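/- Let $\Bbbk$ be an algebraically closed field of characteristic $0$, let $n\ge 2$ and $0\le k\le n-1$, let $\omega\in\Bbbk$ be a primitive $n$th root of unity, and let $\sqrt\omega\in\Bbbk$ be a square root of $\omega$ of multiplicative order $2n$. Let $$A=\Bbbk\langle u,v\rangle/\langle v^2u-\alpha vuv-\beta uv^2,\; vu^2-\alpha uvu-\beta u^2v\rangle,\qquad \alpha=\omega^{-(k+1)}(1+\sqrt\omega),\quad \beta=-\omega^{-2(k+1)}\sqrt\omega,$$ and let $T_n=\Bbbk\langle x,g\mid g^n-1,\ x^n,\ gx-\omega xg\rangle$ be the Taft algebra, with $\Delta(g)=g\otimes g$, $\Delta(x)=g\otimes x+x\otimes 1$, $\varepsilon(g)=1$, $\varepsilon(x)=0$, acting on $A$ so that $A$ is a $T_n$-module algebra with $g\cdot u=\omega^{k+1}u$, $g\cdot v=\omega^k v$, $x\cdot u=0$, $x\cdot v=u$. Put $A^x=\{p\in A\mid x\cdot p=0\}$ and $z=vu-\omega^{-(k+1)}uv$. Then: 1. $A^x$ is the subalgebra of $A$ generated by $u$, $z$, $v^{2n}$ and $x^{n-1}\cdot v^{2n-1}$. 2.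 There is an isomorphism of $\Bbbk$-algebras $$\Bbbk\langle a,b,c,d\rangle\Big/\left\langle\begin{array}{c} ad-da,\ \ bd-db,\ \ cd-dc,\\ ca-\omega^k\sqrt\omega\,ac,\ \ bc-\omega^k\sqrt\omega\,cb,\\ ba-ab-c^n,\ \ a^2-b^{2(n-1)}d\end{array}\right\rangle\ \xrightarrow{\ \sim\ }\ A^x$$ which sends $a\mapsto\gamma\,(x^{n-1}\cdot v^{2n-1})$, $b\mapsto u$, $c\mapsto\eta z$, $d\mapsto v^{2n}$ for some $\gamma,\eta\in\Bbbk^\times$. 3. Let $D$ be the algebra on $a,b,c,d$ with the first six of these relations only, graded by $\deg a=2n-1$, $\deg b=1$, $\deg c=2$, $\deg d=2n$. Then $D$ is Artin–Schelter regular of dimension $4$, and it is an iterated Ore extension $\Bbbk[a][c;\sigma][b;\tau,\delta][d]$, where $\sigma(a)=\omega^k\sqrt\omega\,a$, $\tau(a)=a$, $\tau(c)=\omega^k\sqrt\omega\,c$, $\delta(a)=c^n$, $\delta(c)=0$. 4. The element $f=a^2-b^{2(n-1)}d\in D$ is homogeneous of degree $4n-2$, is neither a left nor a right zero divisor, and is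 normal ($fD=Df$). There is a surjective algebra homomorphism $D\to A^x$, given on generators as in 2 for some $\gamma,\eta\in\Bbbk^\times$, whose kernel is the two-sided ideal generated by $f$. Here a graded algebra $D=\bigoplus_{i\ge0}D_i$ is Artin–Schelter regular of dimension $r$ if $D_0=\Bbbk$, the modules ${}_DD$ and $D_D$ have injective dimension $r$, there is an integer $\ell$ such that, both for left and for right modules, $\operatorname{Ext}^i_D(\Bbbk,D)$ is $0$ for $i\ne r$ and is isomorphic to $\Bbbk[\ell]$ as a graded module for $i=r$, the (left and right) global dimension of $D$ is $r$, and the Gelfand–Kirillov dimension of $D$ is finite. -/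

import Mathlib

universe u

/-! ### A q-binomial identity at a root of unity -/

section QBinomial

variable {𝕜 : Type*} [Field 𝕜] {R : Type*} [Semiring R] [Algebra 𝕜 R]

/-- The Gaussian binomial coefficient `[r + t choose r]_q`, via Pascal's rule. -/
def qChoose (q : 𝕜) : ℕ → ℕ → 𝕜
  | 0, _ => 1
  | _ + 1, 0 => 1
  | r + 1, t + 1 => qChoose q r (t + 1) + q ^ (r + 1) * qChoose q (r + 1) t

/-- The `q`-factorial, up to the factor `(1 - q) ^ r`. -/
def qFact (q : 𝕜) (r : ℕ) : 𝕜 := ∏ i ∈ Finset.range r, (1 - q ^ (i + 1))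

theorem qChoose_zero_right (q : 𝕜) (r : ℕ) : qChoose q r 0 = 1 := by
  cases r <;> simp [qChoose]

theorem qChoose_mul_qFact (q : 𝕜) (r t : ℕ) :
    qChoose q r t * qFact q r * qFact q t = qFact q (r + t) := by
  induction r generalizing t with
  | zero => simp [qChoose, qFact]
  | succ r ihr =>
    induction t with
    | zero => simp [qChoose, qFact]
    | succ t iht =>
      have h1 := ihr (t + 1)
      have h2 : qFact q (r + 1) = qFact q r * (1 - q ^ (r + 1)) := Finset.prod_range_succ _ _
      have h3 : qFact q (t + 1) = qFact q t * (1 - q ^ (t + 1)) := Finset.prod_range_succ _ _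
      have h4 : qFact q (r + 1 + (t + 1)) = qFact q (r + (t + 1)) * (1 - q ^ (r + t + 2)) := by
        have := Finset.prod_range_succ (fun i => (1 - q ^ (i + 1))) (r + (t + 1))
        rw [show r + 1 + (t + 1) = r + (t + 1) + 1 by ring]
        exact this
      have h5 : r + 1 + t = r + (t + 1) := by ring
      rw [h5] at iht
      rw [h4, qChoose]
      calc _ = (qChoose q r (t + 1) * qFact q r * qFact q (t + 1)) * (1 - q ^ (r + 1))
            + q ^ (r + 1) * (qChoose q (r + 1) t * qFact q (r + 1) * qFact q t)
              * (1 - q ^ (t + 1)) := by rw [h2, h3]; ring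
        _ = _ := by rw [h1, iht]; ring

theorem qFact_ne_zero {q : 𝕜} {n r : ℕ} (hq : IsPrimitiveRoot q n) (hr : r < n) :
    qFact q r ≠ 0 := by
  rw [qFact, Finset.prod_ne_zero_iff]
  intro i hi
  have hi' := Finset.mem_range.mp hi
  exact sub_ne_zero.mpr (hq.pow_ne_one_of_pos_of_lt (by omega) (by omega)).symm

theorem qFact_eq_zero {q : 𝕜} {n : ℕ} (hq : IsPrimitiveRoot q n) (hn : 0 < n) :
    qFact q n = 0 := by
  rw [qFact, Finset.prod_eq_zero_iff]
  exact ⟨n - 1, Finset.mem_range.mpr (by omega), by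
    rw [Nat.sub_add_cancel hn, hq.pow_eq_one, sub_self]⟩

theorem qChoose_eq_zero {q : 𝕜} {n r t : ℕ} (hq : IsPrimitiveRoot q n) (h : r + t = n)
    (hr : 0 < r) (ht : 0 < t) : qChoose q r t = 0 := by
  have h1 := qChoose_mul_qFact q r t
  rw [h, qFact_eq_zero hq (by omega)] at h1
  have h2 := qFact_ne_zero hq (r := r) (by omega)
  have h3 := qFact_ne_zero hq (r := t) (by omega)
  simpa [h2, h3] using h1

theorem add_pow_of_qcomm (q : 𝕜) (X Y : R) (h : Y * X = q • (X * Y)) (m : ℕ) :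
    (X + Y) ^ m = ∑ p ∈ Finset.HasAntidiagonal.antidiagonal m, qChoose q p.1 p.2 • (X ^ p.1 * Y ^ p.2) := by
  have hYX : ∀ r : ℕ, Y * X ^ r = q ^ r • (X ^ r * Y) := by
    intro r
    induction r with
    | zero => simp
    | succ r ih =>
      rw [pow_succ, ← mul_assoc, ih, smul_mul_assoc, mul_assoc, h, mul_smul_comm, smul_smul,
        pow_succ, mul_assoc]
  induction m with
  | zero => simp [qChoose]
  | succ m ih =>
    let P : ℕ × ℕ → 𝕜 := fun p => match p with
      | (0, _) => 0
      | (r + 1, t) => qChoose q r t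
    let Q : ℕ × ℕ → 𝕜 := fun p => match p with
      | (_, 0) => 0
      | (r, t + 1) => q ^ r * qChoose q r t
    have hPQ : ∀ p ∈ Finset.HasAntidiagonal.antidiagonal (m + 1), qChoose q p.1 p.2 = P p + Q p := by
      rintro ⟨r, t⟩ hp
      rw [Finset.HasAntidiagonal.mem_antidiagonal] at hp
      rcases r with _ | r <;> rcases t with _ | t
      · simp at hp
      · simp [P, Q, qChoose]
      · simp [P, Q, qChoose_zero_right]
      · simp [P, Q, qChoose]
    have hsplit : ∑ p ∈ Finset.HasAntidiagonal.antidiagonal (m + 1), qChoose q p.1 p.2 • (X ^ p.1 * Y ^ p.2)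
        = ∑ p ∈ Finset.HasAntidiagonal.antidiagonal (m + 1), P p • (X ^ p.1 * Y ^ p.2)
          + ∑ p ∈ Finset.HasAntidiagonal.antidiagonal (m + 1), Q p • (X ^ p.1 * Y ^ p.2) := by
      rw [← Finset.sum_add_distrib]
      refine Finset.sum_congr rfl fun p hp => ?_
      rw [hPQ p hp, add_smul]
    rw [hsplit, Finset.Nat.sum_antidiagonal_succ, Finset.Nat.sum_antidiagonal_succ', pow_succ', ih,
      add_mul, Finset.mul_sum, Finset.mul_sum]
    have e1 : P (0, m + 1) = 0 := rfl
    have e2 : Q (m + 1, 0) = 0 := rfl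
    rw [e1, e2, zero_smul, zero_smul, zero_add, zero_add]
    congr 1
    · refine Finset.sum_congr rfl fun p _ => ?_
      have : P (p.1 + 1, p.2) = qChoose q p.1 p.2 := rfl
      rw [this, mul_smul_comm, ← mul_assoc, ← pow_succ']
    · refine Finset.sum_congr rfl fun p _ => ?_
      have : Q (p.1, p.2 + 1) = q ^ p.1 * qChoose q p.1 p.2 := rfl
      rw [this, mul_smul_comm, ← mul_assoc, hYX, smul_mul_assoc, smul_smul, mul_assoc, ← pow_succ',
        mul_comm]

theorem add_pow_of_qcomm_root {q : 𝕜} {n : ℕ} (hq : IsPrimitiveRoot q n) (hn : 0 < n) (X Y : R)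
    (h : Y * X = q • (X * Y)) : (X + Y) ^ n = X ^ n + Y ^ n := by
  rw [add_pow_of_qcomm q X Y h]
  obtain ⟨m, rfl⟩ : ∃ m, n = m + 1 := ⟨n - 1, by omega⟩
  rw [Finset.Nat.sum_antidiagonal_succ]
  have hlast : ∑ p ∈ Finset.HasAntidiagonal.antidiagonal m,
      qChoose q (p.1 + 1) p.2 • (X ^ (p.1 + 1) * Y ^ p.2) = X ^ (m + 1) := by
    rw [Finset.sum_eq_single (m, 0)]
    · simp [qChoose_zero_right]
    · rintro ⟨r, t⟩ hp hne
      rw [Finset.HasAntidiagonal.mem_antidiagonal] at hp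
      have ht : 0 < t := by
        rcases Nat.eq_zero_or_pos t with h0 | h0
        · exact absurd (by simp at hp; simp [h0]; omega) hne
        · exact h0
      rw [qChoose_eq_zero hq (by simp at hp ⊢; omega) (by simp) ht, zero_smul]
    · intro hp; simp at hp
  rw [hlast]
  simp [qChoose, add_comm]

end QBinomial

/-! ### Down-up algebras -/

section DownUp

variable {𝕜 : Type u} [Field 𝕜]

/-- Names of the two generators of a down-up algebra. -/
inductive DownUpGen : Type
  | u
  | v

/-- The two cubic relations of the graded down-up algebra with parameters `α, β`. -/
inductive DownUpRel (α β : 𝕜) : FreeAlgebra 𝕜 DownUpGen → FreeAlgebra 𝕜 DownUpGen → Prop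
  | vvu : DownUpRel α β
      (FreeAlgebra.ι 𝕜 DownUpGen.v ^ 2 * FreeAlgebra.ι 𝕜 DownUpGen.u)
      (α • (FreeAlgebra.ι 𝕜 DownUpGen.v * FreeAlgebra.ι 𝕜 DownUpGen.u
          * FreeAlgebra.ι 𝕜 DownUpGen.v)
        + β • (FreeAlgebra.ι 𝕜 DownUpGen.u * FreeAlgebra.ι 𝕜 DownUpGen.v ^ 2))
  | vuu : DownUpRel α β
      (FreeAlgebra.ι 𝕜 DownUpGen.v * FreeAlgebra.ι 𝕜 DownUpGen.u ^ 2)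
      (α • (FreeAlgebra.ι 𝕜 DownUpGen.u * FreeAlgebra.ι 𝕜 DownUpGen.v
          * FreeAlgebra.ι 𝕜 DownUpGen.u)
        + β • (FreeAlgebra.ι 𝕜 DownUpGen.u ^ 2 * FreeAlgebra.ι 𝕜 DownUpGen.v))

/-- The graded down-up algebra `A(α, β)`. -/
abbrev DownUp (α β : 𝕜) : Type u := RingQuot (DownUpRel α β)

namespace DownUp

/-- The image of a generator in `A(α, β)`. -/
noncomputable def gen (α β : 𝕜) (i : DownUpGen) : DownUp α β :=
  RingQuot.mkAlgHom 𝕜 (DownUpRel α β) (FreeAlgebra.ι 𝕜 i)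

/-- The generator `u` of `A(α, β)`. -/
noncomputable def u (α β : 𝕜) : DownUp α β := gen α β DownUpGen.u

/-- The generator `v` of `A(α, β)`. -/
noncomputable def v (α β : 𝕜) : DownUp α β := gen α β DownUpGen.v

variable {α β : 𝕜}

theorem rel_vvu : v α β ^ 2 * u α β =
    α • (v α β * u α β * v α β) + β • (u α β * v α β ^ 2) := by
  simpa [u, v, gen] using RingQuot.mkAlgHom_rel 𝕜 (DownUpRel.vvu (α := α) (β := β))

theorem rel_vuu : v α β * u α β ^ 2 =
    α • (u α β * v α β * u α β) + β • (u α β ^ 2 * v α β) := by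
  simpa [u, v, gen] using RingQuot.mkAlgHom_rel 𝕜 (DownUpRel.vuu (α := α) (β := β))

theorem induction {p : DownUp α β → Prop} (hu : p (u α β)) (hv : p (v α β))
    (hc : ∀ r : 𝕜, p (algebraMap 𝕜 _ r)) (hmul : ∀ a b, p a → p b → p (a * b))
    (hadd : ∀ a b, p a → p b → p (a + b)) (a : DownUp α β) : p a := by
  obtain ⟨a, rfl⟩ := RingQuot.mkAlgHom_surjective 𝕜 (DownUpRel α β) a
  induction a using FreeAlgebra.induction with
  | grade0 r => simpa using hc r
  | grade1 i => cases i
                · exact hu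
                · exact hv
  | mul a b ha hb => rw [map_mul]; exact hmul _ _ ha hb
  | add a b ha hb => rw [map_add]; exact hadd _ _ ha hb

end DownUp

end DownUp

/-! ### The Taft algebra and its action on a down-up algebra -/

section Taft

variable {𝕜 : Type u} [Field 𝕜]

/-- Names of the two generators of a Taft algebra. -/
inductive TaftGen : Type
  | g
  | x

/-- The relations `g ^ n = 1`, `x ^ n = 0`, `g x = ω x g` of the Taft algebra. -/
inductive TaftRel (n : ℕ) (ω : 𝕜) : FreeAlgebra 𝕜 TaftGen → FreeAlgebra 𝕜 TaftGen → Prop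
  | g_pow : TaftRel n ω (FreeAlgebra.ι 𝕜 TaftGen.g ^ n) 1
  | x_pow : TaftRel n ω (FreeAlgebra.ι 𝕜 TaftGen.x ^ n) 0
  | g_x : TaftRel n ω (FreeAlgebra.ι 𝕜 TaftGen.g * FreeAlgebra.ι 𝕜 TaftGen.x)
      (ω • (FreeAlgebra.ι 𝕜 TaftGen.x * FreeAlgebra.ι 𝕜 TaftGen.g))

/-- The Taft algebra `T_n`, for `ω` a primitive `n`-th root of unity. -/
abbrev TaftAlgebra (n : ℕ) (ω : 𝕜) : Type u := RingQuot (TaftRel n ω)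

namespace TaftAlgebra

/-- The grouplike generator `g` of `T_n`. -/
noncomputable def g (n : ℕ) (ω : 𝕜) : TaftAlgebra n ω :=
  RingQuot.mkAlgHom 𝕜 (TaftRel n ω) (FreeAlgebra.ι 𝕜 TaftGen.g)

/-- The skew primitive generator `x` of `T_n`. -/
noncomputable def x (n : ℕ) (ω : 𝕜) : TaftAlgebra n ω :=
  RingQuot.mkAlgHom 𝕜 (TaftRel n ω) (FreeAlgebra.ι 𝕜 TaftGen.x)

end TaftAlgebra

/-- The down-up algebra `A(α, β)` with `α = ω^{-(k+1)} (1 + s)` and `β = - ω^{-2(k+1)} s`, where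
`s` is a chosen square root of `ω`. -/
def TaftDownUp (k : ℕ) (ω s : 𝕜) : Type u :=
  DownUp (ω⁻¹ ^ (k + 1) * (1 + s)) (-(ω⁻¹ ^ (2 * (k + 1)) * s))

namespace TaftDownUp

noncomputable instance (k : ℕ) (ω s : 𝕜) : Ring (TaftDownUp k ω s) :=
  inferInstanceAs (Ring (DownUp (ω⁻¹ ^ (k + 1) * (1 + s)) (-(ω⁻¹ ^ (2 * (k + 1)) * s))))

noncomputable instance (k : ℕ) (ω s : 𝕜) : Algebra 𝕜 (TaftDownUp k ω s) :=
  inferInstanceAs (Algebra 𝕜 (DownUp (ω⁻¹ ^ (k + 1) * (1 + s)) (-(ω⁻¹ ^ (2 * (k + 1)) * s))))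

/-- The generator `u` of `A`. -/
noncomputable def u (k : ℕ) (ω s : 𝕜) : TaftDownUp k ω s := DownUp.u _ _

/-- The generator `v` of `A`. -/
noncomputable def v (k : ℕ) (ω s : 𝕜) : TaftDownUp k ω s := DownUp.v _ _

/-- The element `z = v u - ω^{-(k+1)} u v` of `A`. -/
noncomputable def z (k : ℕ) (ω s : 𝕜) : TaftDownUp k ω s :=
  v k ω s * u k ω s - ω⁻¹ ^ (k + 1) • (u k ω s * v k ω s)

theorem induction {k : ℕ} {ω s : 𝕜} {p : TaftDownUp k ω s → Prop} (hu : p (u k ω s))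
    (hv : p (v k ω s)) (hc : ∀ r : 𝕜, p (algebraMap 𝕜 _ r))
    (hmul : ∀ a b, p a → p b → p (a * b)) (hadd : ∀ a b, p a → p b → p (a + b))
    (a : TaftDownUp k ω s) : p a :=
  DownUp.induction hu hv hc hmul hadd a

/-- The matrices `!![g i, x i; 0, i]` for the two generators `i`, where `g` and `x` act on the
generators by `g u = ω^{k+1} u`, `g v = ω^k v`, `x u = 0`, `x v = u`. -/
noncomputable def actionGen (k : ℕ) (ω s : 𝕜) :
    DownUpGen → Matrix (Fin 2) (Fin 2) (TaftDownUp k ω s)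
  | DownUpGen.u => !![ω ^ (k + 1) • u k ω s, 0; 0, u k ω s]
  | DownUpGen.v => !![ω ^ k • v k ω s, u k ω s; 0, v k ω s]

theorem actionGen_rel_aux {S : Type*} [Ring S] [Algebra 𝕜 S] (U V : S) {s d : 𝕜} (hs : s ≠ 0)
    (hd : d ≠ 0) {α β a : 𝕜} (ha : a = s ^ 2 * d) (hα : α = a⁻¹ * (1 + s))
    (hβ : β = -(a⁻¹ ^ 2 * s))
    (h1 : V ^ 2 * U = α • (V * U * V) + β • (U * V ^ 2))
    (h2 : V * U ^ 2 = α • (U * V * U) + β • (U ^ 2 * V)) :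
    let M : Matrix (Fin 2) (Fin 2) S := !![a • U, 0; 0, U]
    let N : Matrix (Fin 2) (Fin 2) S := !![d • V, U; 0, V]
    N ^ 2 * M = α • (N * M * N) + β • (M * N ^ 2) ∧
      N * M ^ 2 = α • (M * N * M) + β • (M ^ 2 * N) := by
  intro M N
  simp only [pow_two, mul_assoc] at h1 h2
  constructor <;> ext i j <;> fin_cases i <;> fin_cases j <;>
    simp [M, N, pow_two, Matrix.mul_apply, Fin.sum_univ_two, mul_assoc, add_mul, mul_add, h1, h2,
      smul_smul]
  all_goals
    subst hα hβ ha
    match_scalars <;> field_simp <;> ring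

theorem actionGen_rel (k : ℕ) {ω s : 𝕜} (hω : ω ≠ 0) (hs : s ^ 2 = ω)
    ⦃a b : FreeAlgebra 𝕜 DownUpGen⦄
    (h : DownUpRel (ω⁻¹ ^ (k + 1) * (1 + s)) (-(ω⁻¹ ^ (2 * (k + 1)) * s)) a b) :
    FreeAlgebra.lift 𝕜 (actionGen k ω s) a = FreeAlgebra.lift 𝕜 (actionGen k ω s) b := by
  have hs0 : s ≠ 0 := by rintro rfl; exact hω (by simpa using hs.symm)
  have key := actionGen_rel_aux (u k ω s) (v k ω s) hs0 (pow_ne_zero k hω)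
    (a := ω ^ (k + 1)) (by rw [pow_succ', hs]) (by rw [inv_pow])
    (by rw [← inv_pow, ← pow_mul, mul_comm 2]) DownUp.rel_vvu DownUp.rel_vuu
  cases h
  · simp only [map_mul, map_pow, map_add, map_smul, FreeAlgebra.lift_ι_apply, actionGen]
    exact key.1
  · simp only [map_mul, map_pow, map_add, map_smul, FreeAlgebra.lift_ι_apply, actionGen]
    exact key.2

/-- The algebra map `a ↦ !![g a, x a; 0, a]`. It is multiplicative exactly because of the rules
`g (a b) = (g a) (g b)` and `x (a b) = (g a) (x b) + (x a) b`. -/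
noncomputable def actionMatrix (k : ℕ) {ω s : 𝕜} (hω : ω ≠ 0) (hs : s ^ 2 = ω) :
    TaftDownUp k ω s →ₐ[𝕜] Matrix (Fin 2) (Fin 2) (TaftDownUp k ω s) :=
  RingQuot.liftAlgHom 𝕜 ⟨FreeAlgebra.lift 𝕜 (actionGen k ω s), actionGen_rel k hω hs⟩

section

variable (k : ℕ) {ω s : 𝕜} (hω : ω ≠ 0) (hs : s ^ 2 = ω)

theorem actionMatrix_u : actionMatrix k hω hs (u k ω s)
    = !![ω ^ (k + 1) • u k ω s, 0; 0, u k ω s] :=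
  (RingQuot.liftAlgHom_mkAlgHom_apply 𝕜 (FreeAlgebra.lift 𝕜 (actionGen k ω s))
    (actionGen_rel k hω hs) (FreeAlgebra.ι 𝕜 DownUpGen.u)).trans
    (FreeAlgebra.lift_ι_apply (actionGen k ω s) DownUpGen.u)

theorem actionMatrix_v : actionMatrix k hω hs (v k ω s)
    = !![ω ^ k • v k ω s, u k ω s; 0, v k ω s] :=
  (RingQuot.liftAlgHom_mkAlgHom_apply 𝕜 (FreeAlgebra.lift 𝕜 (actionGen k ω s))
    (actionGen_rel k hω hs) (FreeAlgebra.ι 𝕜 DownUpGen.v)).trans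
    (FreeAlgebra.lift_ι_apply (actionGen k ω s) DownUpGen.v)

theorem actionMatrix_lower (a : TaftDownUp k ω s) :
    actionMatrix k hω hs a 1 0 = 0 ∧ actionMatrix k hω hs a 1 1 = a := by
  induction a using TaftDownUp.induction with
  | hu => have := actionMatrix_u k hω hs; simp [this]
  | hv => have := actionMatrix_v k hω hs; simp [this]
  | hc r => simp [AlgHom.commutes, Matrix.algebraMap_matrix_apply]
  | hmul a b ha hb => simp [map_mul, Matrix.mul_apply, Fin.sum_univ_two, ha, hb]
  | hadd a b ha hb => simp [map_add, ha, hb]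

/-- The action of `g` on `A`. -/
noncomputable def gAct : Module.End 𝕜 (TaftDownUp k ω s) where
  toFun a := actionMatrix k hω hs a 0 0
  map_add' a b := by simp
  map_smul' r a := by simp

/-- The action of `x` on `A`. -/
noncomputable def xAct : Module.End 𝕜 (TaftDownUp k ω s) where
  toFun a := actionMatrix k hω hs a 0 1
  map_add' a b := by simp
  map_smul' r a := by simp

theorem gAct_u : gAct k hω hs (u k ω s) = ω ^ (k + 1) • u k ω s := by
  simp [gAct, actionMatrix_u]

theorem gAct_v : gAct k hω hs (v k ω s) = ω ^ k • v k ω s := by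
  simp [gAct, actionMatrix_v]

theorem xAct_u : xAct k hω hs (u k ω s) = 0 := by
  simp [xAct, actionMatrix_u]

theorem xAct_v : xAct k hω hs (v k ω s) = u k ω s := by
  simp [xAct, actionMatrix_v]

theorem gAct_algebraMap (r : 𝕜) : gAct k hω hs (algebraMap 𝕜 _ r) = algebraMap 𝕜 _ r := by
  simp [gAct, AlgHom.commutes, Matrix.algebraMap_matrix_apply]

theorem xAct_algebraMap (r : 𝕜) : xAct k hω hs (algebraMap 𝕜 _ r) = 0 := by
  simp [xAct, AlgHom.commutes, Matrix.algebraMap_matrix_apply]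

theorem gAct_mul (a b : TaftDownUp k ω s) :
    gAct k hω hs (a * b) = gAct k hω hs a * gAct k hω hs b := by
  simp [gAct, Matrix.mul_apply, Fin.sum_univ_two, actionMatrix_lower]

theorem xAct_mul (a b : TaftDownUp k ω s) :
    xAct k hω hs (a * b) = gAct k hω hs a * xAct k hω hs b + xAct k hω hs a * b := by
  simp [gAct, xAct, Matrix.mul_apply, Fin.sum_univ_two, actionMatrix_lower]

theorem gAct_pow_mul (m : ℕ) (a b : TaftDownUp k ω s) :
    (gAct k hω hs ^ m) (a * b) = (gAct k hω hs ^ m) a * (gAct k hω hs ^ m) b := by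
  induction m with
  | zero => simp
  | succ m ih => simp only [pow_succ', Module.End.mul_apply, ih, gAct_mul]

theorem gAct_pow {n : ℕ} (hn : ω ^ n = 1) : gAct k hω hs ^ n = 1 := by
  have h : ∀ (m : ℕ) (c : 𝕜) (a : TaftDownUp k ω s), gAct k hω hs a = c • a →
      (gAct k hω hs ^ m) a = c ^ m • a := by
    intro m c a ha
    induction m with
    | zero => simp
    | succ m ih => rw [pow_succ', Module.End.mul_apply, ih, map_smul, ha, smul_smul, pow_succ]
  ext a
  rw [Module.End.one_apply]
  induction a using TaftDownUp.induction with
  | hu => exact (h n _ _ (gAct_u k hω hs)).trans (by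
      rw [← pow_mul, mul_comm, pow_mul, hn, one_pow, one_smul])
  | hv => exact (h n _ _ (gAct_v k hω hs)).trans (by
      rw [← pow_mul, mul_comm, pow_mul, hn, one_pow, one_smul])
  | hc r => simpa using h n 1 _ ((gAct_algebraMap k hω hs r).trans (one_smul _ _).symm)
  | hmul a b ha hb => rw [gAct_pow_mul, ha, hb]
  | hadd a b ha hb => rw [map_add, ha, hb]

theorem gAct_mul_xAct : gAct k hω hs * xAct k hω hs = ω • (xAct k hω hs * gAct k hω hs) := by
  ext a
  simp only [Module.End.mul_apply, LinearMap.smul_apply]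
  induction a using TaftDownUp.induction with
  | hu =>
    have h1 := xAct_u k hω hs
    have h2 := gAct_u k hω hs
    rw [h2, map_smul, h1]; simp
  | hv =>
    have h1 := xAct_v k hω hs
    have h2 := gAct_v k hω hs
    rw [h2, map_smul, h1, gAct_u, smul_smul, pow_succ']
  | hc r => simp [gAct_algebraMap, xAct_algebraMap]
  | hmul a b ha hb =>
    simp only [xAct_mul, gAct_mul, map_add, ha, hb, smul_add, mul_smul_comm, smul_mul_assoc]
  | hadd a b ha hb => simp only [map_add, ha, hb, smul_add]

theorem xAct_pow {n : ℕ} (hn : 2 ≤ n) (hprim : IsPrimitiveRoot ω n) : xAct k hω hs ^ n = 0 := by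
  set G := gAct k hω hs with hG
  set X := xAct k hω hs with hX
  let P : Module.End 𝕜 (TensorProduct 𝕜 (TaftDownUp k ω s) (TaftDownUp k ω s)) :=
    TensorProduct.map X 1
  let Q : Module.End 𝕜 (TensorProduct 𝕜 (TaftDownUp k ω s) (TaftDownUp k ω s)) :=
    TensorProduct.map G X
  let μ := LinearMap.mul' 𝕜 (TaftDownUp k ω s)
  have hμ : ∀ m : ℕ, ∀ w, (X ^ m) (μ w) = μ (((P + Q) ^ m) w) := by
    have h1 : ∀ w, X (μ w) = μ ((P + Q) w) := by
      intro w
      induction w using TensorProduct.induction_on with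
      | zero => simp
      | tmul a b => simp [μ, P, Q, hX, hG, xAct_mul, add_comm]
      | add a b ha hb => simp only [map_add, ha, hb]
    intro m
    induction m with
    | zero => intro w; simp
    | succ m ih =>
      intro w
      rw [pow_succ, Module.End.mul_apply, h1, ih, pow_succ, Module.End.mul_apply]
  have hQP : Q * P = ω • (P * Q) := by
    simp only [P, Q, ← TensorProduct.map_mul, mul_one, one_mul]
    rw [hG, hX, gAct_mul_xAct, TensorProduct.map_smul_left]
  have hpow : (P + Q) ^ n = TensorProduct.map (X ^ n) 1 + TensorProduct.map (G ^ n) (X ^ n) := by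
    rw [add_pow_of_qcomm_root hprim (by omega) P Q hQP]
    simp only [P, Q, TensorProduct.map_pow, one_pow]
  have hX2 : ∀ a, X (X a) = 0 → (X ^ n) a = 0 := by
    intro a ha
    obtain ⟨m, rfl⟩ : ∃ m, n = m + 2 := ⟨n - 2, by omega⟩
    rw [pow_add, Module.End.mul_apply, pow_two, Module.End.mul_apply, ha, map_zero]
  ext a
  rw [LinearMap.zero_apply]
  induction a using TaftDownUp.induction with
  | hu =>
    apply hX2
    have h1 := xAct_u k hω hs
    rw [hX, h1, map_zero]
  | hv =>
    apply hX2
    have h1 := xAct_v k hω hs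
    rw [hX, h1, xAct_u]
  | hc r => exact hX2 _ (by rw [hX, xAct_algebraMap, map_zero])
  | hmul a b ha hb =>
    have := hμ n (a ⊗ₜ[𝕜] b)
    rw [hpow] at this
    simpa [μ, ha, hb] using this
  | hadd a b ha hb => rw [map_add, ha, hb, add_zero]

end

/-- The action of the Taft algebra `T_n` on `A`, as a representation of `T_n`. -/
noncomputable def taftAction (n k : ℕ) {ω s : 𝕜} (hn : 2 ≤ n) (hω : IsPrimitiveRoot ω n)
    (hs : s ^ 2 = ω) : TaftAlgebra n ω →ₐ[𝕜] Module.End 𝕜 (TaftDownUp k ω s) :=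
  have h0 : ω ≠ 0 := hω.ne_zero (by omega)
  RingQuot.liftAlgHom 𝕜 ⟨FreeAlgebra.lift 𝕜 fun i => match i with
    | TaftGen.g => gAct k h0 hs
    | TaftGen.x => xAct k h0 hs, by
      intro a b h
      cases h
      · simpa using gAct_pow k h0 hs hω.pow_eq_one
      · simpa using xAct_pow k h0 hs hn hω
      · simpa using gAct_mul_xAct k h0 hs⟩

section

variable (n k : ℕ) {ω s : 𝕜} (hn : 2 ≤ n) (hω : IsPrimitiveRoot ω n) (hs : s ^ 2 = ω)

theorem taftAction_g : taftAction n k hn hω hs (TaftAlgebra.g n ω)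
    = gAct k (hω.ne_zero (by omega)) hs := by
  simp [taftAction, TaftAlgebra.g, RingQuot.liftAlgHom_mkAlgHom_apply]

theorem taftAction_x : taftAction n k hn hω hs (TaftAlgebra.x n ω)
    = xAct k (hω.ne_zero (by omega)) hs := by
  simp [taftAction, TaftAlgebra.x, RingQuot.liftAlgHom_mkAlgHom_apply]

/-- The action of `T_n` on `A` satisfies the axioms of a module algebra for the Hopf structure
`Δ g = g ⊗ g`, `Δ x = g ⊗ x + x ⊗ 1`, `ε g = 1`, `ε x = 0`, and it has the prescribed values on
the generators `u` and `v`. -/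
theorem taftAction_spec :
    let G := taftAction n k hn hω hs (TaftAlgebra.g n ω)
    let X := taftAction n k hn hω hs (TaftAlgebra.x n ω)
    (∀ a b, G (a * b) = G a * G b) ∧ (∀ a b, X (a * b) = G a * X b + X a * b) ∧
      G 1 = 1 ∧ X 1 = 0 ∧
      G (u k ω s) = ω ^ (k + 1) • u k ω s ∧ G (v k ω s) = ω ^ k • v k ω s ∧
      X (u k ω s) = 0 ∧ X (v k ω s) = u k ω s := by
  intro G X
  have h0 : ω ≠ 0 := hω.ne_zero (by omega)
  simp only [G, X, taftAction_g, taftAction_x]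
  refine ⟨gAct_mul k h0 hs, xAct_mul k h0 hs, ?_, ?_, gAct_u k h0 hs, gAct_v k h0 hs,
    xAct_u k h0 hs, xAct_v k h0 hs⟩
  · simpa using gAct_algebraMap k h0 hs 1
  · simpa using xAct_algebraMap k h0 hs 1

/-- The subring `A^x = {a ∈ A | x · a = 0}` of `x`-invariant elements. -/
noncomputable def xInvariants : Subalgebra 𝕜 (TaftDownUp k ω s) where
  carrier := {a | taftAction n k hn hω hs (TaftAlgebra.x n ω) a = 0}
  mul_mem' {a b} ha hb := by
    simp only [Set.mem_ofPred_eq] at ha hb ⊢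
    rw [(taftAction_spec n k hn hω hs).2.1, ha, hb, mul_zero, zero_mul, add_zero]
  add_mem' {a b} ha hb := by
    simp only [Set.mem_ofPred_eq] at ha hb ⊢
    rw [map_add, ha, hb, add_zero]
  algebraMap_mem' r := by
    simp only [Set.mem_ofPred_eq, taftAction_x]
    exact xAct_algebraMap k _ hs r

/-- The element `x^{n-1} · v^{2n-1}` of `A`. -/
noncomputable def aElt : TaftDownUp k ω s :=
  taftAction n k hn hω hs (TaftAlgebra.x n ω ^ (n - 1)) (v k ω s ^ (2 * n - 1))

end

end TaftDownUp

end Taft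

/-! ### The algebras on four generators -/

section Presentation

variable {𝕜 : Type u} [Field 𝕜]

/-- Names of the four generators. -/
inductive FourGen : Type
  | a
  | b
  | c
  | d

/-- The relations `ad = da`, `bd = db`, `cd = dc`, `ca = q ac`, `bc = q cb`, `ba = ab + c ^ n`. -/
inductive OreRel (n : ℕ) (q : 𝕜) : FreeAlgebra 𝕜 FourGen → FreeAlgebra 𝕜 FourGen → Prop
  | ad : OreRel n q (FreeAlgebra.ι 𝕜 FourGen.a * FreeAlgebra.ι 𝕜 FourGen.d)
      (FreeAlgebra.ι 𝕜 FourGen.d * FreeAlgebra.ι 𝕜 FourGen.a)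
  | bd : OreRel n q (FreeAlgebra.ι 𝕜 FourGen.b * FreeAlgebra.ι 𝕜 FourGen.d)
      (FreeAlgebra.ι 𝕜 FourGen.d * FreeAlgebra.ι 𝕜 FourGen.b)
  | cd : OreRel n q (FreeAlgebra.ι 𝕜 FourGen.c * FreeAlgebra.ι 𝕜 FourGen.d)
      (FreeAlgebra.ι 𝕜 FourGen.d * FreeAlgebra.ι 𝕜 FourGen.c)
  | ca : OreRel n q (FreeAlgebra.ι 𝕜 FourGen.c * FreeAlgebra.ι 𝕜 FourGen.a)
      (q • (FreeAlgebra.ι 𝕜 FourGen.a * FreeAlgebra.ι 𝕜 FourGen.c))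
  | bc : OreRel n q (FreeAlgebra.ι 𝕜 FourGen.b * FreeAlgebra.ι 𝕜 FourGen.c)
      (q • (FreeAlgebra.ι 𝕜 FourGen.c * FreeAlgebra.ι 𝕜 FourGen.b))
  | ba : OreRel n q (FreeAlgebra.ι 𝕜 FourGen.b * FreeAlgebra.ι 𝕜 FourGen.a)
      (FreeAlgebra.ι 𝕜 FourGen.a * FreeAlgebra.ι 𝕜 FourGen.b + FreeAlgebra.ι 𝕜 FourGen.c ^ n)

/-- The relations above together with `a ^ 2 = b ^ (2(n-1)) d`. -/
inductive FactorRel (n : ℕ) (q : 𝕜) : FreeAlgebra 𝕜 FourGen → FreeAlgebra 𝕜 FourGen → Prop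
  | ore {x y : FreeAlgebra 𝕜 FourGen} (h : OreRel n q x y) : FactorRel n q x y
  | aa : FactorRel n q (FreeAlgebra.ι 𝕜 FourGen.a ^ 2)
      (FreeAlgebra.ι 𝕜 FourGen.b ^ (2 * (n - 1)) * FreeAlgebra.ι 𝕜 FourGen.d)

/-- The algebra on `a, b, c, d` with the first six relations only. -/
abbrev OreAlg (n : ℕ) (q : 𝕜) : Type u := RingQuot (OreRel n q)

/-- The algebra on `a, b, c, d` with all seven relations. -/
abbrev FactorAlg (n : ℕ) (q : 𝕜) : Type u := RingQuot (FactorRel n q)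

/-- The generators of `OreAlg n q`. -/
noncomputable def OreAlg.gen (n : ℕ) (q : 𝕜) (i : FourGen) : OreAlg n q :=
  RingQuot.mkAlgHom 𝕜 (OreRel n q) (FreeAlgebra.ι 𝕜 i)

/-- The generators of `FactorAlg n q`. -/
noncomputable def FactorAlg.gen (n : ℕ) (q : 𝕜) (i : FourGen) : FactorAlg n q :=
  RingQuot.mkAlgHom 𝕜 (FactorRel n q) (FreeAlgebra.ι 𝕜 i)

/-- The element `f = a ^ 2 - b ^ (2(n-1)) d` of `OreAlg n q`. -/
noncomputable def OreAlg.f (n : ℕ) (q : 𝕜) : OreAlg n q :=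
  gen n q FourGen.a ^ 2 - gen n q FourGen.b ^ (2 * (n - 1)) * gen n q FourGen.d

/-- The degrees `2n - 1, 1, 2, 2n` of `a, b, c, d`. -/
def fourDegree (n : ℕ) : FourGen → ℕ
  | FourGen.a => 2 * n - 1
  | FourGen.b => 1
  | FourGen.c => 2
  | FourGen.d => 2 * n

/-- The degree `m` part of `OreAlg n q`: the span of all words in the generators of total
degree `m`. -/
noncomputable def OreAlg.grading (n : ℕ) (q : 𝕜) (m : ℕ) : Submodule 𝕜 (OreAlg n q) :=
  Submodule.span 𝕜 {y | ∃ l : List FourGen, (l.map (fourDegree n)).sum = m ∧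
    y = (l.map (gen n q)).prod}

end Presentation

/-! ### Ore extensions -/

section Ore

variable {𝕜 : Type u} [Field 𝕜] {S : Type u} [Ring S] [Algebra 𝕜 S]

/-- For subalgebras `R ≤ T` of `S`, an automorphism `σ` and a linear endomorphism `δ` of `R`,
this says that `T` is the Ore extension `R[y; σ, δ]`: `δ` is a `σ`-derivation,
`y r = σ(r) y + δ(r)` for `r ∈ R`, and `T` is free as a left `R`-module on the powers of `y`. -/
structure IsOreExtension (R T : Subalgebra 𝕜 S) (y : S) (σ : R ≃ₐ[𝕜] R) (δ : R →ₗ[𝕜] R) :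
    Prop where
  le : R ≤ T
  mem : y ∈ T
  derivation : ∀ r r' : R, δ (r * r') = σ r * δ r' + δ r * r'
  comm : ∀ r : R, y * (r : S) = (σ r : S) * y + (δ r : S)
  basis : ∀ t ∈ T, ∃! p : ℕ →₀ R, t = p.sum fun i r => (r : S) * y ^ i

end Ore

/-! ### Artin-Schelter regular algebras -/

section ASRegular

open MulOpposite

variable {𝕜 : Type u} [Field 𝕜] {A : Type u} [Ring A] [Algebra 𝕜 A]

/-- `A` is the direct sum of the subspaces `𝒜 m`, these multiply as degrees, and `𝒜 0 = 𝕜`. -/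
structure IsConnectedGraded (𝒜 : ℕ → Submodule 𝕜 A) : Prop where
  gradedMonoid : SetLike.GradedMonoid 𝒜
  isInternal : DirectSum.IsInternal 𝒜
  connected : Module.finrank 𝕜 (𝒜 0) = 1

/-- The grading on the opposite algebra. -/
def opGrading (𝒜 : ℕ → Submodule 𝕜 A) (m : ℕ) : Submodule 𝕜 Aᵐᵒᵖ :=
  (𝒜 m).map (opLinearEquiv 𝕜 : A ≃ₗ[𝕜] Aᵐᵒᵖ).toLinearMap

/-- The homogeneous parts indexed by integers; those of negative degree are zero. -/
def intPiece (𝒜 : ℕ → Submodule 𝕜 A) : ℤ → Submodule 𝕜 A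
  | Int.ofNat m => 𝒜 m
  | Int.negSucc _ => ⊥

/-- The ideal `A_{≥ 1}`, as a left ideal. -/
def irrelevantIdeal (𝒜 : ℕ → Submodule 𝕜 A) : Submodule A A :=
  Submodule.span A {a | ∃ m, 1 ≤ m ∧ a ∈ 𝒜 m}

/-- The trivial left module `A / A_{≥ 1}`. -/
abbrev TrivialModule (𝒜 : ℕ → Submodule 𝕜 A) : Type u := A ⧸ irrelevantIdeal 𝒜

/-- A resolution of the trivial left module `A / A_{≥ 1}` by finitely generated graded free left
modules. The `i`-th term has a basis `e_s`, `s : Fin (rank i)`, with `e_s` in degree `deg i s`,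
and all maps are homogeneous of degree zero. -/
structure GradedFreeResolution (𝒜 : ℕ → Submodule 𝕜 A) where
  rank : ℕ → ℕ
  deg : ∀ i, Fin (rank i) → ℤ
  d : ∀ i, (Fin (rank (i + 1)) → A) →ₗ[A] (Fin (rank i) → A)
  aug : (Fin (rank 0) → A) →ₗ[A] TrivialModule 𝒜
  d_homogeneous : ∀ i s t, d i (Pi.single s 1) t ∈ intPiece 𝒜 (deg (i + 1) s - deg i t)
  aug_homogeneous : ∀ s, deg 0 s ≠ 0 → aug (Pi.single s 1) = 0
  aug_surjective : Function.Surjective aug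
  exact_zero : Function.Exact (d 0) aug
  exact_succ : ∀ i, Function.Exact (d (i + 1)) (d i)

namespace GradedFreeResolution

variable {𝒜 : ℕ → Submodule 𝕜 A} (P : GradedFreeResolution 𝒜)

/-- `Hom_A(P_i, A)`, a right `A`-module through the right multiplication on `A`. -/
abbrev Cochain (i : ℕ) : Type u := (Fin (P.rank i) → A) →ₗ[A] A

/-- The differential of the complex `Hom_A(P, A)` of right `A`-modules. -/
def coboundary (i : ℕ) : P.Cochain i →ₗ[Aᵐᵒᵖ] P.Cochain (i + 1) where
  toFun φ := φ.comp (P.d i)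
  map_add' _ _ := rfl
  map_smul' _ _ := rfl

/-- The cocycles in `Hom_A(P_i, A)`. -/
def cocycles (i : ℕ) : Submodule Aᵐᵒᵖ (P.Cochain i) := LinearMap.ker (P.coboundary i)

/-- The coboundaries in `Hom_A(P_i, A)`. -/
def coboundaries : ∀ i : ℕ, Submodule Aᵐᵒᵖ (P.Cochain i)
  | 0 => ⊥
  | i + 1 => LinearMap.range (P.coboundary i)

/-- The right `A`-module `Ext^i_A(𝕜, A)`, computed from the resolution `P`: cocycles modulo
coboundaries, as the image of the cocycles in the cochains modulo coboundaries. -/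
def ext (i : ℕ) : Submodule Aᵐᵒᵖ (P.Cochain i ⧸ P.coboundaries i) :=
  (P.cocycles i).map (P.coboundaries i).mkQ

/-- The class in `Ext^i_A(𝕜, A)` of a cocycle. -/
def extClass {i : ℕ} (φ : P.cocycles i) : P.ext i :=
  ⟨(P.coboundaries i).mkQ φ.1, Submodule.mem_map_of_mem φ.2⟩

/-- A homomorphism `P_i → A` is homogeneous of degree `j` if it raises degrees by `j`. -/
def IsHomogeneous {i : ℕ} (φ : P.Cochain i) (j : ℤ) : Prop :=
  ∀ s, φ (Pi.single s 1) ∈ intPiece 𝒜 (P.deg i s + j)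

end GradedFreeResolution

/-- `Ext^i_A(𝕜, A)` of left modules is zero for `i ≠ d`, and for `i = d` it is isomorphic as a
graded right module to `𝕜[ℓ]`, which is the trivial right module placed in degree `-ℓ`. -/
def ExtCondition (𝒜 : ℕ → Submodule 𝕜 A) (d : ℕ) (ℓ : ℤ) : Prop :=
  ∃ P : GradedFreeResolution 𝒜, (∀ i, i ≠ d → Subsingleton (P.ext i)) ∧
    ∃ e : P.ext d ≃ₗ[Aᵐᵒᵖ] TrivialModule (opGrading 𝒜),
      ∀ (j : ℤ) (φ : P.cocycles d), P.IsHomogeneous φ.1 j → j ≠ -ℓ →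
        e (P.extClass φ) = 0

/-- Artin-Schelter Gorenstein of dimension `d`. Right modules are left modules over `Aᵐᵒᵖ`. -/
structure IsASGorenstein (𝒜 : ℕ → Submodule 𝕜 A) (d : ℕ) : Prop where
  connectedGraded : IsConnectedGraded 𝒜
  left_injdim : CategoryTheory.injectiveDimension (ModuleCat.of A A) = d
  right_injdim : CategoryTheory.injectiveDimension (ModuleCat.of Aᵐᵒᵖ A) = d
  ext : ∃ ℓ : ℤ, ExtCondition 𝒜 d ℓ ∧ ExtCondition (opGrading 𝒜) d ℓ

/-- The left global dimension: the supremum of the projective dimensions of all left modules. -/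
noncomputable def globalDim (B : Type u) [Ring B] : WithBot ℕ∞ :=
  ⨆ M : ModuleCat.{u} B, CategoryTheory.projectiveDimension M

variable (𝕜 A) in
/-- The Gelfand-Kirillov dimension: the supremum over finite dimensional subspaces `V` of
`limsup log dim (𝕜 + V + ⋯ + V ^ m) / log m`. -/
noncomputable def gkDim : EReal :=
  ⨆ (V : Submodule 𝕜 A) (_ : FiniteDimensional 𝕜 V),
    Filter.limsup (fun m : ℕ =>
      ((Real.log (Module.finrank 𝕜 ((1 ⊔ V) ^ m : Submodule 𝕜 A)) / Real.log m : ℝ) : EReal))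
      Filter.atTop

/-- Artin-Schelter regular of dimension `d`. -/
structure IsASRegular (𝒜 : ℕ → Submodule 𝕜 A) (d : ℕ) : Prop where
  gorenstein : IsASGorenstein 𝒜 d
  left_gldim : globalDim A = d
  right_gldim : globalDim Aᵐᵒᵖ = d
  gkDim_lt_top : gkDim 𝕜 A < ⊤

end ASRegular

/-! ### The iterated Ore extension -/

section IteratedOre

variable {𝕜 : Type u} [Field 𝕜]

/-- `OreAlg n q` is the iterated Ore extension `𝕜[a][c; σ][b; τ, δ][d]` with `σ a = q a`,
`τ a = a`, `τ c = q c`, `δ a = c ^ n`, `δ c = 0`; the first and the last step are ordinary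
polynomial extensions. -/
def OreAlg.IsIteratedOreExtension (n : ℕ) (q : 𝕜) : Prop :=
  let a := OreAlg.gen n q FourGen.a
  let b := OreAlg.gen n q FourGen.b
  let c := OreAlg.gen n q FourGen.c
  let d := OreAlg.gen n q FourGen.d
  let R₁ : Subalgebra 𝕜 (OreAlg n q) := Algebra.adjoin 𝕜 {a}
  let R₂ : Subalgebra 𝕜 (OreAlg n q) := Algebra.adjoin 𝕜 {a, c}
  let R₃ : Subalgebra 𝕜 (OreAlg n q) := Algebra.adjoin 𝕜 {a, c, b}
  IsOreExtension ⊥ R₁ a AlgEquiv.refl 0 ∧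
  (∃ σ : R₁ ≃ₐ[𝕜] R₁, (∀ r : R₁, (r : OreAlg n q) = a → (σ r : OreAlg n q) = q • a) ∧
    IsOreExtension R₁ R₂ c σ 0) ∧
  (∃ (τ : R₂ ≃ₐ[𝕜] R₂) (δ : R₂ →ₗ[𝕜] R₂),
    (∀ r : R₂, (r : OreAlg n q) = a →
      (τ r : OreAlg n q) = a ∧ (δ r : OreAlg n q) = c ^ n) ∧
    (∀ r : R₂, (r : OreAlg n q) = c →
      (τ r : OreAlg n q) = q • c ∧ (δ r : OreAlg n q) = 0) ∧
    IsOreExtension R₂ R₃ b τ δ) ∧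
  IsOreExtension R₃ ⊤ d AlgEquiv.refl 0

end IteratedOre

/-!
## Why the theorem holds

Write `r = ω⁻¹ ^ (k + 1)` and `q = ω ^ k * s = (r * s)⁻¹`; since `s` has order `2n`, `q ^ n = -1`.

**The invariants.** The elements `u, v, z` satisfy `v u = r u v + z`, `z u = r s u z` and
`v z = r s z v`, and the monomials `u ^ i z ^ j v ^ l` are a basis of `A`. Since `x` kills `u` and
`z`, its action is determined by
`x · v ^ l = coeffA l • u v ^ (l - 1) + coeffB l • z v ^ (l - 2)`, where both coefficients have
closed forms: `coeffA l = 0` only if `n ∣ l`, and `coeffB l = 0` only if `l` is `0` or `1` modulo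
`2n`. Hence the equation `x · y = 0` determines all coordinates of `y` from those at
`u ^ i z ^ j v ^ (2nm)` and at `u ^ (i + n - 1) z ^ j v ^ (2nm + n)`
(`TaftDownUp.eq_zero_of_xAct_eq_zero`). With `w = x ^ (n - 1) · v ^ (2n - 1)`, the invariants
`u ^ i z ^ j w ^ ε v ^ (2nm)`, `ε ≤ 1`, have a diagonal matrix of such coordinates, so they are a
basis of `A^x`, which gives the generators. The same lemma proves the relations: `w u - u w` and
`w ^ 2` are invariants, and for reasons of bidegree in `u` and `v` only one or two of the
determining coordinates can be nonzero, so that `w u - u w` is a nonzero multiple of `z ^ n` and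
`w ^ 2` is a nonzero multiple of `u ^ (2n - 2) v ^ (2n)`. Conversely, the seven relations allow one
to rewrite each element of `FactorAlg n q` in terms of the monomials `b ^ i c ^ j a ^ ε d ^ m`, whose
images are the basis of `A^x`.

**The algebra with six relations.** A representation shows that the monomials
`a ^ i c ^ j b ^ k d ^ l` are a basis of `OreAlg n q`, hence it is an iterated Ore extension. Passing
from `R` to `R[x; σ, δ]` raises the global dimension by at most one
(`hasInjectiveDimensionLT_of_ore`). Both on the left and on the right, `d, c, b, a` is a regular
sequence in the sense that each of these elements acts injectively on the quotient by the previous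
ones; iterated mapping cones of liftings of these actions give a Koszul resolution of the trivial
module (`koszulResolution`) of length four, whose dual is again of this type. It yields the `Ext`
condition, and, since `Ext ^ 4` is not zero, the exact values of the dimensions. The opposite algebra
is of the same form with `q⁻¹` in place of `q`. Finally `f` is normal since `q ^ n = -1` makes
`a ^ 2` commute with `b`, and `b ^ 2` with `a`; it is regular by comparing exponents of `a`.
-/

/-! ### Injective dimension over an Ore extension -/

section OreInjectiveDimension

open CategoryTheory

variable {R S : Type u} [Ring R] [Ring S]

/-- If every element of `S` is uniquely a finite sum `∑ f (r i) * x ^ i`, then `S` is a free left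
`R`-module on the powers of `x`. -/
noncomputable def oreBasis (f : R →+* S) (x : S)
    (h : ∀ t : S, ∃! p : ℕ →₀ R, t = p.sum fun i r => f r * x ^ i) :
    Module.Basis ℕ R ((ModuleCat.restrictScalars f).obj (ModuleCat.of S S)) :=
  Module.Basis.ofRepr (LinearEquiv.ofBijective
    (Finsupp.linearCombination R
      (M := (ModuleCat.restrictScalars f).obj (ModuleCat.of S S)) fun i => (x ^ i : S)) (by
      have key : ∀ p : ℕ →₀ R, Finsupp.linearCombination R
          (M := (ModuleCat.restrictScalars f).obj (ModuleCat.of S S)) (fun i => (x ^ i : S)) p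
          = (p.sum fun i r => f r * x ^ i : S) := fun p => rfl
      constructor
      · intro p p' hp
        obtain ⟨p₀, -, h0⟩ := h (p.sum fun i r => f r * x ^ i)
        rw [h0 p rfl, h0 p' (by rw [key, key] at hp; exact hp)]
      · intro t
        obtain ⟨p₀, h0, -⟩ := h t
        exact ⟨p₀, by rw [key]; exact h0.symm⟩)).symm

theorem oreBasis_apply (f : R →+* S) (x : S)
    (h : ∀ t : S, ∃! p : ℕ →₀ R, t = p.sum fun i r => f r * x ^ i) (i : ℕ) :
    oreBasis f x h i = (x ^ i : S) := by
  have h1 : oreBasis f x h i = Finsupp.linearCombination R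
      (M := (ModuleCat.restrictScalars f).obj (ModuleCat.of S S)) (fun i => (x ^ i : S))
      (Finsupp.single i 1) := rfl
  exact h1.trans ((Finsupp.linearCombination_single R _ _).trans (one_smul _ _))

/-- Coextension of scalars along a ring homomorphism over which the target is a projective left
module does not raise the injective dimension: it is exact and preserves injective modules. -/
theorem hasInjectiveDimensionLT_coextendScalars (f : R →+* S)
    [Module.Projective R ((ModuleCat.restrictScalars f).obj (ModuleCat.of S S))] (n : ℕ)
    (M : ModuleCat.{u} R) (h : HasInjectiveDimensionLT M (n + 1)) :
    HasInjectiveDimensionLT ((ModuleCat.coextendScalars f).obj M) (n + 1) := by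
  induction n generalizing M with
  | zero =>
    rw [zero_add, ← injective_iff_hasInjectiveDimensionLT_one] at h ⊢
    exact (ModuleCat.restrictCoextendScalarsAdj f).map_injective M h
  | succ n ih =>
    obtain ⟨I, _, j, _⟩ := EnoughInjectives.presentation M
    have hj : Function.Injective j.hom := (ModuleCat.mono_iff_injective j).mp ‹_›
    let C : ModuleCat.{u} R := ModuleCat.of R (I ⧸ LinearMap.range j.hom)
    let π : I ⟶ C := ModuleCat.ofHom (Submodule.mkQ _)
    have hex : Function.Exact j.hom π.hom := j.hom.exact_map_mkQ_range
    have hπ : Function.Surjective π.hom := Submodule.mkQ_surjective _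
    have hS := ModuleCat.shortComplex_shortExact
      (ModuleCat.shortComplexOfCompEqZero _ _ hex.linearMap_comp_eq_zero) hex hj hπ
    have hC : HasInjectiveDimensionLT C (n + 1) :=
      (hS.hasInjectiveDimensionLT_X₃_iff n inferInstance).mpr h
    let F := ModuleCat.coextendScalars.{u, u, u} f
    have hI : Injective (F.obj I) :=
      (ModuleCat.restrictCoextendScalarsAdj f).map_injective I inferInstance
    have hex' : Function.Exact (F.map j).hom (F.map π).hom := by
      intro φ
      constructor
      · intro hφ
        have h1 : ∀ t : S, φ t ∈ LinearMap.range j.hom := fun t => by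
          have : π.hom (φ t) = 0 := by
            have := congrArg (fun ψ : F.obj C => ψ t) hφ
            exact this
          exact (hex _).mp this
        refine ⟨(ModuleCat.CoextendScalars.equiv f M).symm
          ((LinearEquiv.ofInjective j.hom hj).symm.toLinearMap ∘ₗ
            LinearMap.codRestrict _ (ModuleCat.CoextendScalars.equiv f I φ) h1), ?_⟩
        refine ModuleCat.CoextendScalars.ext (LinearMap.ext fun t => ?_)
        exact congrArg Subtype.val
          ((LinearEquiv.ofInjective j.hom hj).apply_symm_apply ⟨φ t, h1 t⟩)
      · rintro ⟨ψ, rfl⟩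
        refine ModuleCat.CoextendScalars.ext (LinearMap.ext fun t => ?_)
        exact (hex _).mpr ⟨ψ t, rfl⟩
    have hj' : Function.Injective (F.map j).hom := by
      intro φ ψ hφ
      refine ModuleCat.CoextendScalars.ext (LinearMap.ext fun t => hj ?_)
      exact congrArg (fun χ : F.obj I => χ t) hφ
    have hπ' : Function.Surjective (F.map π).hom := by
      intro φ
      obtain ⟨ψ, hψ⟩ := Module.projective_lifting_property π.hom
        (ModuleCat.CoextendScalars.equiv f C φ) hπ
      exact ⟨(ModuleCat.CoextendScalars.equiv f I).symm ψ,
        ModuleCat.CoextendScalars.ext hψ⟩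
    have hS' := ModuleCat.shortComplex_shortExact
      (ModuleCat.shortComplexOfCompEqZero _ _ hex'.linearMap_comp_eq_zero) hex' hj' hπ'
    exact (hS'.hasInjectiveDimensionLT_X₃_iff n hI).mp (ih C hC)

/-- If all left modules over `R` have injective dimension at most `n`, then all left modules over
an Ore extension `S = R[x; σ, δ]` have injective dimension at most `n + 1`. For a left `S`-module
`M`, this follows from the exact sequence `0 → M → Hom_R(S, M) → Hom_R(S, M^σ) → 0`, in which the
second map sends `φ` to `t ↦ x φ(t) - φ(x t)`. -/
theorem hasInjectiveDimensionLT_of_ore (f : R →+* S) (x : S) (σ : R →+* R) (δ : R → R)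
    (comm : ∀ r, x * f r = f (σ r) * x + f (δ r))
    (basis : ∀ t : S, ∃! p : ℕ →₀ R, t = p.sum fun i r => f r * x ^ i) (n : ℕ)
    (h : ∀ M : ModuleCat.{u} R, HasInjectiveDimensionLT M (n + 1)) (M : ModuleCat.{u} S) :
    HasInjectiveDimensionLT M (n + 2) := by
  let B := oreBasis f x basis
  have hB : ∀ i, B i = (x ^ i : S) := oreBasis_apply f x basis
  have : Module.Projective R ((ModuleCat.restrictScalars f).obj (ModuleCat.of S S)) :=
    Module.Projective.of_basis B
  let N := (ModuleCat.restrictScalars f).obj M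
  let N' := (ModuleCat.restrictScalars σ).obj N
  let F := ModuleCat.coextendScalars.{u, u, u} f
  -- values of elements of the coextended modules, as elements of `M`
  let ev : F.obj N → S → M := fun φ t => φ t
  let ev' : F.obj N' → S → M := fun φ t => φ t
  have lin : ∀ (φ : F.obj N) (r : R) (t : S), ev φ (f r * t) = f r • ev φ t :=
    fun φ r t => (ModuleCat.CoextendScalars.equiv f N φ).map_smul r t
  have ladd : ∀ (φ : F.obj N) (t t' : S), ev φ (t + t') = ev φ t + ev φ t' :=
    fun φ t t' => (ModuleCat.CoextendScalars.equiv f N φ).map_add t t'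
  have hext : ∀ φ ψ : F.obj N, (∀ i, ev φ (x ^ i) = ev ψ (x ^ i)) → φ = ψ := fun φ ψ hφ =>
    ModuleCat.CoextendScalars.ext (B.ext fun i => by rw [hB]; exact hφ i)
  have hext' : ∀ φ ψ : F.obj N', (∀ i, ev' φ (x ^ i) = ev' ψ (x ^ i)) → φ = ψ := fun φ ψ hφ =>
    ModuleCat.CoextendScalars.ext (B.ext fun i => by rw [hB]; exact hφ i)
  let ι : M →ₗ[S] F.obj N := ((ModuleCat.restrictCoextendScalarsAdj f).unit.app M).hom
  have hι : ∀ (m : M) (t : S), ev (ι m) t = t • m := fun m t => rfl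
  let Γ (φ : F.obj N) : (ModuleCat.restrictScalars f).obj (ModuleCat.of S S) →ₗ[R] N' :=
    { toFun := fun (t : S) => (id (x • ev φ t - ev φ (x * t)) : M)
      map_add' := fun (t t' : S) => by
        have h1 : x • ev φ (t + t') - ev φ (x * (t + t'))
            = (x • ev φ t - ev φ (x * t)) + (x • ev φ t' - ev φ (x * t')) := by
          rw [mul_add, ladd, ladd, smul_add]
          abel
        exact h1
      map_smul' := fun r (t : S) => by
        have h1 : x • ev φ (f r * t) - ev φ (x * (f r * t))
            = f (σ r) • (x • ev φ t - ev φ (x * t)) := by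
          rw [← mul_assoc, comm, add_mul, mul_assoc, ladd, lin, lin, lin, ← mul_smul, comm,
            smul_sub, add_smul, mul_smul]
          abel
        exact h1 }
  let g : F.obj N →ₗ[S] F.obj N' :=
    { toFun := fun φ => (ModuleCat.CoextendScalars.equiv f N').symm (Γ φ)
      map_add' := fun φ ψ => by
        refine hext' _ _ fun i => ?_
        change x • (ev φ (x ^ i) + ev ψ (x ^ i)) - (ev φ (x * x ^ i) + ev ψ (x * x ^ i))
          = (x • ev φ (x ^ i) - ev φ (x * x ^ i)) + (x • ev ψ (x ^ i) - ev ψ (x * x ^ i))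
        rw [smul_add]
        abel
      map_smul' := fun r φ => by
        refine hext' _ _ fun i => ?_
        change x • ev φ (x ^ i * r) - ev φ (x * x ^ i * r)
          = x • ev φ (x ^ i * r) - ev φ (x * (x ^ i * r))
        rw [mul_assoc] }
  have hg : ∀ φ (t : S), ev' (g φ) t = x • ev φ t - ev φ (x * t) := fun φ t => rfl
  have hιinj : Function.Injective ι := by
    intro m m' hm
    have h1 : ev (ι m) 1 = ev (ι m') 1 := by rw [hm]
    rwa [hι, hι, one_smul, one_smul] at h1
  have hex : Function.Exact ι g := by
    intro φ
    constructor
    · intro hφ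
      have hx : ∀ t : S, ev φ (x * t) = x • ev φ t := fun t => by
        have h1 : ev' (g φ) t = 0 := by rw [hφ]; rfl
        rw [hg, sub_eq_zero] at h1
        exact h1.symm
      refine ⟨ev φ 1, hext _ _ fun i => ?_⟩
      rw [hι]
      induction i with
      | zero => rw [pow_zero, one_smul]
      | succ i ih => rw [pow_succ', hx, ← ih, mul_smul]
    · rintro ⟨m, rfl⟩
      refine hext' _ _ fun i => ?_
      rw [hg, hι, hι, mul_smul, sub_self]
      rfl
  have hgsurj : Function.Surjective g := by
    intro ψ
    let v : ℕ → M := fun i => Nat.rec 0 (fun j m => x • m - ev' ψ (x ^ j)) i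
    let φ : F.obj N := (ModuleCat.CoextendScalars.equiv f N).symm (B.constr ℕ (M' := N) v)
    have hφ : ∀ i, ev φ (x ^ i) = v i := fun i => by
      have := B.constr_basis ℕ (M' := N) v i
      rw [hB] at this
      exact this
    refine ⟨φ, hext' _ _ fun i => ?_⟩
    rw [hg, ← pow_succ', hφ, hφ]
    exact sub_sub_cancel _ _
  have hS := ModuleCat.shortComplex_shortExact
    (ModuleCat.shortComplexOfCompEqZero _ _ hex.linearMap_comp_eq_zero) hex hιinj hgsurj
  refine hS.hasInjectiveDimensionLT_X₁ (n + 1) ?_ ?_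
  · exact hasInjectiveDimensionLT_coextendScalars f n N' (h N')
  · have := hasInjectiveDimensionLT_coextendScalars f n N (h N)
    exact hasInjectiveDimensionLT_of_ge (F.obj N) (n + 1) (n + 2) (by omega)

/-- Modules over a semisimple ring are injective. -/
theorem hasInjectiveDimensionLT_one_of_isSemisimpleRing [IsSemisimpleRing R]
    (M : ModuleCat.{u} R) : HasInjectiveDimensionLT M 1 := by
  rw [← injective_iff_hasInjectiveDimensionLT_one, ← Module.injective_iff_injective_object R M]
  exact Module.injective_of_isSemisimpleRing R M

end OreInjectiveDimension

/-! ### Iterated mapping cones -/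

section MappingCone

variable {D X : Type*} [AddCommGroup D] [AddCommGroup X]

/-- The additive group `X` with differential `δ` is exact away from its augmentation
`ε : X → D`, with section `ι` consisting of cycles, and the boundaries in the image of `ι` are
those of the subgroup `I`: the total complex is a resolution of `D / I`. -/
structure IsResolution (δ : X →+ X) (ε : X →+ D) (ι : D →+ X) (I : AddSubgroup D) : Prop where
  aug_section : ∀ r, ε (ι r) = r
  section_cycle : ∀ r, δ (ι r) = 0
  exact : ∀ x, δ x = 0 → ε x = 0 → ∃ y, δ y = x
  aug_mem : ∀ y, ε (δ y) ∈ I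
  lift : ∀ r ∈ I, ∃ y, δ y = ι r

theorem isResolution_id : IsResolution (0 : D →+ D) (.id D) (.id D) ⊥ where
  aug_section _ := rfl
  section_cycle _ := rfl
  exact x _ hx := ⟨0, hx.symm⟩
  aug_mem y := by simp
  lift r hr := ⟨0, by simpa using hr.symm⟩

/-- The mapping cone of an endomorphism `T` of a complex. -/
def coneDifferential (δ T : X →+ X) : X × X →+ X × X :=
  ((δ.comp (.fst X X)) + T.comp (.snd X X)).prod (-(δ.comp (.snd X X)))

theorem coneDifferential_apply (δ T : X →+ X) (x : X × X) :
    coneDifferential δ T x = (δ x.1 + T x.2, -δ x.2) := rfl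

theorem IsResolution.neg {δ : X →+ X} {ε : X →+ D} {ι : D →+ X} {I : AddSubgroup D}
    (h : IsResolution δ ε ι I) : IsResolution (-δ) ε ι I where
  aug_section := h.aug_section
  section_cycle r := by simp [h.section_cycle]
  exact x hx hε := by
    obtain ⟨y, hy⟩ := h.exact x (by simpa using hx) hε
    exact ⟨-y, by simp [hy]⟩
  aug_mem y := by simpa using h.aug_mem y
  lift r hr := by
    obtain ⟨y, hy⟩ := h.lift r hr
    exact ⟨-y, by simp [hy]⟩

/-- If `T` lifts the endomorphism `τ` of `D`, and `τ` is injective on `D / I`, then the mapping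
cone of `T` is a resolution of `D / (I + τ D)`. -/
theorem IsResolution.cone {δ : X →+ X} {ε : X →+ D} {ι : D →+ X} {I : AddSubgroup D}
    (h : IsResolution δ ε ι I) (T : X →+ X) (τ : D →+ D) (hT : ∀ x, δ (T x) = T (δ x))
    (hι : ∀ r, T (ι r) = ι (τ r)) (hε : ∀ x, ε (T x) = τ (ε x)) (hreg : ∀ r, τ r ∈ I → r ∈ I) :
    IsResolution (coneDifferential δ T) (ε.comp (.fst X X)) ((AddMonoidHom.inl X X).comp ι)
      (I ⊔ τ.range) where
  aug_section r := h.aug_section r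
  section_cycle r := by simp [coneDifferential_apply, h.section_cycle]
  exact := by
    rintro ⟨x, y⟩ hxy hx
    simp only [coneDifferential_apply, Prod.mk_eq_zero, neg_eq_zero] at hxy
    replace hx : ε x = 0 := hx
    obtain ⟨hxy, hy⟩ := hxy
    have h1 : τ (ε y) ∈ I := by
      have h2 : τ (ε y) = -ε (δ x) := by
        rw [← hε, eq_neg_iff_add_eq_zero, ← map_add, add_comm, hxy, map_zero]
      rw [h2]
      exact I.neg_mem (h.aug_mem x)
    obtain ⟨w, hw⟩ := h.lift _ (hreg _ h1)
    obtain ⟨w', hw'⟩ := h.exact (y - ι (ε y)) (by rw [map_sub, hy, h.section_cycle, sub_zero])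
      (by rw [map_sub, h.aug_section, sub_self])
    -- a primitive of `y`, corrected by a cycle so that its augmentation vanishes
    let y' := (w + w') - ι (ε (w + w'))
    have hy' : δ y' = y := by
      simp only [y', map_sub, h.section_cycle, map_add, hw, hw']
      abel
    have hεy' : ε y' = 0 := by rw [map_sub, h.aug_section, sub_self]
    obtain ⟨x', hx'⟩ := h.exact (x + T y') (by rw [map_add, hT, hy', hxy])
      (by rw [map_add, hε, hεy', hx, map_zero, add_zero])
    refine ⟨(x', -y'), ?_⟩
    simp only [coneDifferential_apply, map_neg, hx', hy', neg_neg]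
    rw [add_neg_cancel_right]
  aug_mem := by
    rintro ⟨x, y⟩
    refine AddSubgroup.mem_sup.mpr ⟨_, h.aug_mem x, _, ⟨ε y, rfl⟩, ?_⟩
    change _ = ε (δ x + T y)
    rw [map_add, hε]
  lift := by
    intro r hr
    obtain ⟨i, hi, _, ⟨t, rfl⟩, rfl⟩ := AddSubgroup.mem_sup.mp hr
    obtain ⟨w, hw⟩ := h.lift i hi
    refine ⟨(w, ι t), ?_⟩
    simp [coneDifferential_apply, hw, hι, h.section_cycle]

end MappingCone

/-! ### The Koszul complex -/

section Koszul

variable {𝕜 : Type u} [Field 𝕜] {A : Type u} [Ring A] [Algebra 𝕜 A]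

/-- The relations of `OreAlg n q`, with a coefficient `e` in front of `c ^ n` (so that they are
stable under passage to the opposite algebra), together with the statement that `d, c, b, a` is a
regular sequence on both sides and generates proper one-sided ideals. -/
structure KoszulData (n : ℕ) (q e : 𝕜) (a b c d : A) : Prop where
  q_ne_zero : q ≠ 0
  ad : a * d = d * a
  bd : b * d = d * b
  cd : c * d = d * c
  ca : c * a = q • (a * c)
  bc : b * c = q • (c * b)
  ba : b * a = a * b + e • c ^ n
  left_d : ∀ r, r * d = 0 → r = 0
  left_c : ∀ r x, r * c = x * d → ∃ y, r = y * d
  left_b : ∀ r x₁ x₂, r * b = x₁ * d + x₂ * c → ∃ y₁ y₂, r = y₁ * d + y₂ * c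
  left_a : ∀ r x₁ x₂ x₃, r * a = x₁ * d + x₂ * c + x₃ * b →
    ∃ y₁ y₂ y₃, r = y₁ * d + y₂ * c + y₃ * b
  left_one : ∀ x₁ x₂ x₃ x₄, x₁ * d + x₂ * c + x₃ * b + x₄ * a ≠ 1
  right_d : ∀ r, d * r = 0 → r = 0
  right_c : ∀ r x, c * r = d * x → ∃ y, r = d * y
  right_b : ∀ r x₁ x₂, b * r = d * x₁ + c * x₂ → ∃ y₁ y₂, r = d * y₁ + c * y₂
  right_a : ∀ r x₁ x₂ x₃, a * r = d * x₁ + c * x₂ + b * x₃ →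
    ∃ y₁ y₂ y₃, r = d * y₁ + c * y₂ + b * y₃
  right_one : ∀ x₁ x₂ x₃ x₄, d * x₁ + c * x₂ + b * x₃ + a * x₄ ≠ 1

namespace KoszulData

variable {n : ℕ} {q e : 𝕜} {a b c d : A}

open MulOpposite in
theorem op (h : KoszulData n q e a b c d) :
    KoszulData n q⁻¹ (-e) (op a) (op b) (op c) (op d) where
  q_ne_zero := inv_ne_zero h.q_ne_zero
  ad := by rw [← op_mul, ← op_mul, h.ad]
  bd := by rw [← op_mul, ← op_mul, h.bd]
  cd := by rw [← op_mul, ← op_mul, h.cd]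
  ca := by rw [← op_mul, ← op_mul, h.ca, op_smul, inv_smul_smul₀ h.q_ne_zero]
  bc := by rw [← op_mul, ← op_mul, h.bc, op_smul, inv_smul_smul₀ h.q_ne_zero]
  ba := by rw [← op_mul, ← op_mul, h.ba, op_add, op_smul, op_pow, neg_smul, add_neg_cancel_right]
  left_d r hr := unop_injective (h.right_d _ (op_injective hr))
  left_c r x hr := by
    obtain ⟨y, hy⟩ := h.right_c (unop r) (unop x) (op_injective hr)
    exact ⟨MulOpposite.op y, unop_injective hy⟩
  left_b r x₁ x₂ hr := by
    obtain ⟨y₁, y₂, hy⟩ := h.right_b (unop r) (unop x₁) (unop x₂) (op_injective hr)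
    exact ⟨MulOpposite.op y₁, MulOpposite.op y₂, unop_injective hy⟩
  left_a r x₁ x₂ x₃ hr := by
    obtain ⟨y₁, y₂, y₃, hy⟩ := h.right_a (unop r) (unop x₁) (unop x₂) (unop x₃) (op_injective hr)
    exact ⟨MulOpposite.op y₁, MulOpposite.op y₂, MulOpposite.op y₃, unop_injective hy⟩
  left_one x₁ x₂ x₃ x₄ hr :=
    h.right_one (unop x₁) (unop x₂) (unop x₃) (unop x₄) (op_injective hr)
  right_d r hr := unop_injective (h.left_d _ (op_injective hr))
  right_c r x hr := by
    obtain ⟨y, hy⟩ := h.left_c (unop r) (unop x) (op_injective hr)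
    exact ⟨MulOpposite.op y, unop_injective hy⟩
  right_b r x₁ x₂ hr := by
    obtain ⟨y₁, y₂, hy⟩ := h.left_b (unop r) (unop x₁) (unop x₂) (op_injective hr)
    exact ⟨MulOpposite.op y₁, MulOpposite.op y₂, unop_injective hy⟩
  right_a r x₁ x₂ x₃ hr := by
    obtain ⟨y₁, y₂, y₃, hy⟩ := h.left_a (unop r) (unop x₁) (unop x₂) (unop x₃) (op_injective hr)
    exact ⟨MulOpposite.op y₁, MulOpposite.op y₂, MulOpposite.op y₃, unop_injective hy⟩
  right_one x₁ x₂ x₃ x₄ hr :=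
    h.left_one (unop x₁) (unop x₂) (unop x₃) (unop x₄) (op_injective hr)

variable (n q e a b c d)

/-- Right multiplication by `b` on `A / (A d + A c)`, lifted to the Koszul complex on `d, c`. The
components are those of `1, e_d, e_c, e_{cd}`. -/
def liftB : (A × A) × (A × A) →+ (A × A) × (A × A) where
  toFun x := ((x.1.1 * b, x.1.2 * b), (q⁻¹ • (x.2.1 * b), q⁻¹ • (x.2.2 * b)))
  map_zero' := by simp
  map_add' x y := by simp [add_mul]

/-- Right multiplication by `a` on `A / (A d + A c + A b)`, lifted to the Koszul complex on
`d, c, b`. The components are those of `1, e_d, e_c, e_{cd}`, followed by those of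
`e_b, e_{bd}, e_{bc}, e_{bcd}`. -/
def liftA : ((A × A) × (A × A)) × ((A × A) × (A × A)) →+
    ((A × A) × (A × A)) × ((A × A) × (A × A)) where
  toFun x := (((x.1.1.1 * a, x.1.1.2 * a),
      (q • (x.1.2.1 * a) + e • (x.2.1.1 * c ^ (n - 1)),
        q • (x.1.2.2 * a) + e • (x.2.1.2 * c ^ (n - 1)))),
    ((x.2.1.1 * a, x.2.1.2 * a), (q • (x.2.2.1 * a), q • (x.2.2.2 * a))))
  map_zero' := by simp
  map_add' x y := by
    simp only [Prod.fst_add, Prod.snd_add, add_mul, smul_add, Prod.mk_add_mk, Prod.mk.injEq,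
      and_true, true_and]
    constructor <;> abel

/-- The transpose of `liftB`; the components are those of `e_{cd}, e_c, e_d, 1`. -/
def coliftB : (A × A) × (A × A) →+ (A × A) × (A × A) where
  toFun x := ((q⁻¹ • (b * x.1.1), q⁻¹ • (b * x.1.2)), (b * x.2.1, b * x.2.2))
  map_zero' := by simp
  map_add' x y := by simp [mul_add]

/-- The transpose of `liftA`; the components are those of `e_{bcd}, e_{bc}, e_{bd}, e_b`, followed
by those of `e_{cd}, e_c, e_d, 1`. -/
def coliftA : ((A × A) × (A × A)) × ((A × A) × (A × A)) →+
    ((A × A) × (A × A)) × ((A × A) × (A × A)) where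
  toFun x := (((q • (a * x.1.1.1), q • (a * x.1.1.2)),
      (a * x.1.2.1 + e • (c ^ (n - 1) * x.2.1.1), a * x.1.2.2 + e • (c ^ (n - 1) * x.2.1.2))),
    ((q • (a * x.2.1.1), q • (a * x.2.1.2)), (a * x.2.2.1, a * x.2.2.2)))
  map_zero' := by simp
  map_add' x y := by
    simp only [Prod.fst_add, Prod.snd_add, mul_add, smul_add, Prod.mk_add_mk, Prod.mk.injEq,
      and_true, true_and]
    constructor <;> abel

/-- The differential of the Koszul complex of left modules on `d, c, b`. -/
def differential₃ : ((A × A) × (A × A)) × ((A × A) × (A × A)) →+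
    ((A × A) × (A × A)) × ((A × A) × (A × A)) :=
  coneDifferential (coneDifferential (coneDifferential 0 (AddMonoidHom.mulRight d))
    ((AddMonoidHom.mulRight c).prodMap (AddMonoidHom.mulRight c))) (liftB q b)

/-- The differential of the dual complex on `d, c, b`. The signs make it the transpose of
`differential₃`, which the mapping cone alone would not give. -/
def codifferential₃ : ((A × A) × (A × A)) × ((A × A) × (A × A)) →+
    ((A × A) × (A × A)) × ((A × A) × (A × A)) :=
  coneDifferential (-(coneDifferential (-(coneDifferential 0 (AddMonoidHom.mulLeft d)))
    ((AddMonoidHom.mulLeft c).prodMap (AddMonoidHom.mulLeft c)))) (coliftB q b)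

variable {n q e a b c d}

theorem pow_pred_mul_d (h : KoszulData n q e a b c d) : c ^ (n - 1) * d = d * c ^ (n - 1) :=
  (Commute.pow_left h.cd (n - 1)).eq

/-- The Koszul complex of left modules is built up by mapping cones of the right multiplications by
`d, c, b, a`, each of which is injective on the quotient by the previous ones. -/
theorem isResolution_left (h : KoszulData n q e a b c d) (hn : 1 ≤ n) :
    ∃ ε ι I, IsResolution (coneDifferential (differential₃ q b c d) (liftA n q e a c)) ε ι I ∧
      ∀ x, ε x = x.1.1.1.1 := by
  have hq := h.q_ne_zero
  have hcn : c * c ^ (n - 1) = c ^ n := by rw [← pow_succ', Nat.sub_add_cancel hn]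
  have hcn' : c ^ (n - 1) * c = c ^ n := by rw [← pow_succ, Nat.sub_add_cancel hn]
  have K1 := (isResolution_id (D := A)).cone (AddMonoidHom.mulRight d) (AddMonoidHom.mulRight d)
    (fun x => by simp) (fun r => rfl) (fun r => rfl)
    (fun r hr => by simpa using h.left_d r (by simpa using hr))
  have K2 := K1.cone ((AddMonoidHom.mulRight c).prodMap (AddMonoidHom.mulRight c))
    (AddMonoidHom.mulRight c)
    (fun x => by simp [coneDifferential_apply, mul_assoc, h.cd]) (fun r => by simp)
    (fun r => rfl)
    (fun r hr => by
      simp only [AddSubgroup.mem_sup, AddSubgroup.mem_bot, AddMonoidHom.mem_range,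
        AddMonoidHom.mulRight_apply, exists_eq_left, zero_add, exists_exists_eq_and] at hr ⊢
      obtain ⟨x, hx⟩ := hr
      obtain ⟨y, hy⟩ := h.left_c r x hx.symm
      exact ⟨y, hy.symm⟩)
  have K3 := K2.cone (liftB q b) (AddMonoidHom.mulRight b)
    (fun x => by
      simp [coneDifferential_apply, liftB, mul_assoc, h.bd, h.bc, add_mul, smul_smul, hq])
    (fun r => by simp [liftB]) (fun r => rfl)
    (fun r hr => by
      simp only [AddSubgroup.mem_sup, AddSubgroup.mem_bot, AddMonoidHom.mem_range,
        AddMonoidHom.mulRight_apply, exists_eq_left, zero_add, exists_exists_eq_and] at hr ⊢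
      obtain ⟨x, y, hx⟩ := hr
      obtain ⟨x', y', hy⟩ := h.left_b r x y hx.symm
      exact ⟨x', y', hy.symm⟩)
  have K4 := K3.cone (liftA n q e a c) (AddMonoidHom.mulRight a)
    (fun x => by
      simp only [coneDifferential_apply, liftA, liftB, AddMonoidHom.coe_mk, ZeroHom.coe_mk,
        AddMonoidHom.zero_apply, AddMonoidHom.mulRight_apply, AddMonoidHom.coe_prodMap,
        Prod.map_apply, Prod.map_fst, Prod.map_snd, Prod.fst_add, Prod.snd_add,
        Prod.fst_neg, Prod.snd_neg, and_true, true_and, zero_mul,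
        mul_zero, smul_zero, zero_add, neg_zero, Prod.neg_mk, Prod.mk_add_mk, Prod.mk.injEq,
        add_mul, mul_assoc, h.ad, h.ca, h.ba, smul_mul_assoc, smul_add, neg_add_rev, mul_smul_comm,
        smul_smul, smul_neg, neg_mul, hcn, hcn', h.pow_pred_mul_d, mul_add]
      refine ⟨⟨⟨?_, ?_⟩, ?_, ?_⟩, ?_⟩ <;> first | rfl | (match_scalars <;> field_simp <;> ring))
    (fun r => by simp [liftA]) (fun r => rfl)
    (fun r hr => by
      simp only [AddSubgroup.mem_sup, AddSubgroup.mem_bot, AddMonoidHom.mem_range,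
        AddMonoidHom.mulRight_apply, exists_eq_left, zero_add, exists_exists_eq_and] at hr ⊢
      obtain ⟨_, ⟨x, y, rfl⟩, z, hx⟩ := hr
      obtain ⟨x', y', z', hy⟩ := h.left_a r x y z hx.symm
      exact ⟨_, ⟨x', y', rfl⟩, z', hy.symm⟩)
  exact ⟨_, _, _, K4, fun x => rfl⟩

/-- The dual of the Koszul complex is built up in the same way from left multiplications. -/
theorem isResolution_right (h : KoszulData n q e a b c d) (hn : 1 ≤ n) :
    ∃ ε ι I, IsResolution
      (coneDifferential (-(codifferential₃ q b c d)) (coliftA n q e a c)) ε ι I ∧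
      ∀ x, ε x = x.1.1.1.1 := by
  have hq := h.q_ne_zero
  have hcn : ∀ x, c * (c ^ (n - 1) * x) = c ^ n * x := fun x => by
    rw [← mul_assoc, ← pow_succ', Nat.sub_add_cancel hn]
  have hcn' : ∀ x, c ^ (n - 1) * (c * x) = c ^ n * x := fun x => by
    rw [← mul_assoc, ← pow_succ, Nat.sub_add_cancel hn]
  have hcd : ∀ x, c * (d * x) = d * (c * x) := fun x => by
    rw [← mul_assoc, h.cd, mul_assoc]
  have hbd : ∀ x, b * (d * x) = d * (b * x) := fun x => by
    rw [← mul_assoc, h.bd, mul_assoc]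
  have had : ∀ x, a * (d * x) = d * (a * x) := fun x => by
    rw [← mul_assoc, h.ad, mul_assoc]
  have hbc : ∀ x, b * (c * x) = q • (c * (b * x)) := fun x => by
    rw [← mul_assoc, h.bc, smul_mul_assoc, mul_assoc]
  have hca : ∀ x, c * (a * x) = q • (a * (c * x)) := fun x => by
    rw [← mul_assoc, h.ca, smul_mul_assoc, mul_assoc]
  have hba : ∀ x, b * (a * x) = a * (b * x) + e • (c ^ n * x) := fun x => by
    rw [← mul_assoc, h.ba, add_mul, smul_mul_assoc, mul_assoc]
  have hpd : ∀ x, c ^ (n - 1) * (d * x) = d * (c ^ (n - 1) * x) := fun x => by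
    rw [← mul_assoc, h.pow_pred_mul_d, mul_assoc]
  have K1 := (isResolution_id (D := A)).cone (AddMonoidHom.mulLeft d) (AddMonoidHom.mulLeft d)
    (fun x => by simp) (fun r => rfl) (fun r => rfl)
    (fun r hr => by simpa using h.right_d r (by simpa using hr))
  have K2 := K1.neg.cone ((AddMonoidHom.mulLeft c).prodMap (AddMonoidHom.mulLeft c))
    (AddMonoidHom.mulLeft c)
    (fun x => by simp [coneDifferential_apply, hcd]) (fun r => by simp)
    (fun r => rfl)
    (fun r hr => by
      simp only [AddSubgroup.mem_sup, AddSubgroup.mem_bot, AddMonoidHom.mem_range,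
        AddMonoidHom.coe_mulLeft, exists_eq_left, zero_add, exists_exists_eq_and] at hr ⊢
      obtain ⟨x, hx⟩ := hr
      obtain ⟨y, hy⟩ := h.right_c r x hx.symm
      exact ⟨y, hy.symm⟩)
  have K3 := K2.neg.cone (coliftB q b) (q⁻¹ • AddMonoidHom.mulLeft b)
    (fun x => by
      simp [coneDifferential_apply, coliftB, hbd, hbc, mul_add, smul_smul, hq])
    (fun r => by simp [coliftB]) (fun r => rfl)
    (fun r hr => by
      simp only [AddSubgroup.mem_sup, AddSubgroup.mem_bot, AddMonoidHom.mem_range,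
        AddMonoidHom.coe_mulLeft, exists_eq_left, zero_add, exists_exists_eq_and,
        AddMonoidHom.smul_apply] at hr ⊢
      obtain ⟨x, y, hx⟩ := hr
      obtain ⟨x', y', hy⟩ := h.right_b r (q • x) (q • y) (by
        rw [mul_smul_comm, mul_smul_comm, ← smul_add, hx, smul_inv_smul₀ hq])
      exact ⟨x', y', hy.symm⟩)
  have K4 := K3.neg.cone (coliftA n q e a c) (q • AddMonoidHom.mulLeft a)
    (fun x => by
      simp only [coneDifferential_apply, coliftA, coliftB, AddMonoidHom.coe_mk, ZeroHom.coe_mk,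
        AddMonoidHom.zero_apply, AddMonoidHom.coe_mulLeft, AddMonoidHom.coe_prodMap,
        Prod.map_apply, Prod.map_fst, Prod.map_snd, Prod.fst_add, Prod.snd_add,
        Prod.fst_neg, Prod.snd_neg, and_true, true_and, zero_mul,
        mul_zero, smul_zero, zero_add, neg_zero, Prod.neg_mk, Prod.mk_add_mk, Prod.mk.injEq,
        mul_add, had, hca, hba, smul_mul_assoc, smul_add, neg_add_rev, mul_smul_comm, neg_neg,
        AddMonoidHom.neg_apply, mul_neg,
        smul_smul, smul_neg, neg_mul, hcn, hcn', hpd]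
      refine ⟨⟨⟨?_, ?_⟩, ?_, ?_⟩, ?_⟩ <;> first | rfl | (match_scalars <;> field_simp <;> ring))
    (fun r => by simp [coliftA]) (fun r => rfl)
    (fun r hr => by
      simp only [AddSubgroup.mem_sup, AddSubgroup.mem_bot, AddMonoidHom.mem_range,
        AddMonoidHom.coe_mulLeft, exists_eq_left, zero_add, exists_exists_eq_and,
        AddMonoidHom.smul_apply] at hr ⊢
      obtain ⟨_, ⟨x, y, rfl⟩, z, hx⟩ := hr
      obtain ⟨x', y', z', hy⟩ := h.right_a r (q⁻¹ • x) (q⁻¹ • y) ((q⁻¹ * q⁻¹) • z) (by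
        have := congrArg (fun t => q⁻¹ • t) hx
        simp only [smul_add, inv_smul_smul₀ hq, smul_smul] at this
        rw [← this, mul_smul_comm, mul_smul_comm, mul_smul_comm])
      exact ⟨_, ⟨x', y', rfl⟩, q • z', by
        rw [mul_smul_comm, inv_smul_smul₀ hq]; exact hy.symm⟩)
  exact ⟨_, _, _, K4, fun x => rfl⟩

end KoszulData

end Koszul

/-! ### The matrices of the Koszul resolution -/

section KoszulResolution

variable {𝕜 : Type u} [Field 𝕜] {A : Type u} [Ring A] [Algebra 𝕜 A]

/-- The ranks of the terms of the Koszul resolution. -/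
def koszulRank : ℕ → ℕ
  | 0 => 1
  | 1 => 4
  | 2 => 6
  | 3 => 4
  | 4 => 1
  | _ + 5 => 0

/-- The degrees of the basis elements of the Koszul resolution, for generators `a, b, c, d` of
degrees `wa, wb, wc, wd`. The bases are `1`; `e_d, e_c, e_b, e_a`;
`e_{cd}, e_{bd}, e_{bc}, e_{ad}, e_{ac}, e_{ab}`; `e_{bcd}, e_{acd}, e_{abd}, e_{abc}`;
`e_{abcd}`. -/
def koszulDeg (wa wb wc wd : ℤ) : ∀ i, Fin (koszulRank i) → ℤ
  | 0 => ![0]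
  | 1 => ![wd, wc, wb, wa]
  | 2 => ![wc + wd, wb + wd, wb + wc, wa + wd, wa + wc, wa + wb]
  | 3 => ![wb + wc + wd, wa + wc + wd, wa + wb + wd, wa + wb + wc]
  | 4 => ![wa + wb + wc + wd]
  | _ + 5 => fun s => s.elim0

section Matrices

variable (n : ℕ) (q e : 𝕜) (a b c d : A)

/-- The first differential of the Koszul resolution, acting on row vectors. -/
def koszulMatrix₀ : Matrix (Fin 4) (Fin 1) A := !![d; c; b; a]

/-- The second differential of the Koszul resolution, acting on row vectors. -/
def koszulMatrix₁ : Matrix (Fin 6) (Fin 4) A :=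
  !![c, -d, 0, 0;
    b, 0, -d, 0;
    0, q⁻¹ • b, -c, 0;
    a, 0, 0, -d;
    0, q • a, 0, -c;
    0, e • c ^ (n - 1), a, -b]

/-- The third differential of the Koszul resolution, acting on row vectors. -/
def koszulMatrix₂ : Matrix (Fin 4) (Fin 6) A :=
  !![q⁻¹ • b, -c, d, 0, 0, 0;
    q • a, 0, 0, -c, d, 0;
    e • c ^ (n - 1), a, 0, -b, 0, d;
    0, 0, q • a, 0, -(q⁻¹ • b), c]

/-- The fourth differential of the Koszul resolution, acting on row vectors. -/
def koszulMatrix₃ : Matrix (Fin 1) (Fin 4) A := !![q • a, -(q⁻¹ • b), c, -d]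

/-- The matrices of the differentials of the Koszul resolution, acting on row vectors. -/
def koszulMatrix : ∀ i, Matrix (Fin (koszulRank (i + 1))) (Fin (koszulRank i)) A
  | 0 => koszulMatrix₀ a b c d
  | 1 => koszulMatrix₁ n q e a b c d
  | 2 => koszulMatrix₂ n q e a b c d
  | 3 => koszulMatrix₃ q a b c d
  | _ + 4 => 0

end Matrices

namespace KoszulData

variable {n : ℕ} {q e : 𝕜} {a b c d : A}

open Matrix

theorem koszulMatrix_mul₀ (h : KoszulData n q e a b c d) (hn : 1 ≤ n) :
    koszulMatrix₁ n q e a b c d * koszulMatrix₀ a b c d = 0 := by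
  have hcn' : c ^ (n - 1) * c = c ^ n := by rw [← pow_succ, Nat.sub_add_cancel hn]
  ext s t
  fin_cases s <;> fin_cases t <;>
    simp [koszulMatrix₁, koszulMatrix₀, Matrix.mul_apply, Fin.sum_univ_succ, h.ad, h.bd, h.cd,
      h.ca, h.bc, h.ba, smul_smul, h.q_ne_zero, hcn'] <;> abel

theorem koszulMatrix_mul₁ (h : KoszulData n q e a b c d) (hn : 1 ≤ n) :
    koszulMatrix₂ n q e a b c d * koszulMatrix₁ n q e a b c d = 0 := by
  have hcn : c * c ^ (n - 1) = c ^ n := by rw [← pow_succ', Nat.sub_add_cancel hn]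
  have hcn' : c ^ (n - 1) * c = c ^ n := by rw [← pow_succ, Nat.sub_add_cancel hn]
  ext s t
  fin_cases s <;> fin_cases t <;>
    simp [koszulMatrix₁, koszulMatrix₂, Matrix.mul_apply, Fin.sum_univ_succ, h.ad, h.bd, h.cd,
      h.ca, h.bc, h.ba, smul_smul, h.q_ne_zero, hcn, hcn', h.pow_pred_mul_d] <;> abel

theorem koszulMatrix_mul₂ (h : KoszulData n q e a b c d) (hn : 1 ≤ n) :
    koszulMatrix₃ q a b c d * koszulMatrix₂ n q e a b c d = 0 := by
  have hcn : c * c ^ (n - 1) = c ^ n := by rw [← pow_succ', Nat.sub_add_cancel hn]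
  ext s t
  fin_cases s <;> fin_cases t <;>
    simp [koszulMatrix₃, koszulMatrix₂, Matrix.mul_apply, Fin.sum_univ_succ, h.ad, h.bd, h.cd,
      h.ca, h.bc, h.ba, smul_smul, h.q_ne_zero, hcn] <;> abel

theorem left_exact₀ (h : KoszulData n q e a b c d) (hn : 1 ≤ n) (x : Fin 4 → A)
    (hx : x ᵥ* koszulMatrix₀ a b c d = 0) : ∃ y, y ᵥ* koszulMatrix₁ n q e a b c d = x := by
  obtain ⟨ε, ι, I, hR, hε⟩ := h.isResolution_left hn
  rw [funext_iff] at hx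
  simp only [vecMul, dotProduct] at hx
  simp [Fin.forall_fin_succ, koszulMatrix₀, Fin.sum_univ_succ] at hx
  obtain ⟨y, hy⟩ := hR.exact ((((0, x 0), (x 1, 0)), ((x 2, 0), (0, 0))),
    (((x 3, 0), (0, 0)), ((0, 0), (0, 0)))) (by
      simp [differential₃, liftA, liftB, coneDifferential_apply]; grind) (hε _)
  simp [differential₃, liftA, liftB, coneDifferential_apply, Prod.ext_iff] at hy
  refine ⟨![y.1.1.2.2, y.1.2.1.2, y.1.2.2.1, y.2.1.1.2, y.2.1.2.1, y.2.2.1.1], ?_⟩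
  ext t
  fin_cases t <;> simp [koszulMatrix₁, vecMul, dotProduct, Fin.sum_univ_succ] <;> grind

theorem left_exact₁ (h : KoszulData n q e a b c d) (hn : 1 ≤ n) (x : Fin 6 → A)
    (hx : x ᵥ* koszulMatrix₁ n q e a b c d = 0) :
    ∃ y, y ᵥ* koszulMatrix₂ n q e a b c d = x := by
  obtain ⟨ε, ι, I, hR, hε⟩ := h.isResolution_left hn
  rw [funext_iff] at hx
  simp only [vecMul, dotProduct] at hx
  simp [Fin.forall_fin_succ, koszulMatrix₁, Fin.sum_univ_succ] at hx
  obtain ⟨y, hy⟩ := hR.exact ((((0, 0), (0, x 0)), ((0, x 1), (x 2, 0))),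
    (((0, x 3), (x 4, 0)), ((x 5, 0), (0, 0)))) (by
      simp [differential₃, liftA, liftB, coneDifferential_apply]; grind) (hε _)
  simp [differential₃, liftA, liftB, coneDifferential_apply, Prod.ext_iff] at hy
  refine ⟨![y.1.2.2.2, y.2.1.2.2, y.2.2.1.2, y.2.2.2.1], ?_⟩
  ext t
  fin_cases t <;> simp [koszulMatrix₂, vecMul, dotProduct, Fin.sum_univ_succ] <;> grind

theorem left_exact₂ (h : KoszulData n q e a b c d) (hn : 1 ≤ n) (x : Fin 4 → A)
    (hx : x ᵥ* koszulMatrix₂ n q e a b c d = 0) : ∃ y, y ᵥ* koszulMatrix₃ q a b c d = x := by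
  obtain ⟨ε, ι, I, hR, hε⟩ := h.isResolution_left hn
  rw [funext_iff] at hx
  simp only [vecMul, dotProduct] at hx
  simp [Fin.forall_fin_succ, koszulMatrix₂, Fin.sum_univ_succ] at hx
  obtain ⟨y, hy⟩ := hR.exact ((((0, 0), (0, 0)), ((0, 0), (0, x 0))),
    (((0, 0), (0, x 1)), ((0, x 2), (x 3, 0)))) (by
      simp [differential₃, liftA, liftB, coneDifferential_apply]; grind) (hε _)
  simp [differential₃, liftA, liftB, coneDifferential_apply, Prod.ext_iff] at hy
  refine ⟨![y.2.2.2.2], ?_⟩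
  ext t
  fin_cases t <;> simp [koszulMatrix₃, vecMul, dotProduct, Fin.sum_univ_succ] <;> grind

theorem left_exact₃ (h : KoszulData n q e a b c d) (hn : 1 ≤ n) (x : Fin 1 → A)
    (hx : x ᵥ* koszulMatrix₃ q a b c d = 0) : x = 0 := by
  have := congrFun hx 3
  simp [koszulMatrix₃, vecMul, dotProduct] at this
  ext t
  fin_cases t
  exact h.left_d _ this

theorem right_exact₀ (h : KoszulData n q e a b c d) (x : Fin 1 → A)
    (hx : koszulMatrix₀ a b c d *ᵥ x = 0) : x = 0 := by
  have := congrFun hx 0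
  simp [koszulMatrix₀, mulVec, dotProduct] at this
  ext t
  fin_cases t
  exact h.right_d _ this

theorem right_exact₁ (h : KoszulData n q e a b c d) (hn : 1 ≤ n) (x : Fin 4 → A)
    (hx : koszulMatrix₁ n q e a b c d *ᵥ x = 0) : ∃ y, koszulMatrix₀ a b c d *ᵥ y = x := by
  obtain ⟨ε, ι, I, hR, hε⟩ := h.isResolution_right hn
  simp [funext_iff, Fin.forall_fin_succ, koszulMatrix₁, mulVec, dotProduct,
    Fin.sum_univ_succ] at hx
  obtain ⟨y, hy⟩ := hR.exact ((((0, 0), (0, 0)), ((0, 0), (0, x 3))),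
    (((0, 0), (0, x 2)), ((0, x 1), (x 0, 0)))) (by
      simp [codifferential₃, coliftA, coliftB, coneDifferential_apply]; grind) (hε _)
  simp [codifferential₃, coliftA, coliftB, coneDifferential_apply, Prod.ext_iff] at hy
  refine ⟨![y.2.2.2.2], ?_⟩
  ext t
  fin_cases t <;> simp [koszulMatrix₀, mulVec, dotProduct, Fin.sum_univ_succ] <;> grind

theorem right_exact₂ (h : KoszulData n q e a b c d) (hn : 1 ≤ n) (x : Fin 6 → A)
    (hx : koszulMatrix₂ n q e a b c d *ᵥ x = 0) : ∃ y, koszulMatrix₁ n q e a b c d *ᵥ y = x := by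
  obtain ⟨ε, ι, I, hR, hε⟩ := h.isResolution_right hn
  simp [funext_iff, Fin.forall_fin_succ, koszulMatrix₂, mulVec, dotProduct,
    Fin.sum_univ_succ] at hx
  obtain ⟨y, hy⟩ := hR.exact ((((0, 0), (0, x 5)), ((0, x 4), (x 3, 0))),
    (((0, x 2), (x 1, 0)), ((x 0, 0), (0, 0)))) (by
      simp [codifferential₃, coliftA, coliftB, coneDifferential_apply]; grind) (hε _)
  simp [codifferential₃, coliftA, coliftB, coneDifferential_apply, Prod.ext_iff] at hy
  refine ⟨![y.2.2.2.1, y.2.2.1.2, y.2.1.2.2, y.1.2.2.2], ?_⟩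
  ext t
  fin_cases t <;> simp [koszulMatrix₁, mulVec, dotProduct, Fin.sum_univ_succ] <;> grind

theorem right_exact₃ (h : KoszulData n q e a b c d) (hn : 1 ≤ n) (x : Fin 4 → A)
    (hx : koszulMatrix₃ q a b c d *ᵥ x = 0) : ∃ y, koszulMatrix₂ n q e a b c d *ᵥ y = x := by
  obtain ⟨ε, ι, I, hR, hε⟩ := h.isResolution_right hn
  simp [funext_iff, Fin.forall_fin_succ, koszulMatrix₃, mulVec, dotProduct,
    Fin.sum_univ_succ] at hx
  obtain ⟨y, hy⟩ := hR.exact ((((0, x 3), (x 2, 0)), ((x 1, 0), (0, 0))),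
    (((x 0, 0), (0, 0)), ((0, 0), (0, 0)))) (by
      simp [codifferential₃, coliftA, coliftB, coneDifferential_apply]; grind) (hε _)
  simp [codifferential₃, coliftA, coliftB, coneDifferential_apply, Prod.ext_iff] at hy
  refine ⟨![y.2.2.1.1, y.2.1.2.1, y.2.1.1.2, y.1.2.2.1, y.1.2.1.2, y.1.1.2.2], ?_⟩
  ext t
  fin_cases t <;> simp [koszulMatrix₂, mulVec, dotProduct, Fin.sum_univ_succ] <;> grind

end KoszulData

end KoszulResolution

/-! ### The Koszul resolution and the Ext condition -/

section KoszulExt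

open Matrix

variable {𝕜 : Type u} [Field 𝕜] {A : Type u} [Ring A] [Algebra 𝕜 A]

/-- The generators `a, b, c, d` are homogeneous of degrees `wa, wb, wc, wd` with
`wa + wb = n * wc`, and every homogeneous element of positive degree lies both in the left and in
the right ideal which they generate. -/
structure KoszulGrading (𝒜 : ℕ → Submodule 𝕜 A) (n : ℕ) (a b c d : A) (wa wb wc wd : ℕ) :
    Prop where
  graded : SetLike.GradedMonoid 𝒜
  mem_a : a ∈ 𝒜 wa
  mem_b : b ∈ 𝒜 wb
  mem_c : c ∈ 𝒜 wc
  mem_d : d ∈ 𝒜 wd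
  pos_a : 1 ≤ wa
  pos_b : 1 ≤ wb
  pos_c : 1 ≤ wc
  pos_d : 1 ≤ wd
  weight : wa + wb = n * wc
  left_ideal : ∀ m, 1 ≤ m → ∀ x ∈ 𝒜 m, ∃ x₁ x₂ x₃ x₄, x = x₁ * d + x₂ * c + x₃ * b + x₄ * a
  right_ideal : ∀ m, 1 ≤ m → ∀ x ∈ 𝒜 m, ∃ x₁ x₂ x₃ x₄, x = d * x₁ + c * x₂ + b * x₃ + a * x₄

theorem mem_opGrading {𝒜 : ℕ → Submodule 𝕜 A} {m : ℕ} {x : Aᵐᵒᵖ} :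
    x ∈ opGrading 𝒜 m ↔ x.unop ∈ 𝒜 m := by
  constructor
  · rintro ⟨y, hy, rfl⟩
    exact hy
  · intro h
    exact ⟨x.unop, h, rfl⟩

theorem mem_intPiece {𝒜 : ℕ → Submodule 𝕜 A} {m : ℕ} {z : ℤ} {x : A} (hx : x ∈ 𝒜 m)
    (h : z = m) : x ∈ intPiece 𝒜 z := by
  subst h
  exact hx

namespace KoszulGrading

variable {𝒜 : ℕ → Submodule 𝕜 A} {n : ℕ} {a b c d : A} {wa wb wc wd : ℕ}

open MulOpposite in
theorem op (h : KoszulGrading 𝒜 n a b c d wa wb wc wd) :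
    KoszulGrading (opGrading 𝒜) n (op a) (op b) (op c) (op d) wa wb wc wd where
  graded :=
    { one_mem := mem_opGrading.mpr h.graded.one_mem
      mul_mem := fun i j x y hx hy => mem_opGrading.mpr <| by
        rw [unop_mul, add_comm]
        exact h.graded.mul_mem (mem_opGrading.mp hy) (mem_opGrading.mp hx) }
  mem_a := mem_opGrading.mpr h.mem_a
  mem_b := mem_opGrading.mpr h.mem_b
  mem_c := mem_opGrading.mpr h.mem_c
  mem_d := mem_opGrading.mpr h.mem_d
  pos_a := h.pos_a
  pos_b := h.pos_b
  pos_c := h.pos_c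
  pos_d := h.pos_d
  weight := h.weight
  left_ideal m hm x hx := by
    obtain ⟨x₁, x₂, x₃, x₄, h⟩ := h.right_ideal m hm _ (mem_opGrading.mp hx)
    exact ⟨MulOpposite.op x₁, MulOpposite.op x₂, MulOpposite.op x₃, MulOpposite.op x₄,
      unop_injective h⟩
  right_ideal m hm x hx := by
    obtain ⟨x₁, x₂, x₃, x₄, h⟩ := h.left_ideal m hm _ (mem_opGrading.mp hx)
    exact ⟨MulOpposite.op x₁, MulOpposite.op x₂, MulOpposite.op x₃, MulOpposite.op x₄,
      unop_injective h⟩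

theorem mem_irrelevantIdeal (h : KoszulGrading 𝒜 n a b c d wa wb wc wd) (x : A) :
    x ∈ irrelevantIdeal 𝒜 ↔ ∃ x₁ x₂ x₃ x₄, x = x₁ * d + x₂ * c + x₃ * b + x₄ * a := by
  constructor
  · intro hx
    induction hx using Submodule.span_induction with
    | mem x hx =>
      obtain ⟨m, hm, hx⟩ := hx
      exact h.left_ideal m hm x hx
    | zero => exact ⟨0, 0, 0, 0, by simp⟩
    | add x y _ _ hx hy =>
      obtain ⟨x₁, x₂, x₃, x₄, rfl⟩ := hx
      obtain ⟨y₁, y₂, y₃, y₄, rfl⟩ := hy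
      exact ⟨x₁ + y₁, x₂ + y₂, x₃ + y₃, x₄ + y₄, by simp only [add_mul]; abel⟩
    | smul r x _ hx =>
      obtain ⟨x₁, x₂, x₃, x₄, rfl⟩ := hx
      exact ⟨r * x₁, r * x₂, r * x₃, r * x₄, by simp only [smul_eq_mul, mul_add, mul_assoc]⟩
  · rintro ⟨x₁, x₂, x₃, x₄, rfl⟩
    have key : ∀ (r y : A) (m : ℕ), 1 ≤ m → y ∈ 𝒜 m → r * y ∈ irrelevantIdeal 𝒜 :=
      fun r y m hm hy => Submodule.smul_mem _ r (Submodule.subset_span ⟨m, hm, hy⟩)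
    exact add_mem (add_mem (add_mem (key _ _ _ h.pos_d h.mem_d) (key _ _ _ h.pos_c h.mem_c))
      (key _ _ _ h.pos_b h.mem_b)) (key _ _ _ h.pos_a h.mem_a)

theorem koszulMatrix_homogeneous (h : KoszulGrading 𝒜 n a b c d wa wb wc wd) (hn : 1 ≤ n)
    (q e : 𝕜) (i : ℕ) (s : Fin (koszulRank (i + 1))) (t : Fin (koszulRank i)) :
    koszulMatrix n q e a b c d i s t ∈
      intPiece 𝒜 (koszulDeg wa wb wc wd (i + 1) s - koszulDeg wa wb wc wd i t) := by
  have := h.graded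
  have hcn : e • c ^ (n - 1) ∈ 𝒜 ((n - 1) * wc) :=
    Submodule.smul_mem _ _ (SetLike.pow_mem_graded (n - 1) h.mem_c)
  have hw : ((n - 1) * wc) + wc = wa + wb := by
    rw [h.weight]
    obtain ⟨m, rfl⟩ : ∃ m, n = m + 1 := ⟨n - 1, by omega⟩
    rw [Nat.add_sub_cancel, add_mul, one_mul]
  have ha := h.mem_a
  have hb := h.mem_b
  have hc := h.mem_c
  have hd := h.mem_d
  have hqa : q • a ∈ 𝒜 wa := Submodule.smul_mem _ _ ha
  have hqb : q⁻¹ • b ∈ 𝒜 wb := Submodule.smul_mem _ _ hb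
  have hqb' : -(q⁻¹ • b) ∈ 𝒜 wb := Submodule.neg_mem _ hqb
  have hb' : -b ∈ 𝒜 wb := Submodule.neg_mem _ hb
  have hc' : -c ∈ 𝒜 wc := Submodule.neg_mem _ hc
  have hd' : -d ∈ 𝒜 wd := Submodule.neg_mem _ hd
  match i with
  | 0 =>
    change Fin 4 at s
    change Fin 1 at t
    fin_cases s <;> fin_cases t <;>
      first
      | exact zero_mem _
      | exact mem_intPiece ha (by simp [koszulDeg])
      | exact mem_intPiece hb (by simp [koszulDeg])
      | exact mem_intPiece hc (by simp [koszulDeg])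
      | exact mem_intPiece hd (by simp [koszulDeg])
  | 1 =>
    change Fin 6 at s
    change Fin 4 at t
    fin_cases s <;> fin_cases t <;>
      first
      | exact zero_mem _
      | exact mem_intPiece ha (by simp [koszulDeg])
      | exact mem_intPiece hb (by simp [koszulDeg])
      | exact mem_intPiece hc (by simp [koszulDeg])
      | exact mem_intPiece hqa (by simp [koszulDeg])
      | exact mem_intPiece hqb (by simp [koszulDeg])
      | exact mem_intPiece hb' (by simp [koszulDeg])
      | exact mem_intPiece hc' (by simp [koszulDeg])
      | exact mem_intPiece hd' (by simp [koszulDeg])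
      | exact mem_intPiece hcn (by simp [koszulDeg]; omega)
  | 2 =>
    change Fin 4 at s
    change Fin 6 at t
    fin_cases s <;> fin_cases t <;>
      first
      | exact zero_mem _
      | exact mem_intPiece ha (by simp [koszulDeg])
      | exact mem_intPiece hc (by simp [koszulDeg])
      | exact mem_intPiece hd (by simp [koszulDeg])
      | exact mem_intPiece hqa (by simp [koszulDeg])
      | exact mem_intPiece hqb (by simp [koszulDeg])
      | exact mem_intPiece hqb' (by simp [koszulDeg])
      | exact mem_intPiece hb' (by simp [koszulDeg])
      | exact mem_intPiece hc' (by simp [koszulDeg])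
      | exact mem_intPiece hcn (by simp [koszulDeg]; omega)
  | 3 =>
    change Fin 1 at s
    change Fin 4 at t
    fin_cases s <;> fin_cases t <;>
      first
      | exact mem_intPiece hc (by simp [koszulDeg])
      | exact mem_intPiece hqa (by simp [koszulDeg])
      | exact mem_intPiece hqb' (by simp [koszulDeg])
      | exact mem_intPiece hd' (by simp [koszulDeg])
  | i + 4 => exact s.elim0

end KoszulGrading

variable {n : ℕ} {q e : 𝕜} {a b c d : A} {𝒜 : ℕ → Submodule 𝕜 A} {wa wb wc wd : ℕ}

theorem exact_vecMulLinear {l m k : Type*} [Fintype l] [Fintype m] (M : Matrix l m A)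
    (N : Matrix m k A) (h0 : M * N = 0) (h : ∀ x, x ᵥ* N = 0 → ∃ y, y ᵥ* M = x) :
    Function.Exact (Matrix.vecMulLinear M) (Matrix.vecMulLinear N) := by
  intro x
  constructor
  · exact h x
  · rintro ⟨y, rfl⟩
    simp only [Matrix.vecMulLinear_apply, Matrix.vecMul_vecMul, h0, Matrix.vecMul_zero]

/-- The Koszul resolution of the trivial module. -/
noncomputable def koszulResolution (h : KoszulData n q e a b c d) (hn : 1 ≤ n)
    (hg : KoszulGrading 𝒜 n a b c d wa wb wc wd) : GradedFreeResolution 𝒜 where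
  rank := koszulRank
  deg := koszulDeg wa wb wc wd
  d i := Matrix.vecMulLinear (koszulMatrix n q e a b c d i)
  aug := (irrelevantIdeal 𝒜).mkQ ∘ₗ LinearMap.proj (0 : Fin 1)
  d_homogeneous i s t := by
    have : Matrix.vecMulLinear (koszulMatrix n q e a b c d i) (Pi.single s 1) t
        = koszulMatrix n q e a b c d i s t := by simp
    rw [this]
    exact hg.koszulMatrix_homogeneous hn q e i s t
  aug_homogeneous s hs := by
    change Fin 1 at s
    fin_cases s
    exact absurd rfl hs
  aug_surjective := by
    intro y
    obtain ⟨x, rfl⟩ := Submodule.mkQ_surjective _ y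
    exact ⟨fun _ => x, rfl⟩
  exact_zero := by
    intro x
    change Fin 1 → A at x
    have h1 : ∀ y : Fin 4 → A, (y ᵥ* koszulMatrix₀ a b c d) 0
        = y 0 * d + y 1 * c + y 2 * b + y 3 * a := by
      intro y
      simp [koszulMatrix₀, vecMul, dotProduct, Fin.sum_univ_succ]
      abel
    have h2 : ((irrelevantIdeal 𝒜).mkQ ∘ₗ LinearMap.proj (0 : Fin 1)) x = 0 ↔
        x 0 ∈ irrelevantIdeal 𝒜 := Submodule.Quotient.mk_eq_zero _
    refine h2.trans ((hg.mem_irrelevantIdeal (x 0)).trans ⟨?_, ?_⟩)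
    · rintro ⟨x₁, x₂, x₃, x₄, hx⟩
      refine ⟨![x₁, x₂, x₃, x₄], ?_⟩
      ext t
      fin_cases t
      exact (h1 ![x₁, x₂, x₃, x₄]).trans hx.symm
    · rintro ⟨y, rfl⟩
      exact ⟨_, _, _, _, h1 y⟩
  exact_succ i := match i with
    | 0 => exact_vecMulLinear _ _ (h.koszulMatrix_mul₀ hn) (h.left_exact₀ hn)
    | 1 => exact_vecMulLinear _ _ (h.koszulMatrix_mul₁ hn) (h.left_exact₁ hn)
    | 2 => exact_vecMulLinear _ _ (h.koszulMatrix_mul₂ hn) (h.left_exact₂ hn)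
    | 3 => exact_vecMulLinear _ _ (Matrix.zero_mul _) fun x hx =>
        ⟨0, (Matrix.zero_vecMul _).trans (h.left_exact₃ hn x hx).symm⟩
    | _ + 4 => exact_vecMulLinear _ _ (Matrix.zero_mul _) fun _ _ =>
        ⟨0, funext fun s => s.elim0⟩

theorem comp_vecMulLinear_single {l m : Type*} [Fintype l] [Fintype m] [DecidableEq l]
    [DecidableEq m] (M : Matrix l m A) (φ : (m → A) →ₗ[A] A) (s : l) :
    φ (Matrix.vecMulLinear M (Pi.single s 1)) = (M *ᵥ fun t => φ (Pi.single t 1)) s := by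
  rw [LinearMap.pi_apply_eq_sum_univ φ]
  simp only [Matrix.vecMulLinear_apply, Matrix.single_one_vecMul, Matrix.mulVec, dotProduct,
    smul_eq_mul]
  refine Finset.sum_congr rfl fun t _ => ?_
  congr 2
  ext j
  simp [Pi.single_apply, eq_comm]

theorem exists_linearMap_single {m : Type*} [Fintype m] [DecidableEq m] (y : m → A) :
    ∃ ψ : (m → A) →ₗ[A] A, ∀ t, ψ (Pi.single t 1) = y t :=
  ⟨Fintype.linearCombination A y, fun t => by simp [Fintype.linearCombination_apply_single]⟩

theorem exists_comp_vecMulLinear {l m : Type*} [Fintype l] [Fintype m] [DecidableEq l]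
    [DecidableEq m] (M : Matrix l m A) (φ : (l → A) →ₗ[A] A)
    (h : ∃ y, M *ᵥ y = fun s => φ (Pi.single s 1)) :
    ∃ ψ : (m → A) →ₗ[A] A, ψ ∘ₗ Matrix.vecMulLinear M = φ := by
  obtain ⟨y, hy⟩ := h
  obtain ⟨ψ, hψ⟩ := exists_linearMap_single y
  refine ⟨ψ, LinearMap.pi_ext' fun s => LinearMap.ext_ring ?_⟩
  change ψ (Matrix.vecMulLinear M (Pi.single s 1)) = φ (Pi.single s 1)
  rw [comp_vecMulLinear_single, funext hψ, hy]

theorem GradedFreeResolution.subsingleton_ext (P : GradedFreeResolution 𝒜) (i : ℕ)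
    (h : P.cocycles i ≤ P.coboundaries i) : Subsingleton (P.ext i) := by
  rw [Submodule.subsingleton_iff_eq_bot, GradedFreeResolution.ext, eq_bot_iff]
  rintro _ ⟨φ, hφ, rfl⟩
  simpa using h hφ

theorem mulVec_eq_zero_of_comp {l m : Type*} [Fintype l] [Fintype m] [DecidableEq l]
    [DecidableEq m] (M : Matrix l m A) (φ : (m → A) →ₗ[A] A)
    (h : φ ∘ₗ Matrix.vecMulLinear M = 0) : (M *ᵥ fun t => φ (Pi.single t 1)) = 0 := by
  ext s
  rw [← comp_vecMulLinear_single, ← LinearMap.comp_apply, h]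
  rfl

theorem koszulResolution_ext_subsingleton (h : KoszulData n q e a b c d) (hn : 1 ≤ n)
    (hg : KoszulGrading 𝒜 n a b c d wa wb wc wd) (i : ℕ) (hi : i ≠ 4) :
    Subsingleton ((koszulResolution h hn hg).ext i) := by
  refine GradedFreeResolution.subsingleton_ext _ _ ?_
  rcases i with _ | _ | _ | _ | _ | i
  · intro φ hφ
    have h0 := h.right_exact₀ _ (mulVec_eq_zero_of_comp (koszulMatrix₀ a b c d) φ hφ)
    have : φ = 0 := LinearMap.pi_ext' fun s => LinearMap.ext_ring (congrFun h0 s)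
    rw [this]
    exact zero_mem _
  · exact fun φ hφ => exists_comp_vecMulLinear (koszulMatrix₀ a b c d) φ
      (h.right_exact₁ hn _ (mulVec_eq_zero_of_comp (koszulMatrix₁ n q e a b c d) φ hφ))
  · exact fun φ hφ => exists_comp_vecMulLinear (koszulMatrix₁ n q e a b c d) φ
      (h.right_exact₂ hn _ (mulVec_eq_zero_of_comp (koszulMatrix₂ n q e a b c d) φ hφ))
  · exact fun φ hφ => exists_comp_vecMulLinear (koszulMatrix₂ n q e a b c d) φ
      (h.right_exact₃ hn _ (mulVec_eq_zero_of_comp (koszulMatrix₃ q a b c d) φ hφ))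
  · exact absurd rfl hi
  · intro φ _
    have : φ = 0 := LinearMap.pi_ext' fun s => s.elim0
    rw [this]
    exact zero_mem _

theorem koszulMatrix₃_mulVec (y : Fin 4 → A) : (koszulMatrix₃ q a b c d *ᵥ y) 0
    = q • (a * y 0) - q⁻¹ • (b * y 1) + c * y 2 - d * y 3 := by
  simp [koszulMatrix₃, mulVec, dotProduct, Fin.sum_univ_succ]
  abel

open MulOpposite in
/-- The entries of the last differential are, up to units, the generators `a, b, c, d`, so that the
cokernel of its transpose is the trivial right module. -/
theorem extCondition_of_koszul (h : KoszulData n q e a b c d) (hn : 1 ≤ n)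
    (hg : KoszulGrading 𝒜 n a b c d wa wb wc wd) :
    ExtCondition 𝒜 4 (wa + wb + wc + wd) := by
  let P := koszulResolution h hn hg
  refine ⟨P, koszulResolution_ext_subsingleton h hn hg, ?_⟩
  -- the value of a cochain of top degree on the basis element
  let ev : P.Cochain 4 →ₗ[Aᵐᵒᵖ] Aᵐᵒᵖ :=
    { toFun := fun φ => MulOpposite.op (φ (Pi.single (0 : Fin 1) 1))
      map_add' := fun _ _ => rfl
      map_smul' := fun _ _ => rfl }
  let Ψ : P.Cochain 4 →ₗ[Aᵐᵒᵖ] TrivialModule (opGrading 𝒜) :=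
    (irrelevantIdeal (opGrading 𝒜)).mkQ ∘ₗ ev
  have hΨ : Function.Surjective Ψ := by
    intro y
    obtain ⟨x, rfl⟩ := Submodule.mkQ_surjective _ y
    obtain ⟨ψ, hψ⟩ := exists_linearMap_single (fun _ : Fin 1 => x.unop)
    exact ⟨ψ, congrArg (irrelevantIdeal (opGrading 𝒜)).mkQ (unop_injective (hψ 0))⟩
  have hker : LinearMap.ker Ψ = P.coboundaries 4 := by
    ext φ
    have h1 : φ ∈ LinearMap.ker Ψ ↔ ev φ ∈ irrelevantIdeal (opGrading 𝒜) :=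
      Submodule.Quotient.mk_eq_zero _
    rw [h1, hg.op.mem_irrelevantIdeal]
    constructor
    · rintro ⟨x₁, x₂, x₃, x₄, hx⟩
      refine exists_comp_vecMulLinear (koszulMatrix₃ q a b c d) φ
        ⟨![q⁻¹ • x₄.unop, -(q • x₃.unop), x₂.unop, -x₁.unop], ?_⟩
      ext s
      fin_cases s
      have hx' : φ (Pi.single (0 : Fin 1) 1)
          = d * x₁.unop + c * x₂.unop + b * x₃.unop + a * x₄.unop := op_injective hx
      refine (koszulMatrix₃_mulVec _).trans (Eq.trans ?_ hx'.symm)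
      simp [smul_smul, h.q_ne_zero]
      abel
    · rintro ⟨ψ, rfl⟩
      have h2 := (comp_vecMulLinear_single (koszulMatrix₃ q a b c d) ψ 0).trans
        (koszulMatrix₃_mulVec _)
      refine ⟨-op (ψ (Pi.single (3 : Fin 4) 1)), op (ψ (Pi.single (2 : Fin 4) 1)),
        -op (q⁻¹ • ψ (Pi.single (1 : Fin 4) 1)), op (q • ψ (Pi.single (0 : Fin 4) 1)), ?_⟩
      refine unop_injective (h2.trans ?_)
      have h3 : ∀ w x y z : A, w - x + y - z = -z + y + -x + w := by
        intro w x y z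
        abel
      simp only [unop_add, unop_mul, unop_neg, unop_op, neg_mul, mul_smul_comm]
      exact h3 _ _ _ _
  have hcoc : P.cocycles 4 = ⊤ := by
    rw [eq_top_iff]
    intro φ _
    exact LinearMap.pi_ext' fun s => s.elim0
  have htop : P.ext 4 = ⊤ := by
    rw [GradedFreeResolution.ext, hcoc, Submodule.map_top, Submodule.range_mkQ]
  let E : (P.Cochain 4 ⧸ P.coboundaries 4) ≃ₗ[Aᵐᵒᵖ] TrivialModule (opGrading 𝒜) :=
    (Submodule.quotEquivOfEq _ _ hker.symm).trans (Ψ.quotKerEquivOfSurjective hΨ)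
  refine ⟨((LinearEquiv.ofEq _ _ htop).trans Submodule.topEquiv).trans E, ?_⟩
  intro j φ hφ hj
  have h1 : (((LinearEquiv.ofEq _ _ htop).trans Submodule.topEquiv).trans E) (P.extClass φ)
      = Ψ φ.1 := rfl
  rw [h1]
  refine (Submodule.Quotient.mk_eq_zero _).mpr ?_
  have h2 : φ.1 (Pi.single (0 : Fin 1) 1) ∈ intPiece 𝒜 ((wa + wb + wc + wd : ℤ) + j) :=
    hφ (0 : Fin 1)
  obtain ⟨m, hm | hm⟩ := ((wa + wb + wc + wd : ℤ) + j).eq_nat_or_neg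
  · rw [hm] at h2
    refine Submodule.subset_span ⟨m, ?_, mem_opGrading.mpr h2⟩
    rcases Nat.eq_zero_or_pos m with rfl | hm'
    · exact absurd (by push_cast at hm; linarith) hj
    · exact hm'
  · rcases Nat.eq_zero_or_pos m with rfl | hm'
    · exact absurd (by push_cast at hm; linarith) hj
    · obtain ⟨k, rfl⟩ : ∃ k, m = k + 1 := ⟨m - 1, by omega⟩
      rw [hm, show (-((k + 1 : ℕ) : ℤ)) = Int.negSucc k from rfl] at h2
      have h3 : φ.1 (Pi.single (0 : Fin 1) 1) = 0 := h2
      have h4 : ev φ.1 = 0 := congrArg MulOpposite.op h3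
      rw [h4]
      exact zero_mem _

end KoszulExt

open CategoryTheory

/-! ### Dimension shifting along a free resolution -/

section DimensionShift

variable {C : Type*} [Category* C] [Abelian C] [HasExt.{u} C] {S : ShortComplex C}

theorem subsingleton_ext_of_projective (hS : S.ShortExact) [Projective S.X₂] (Y : C) (m : ℕ)
    [h : Subsingleton (Abelian.Ext.{u} S.X₃ Y (m + 2))] :
    Subsingleton (Abelian.Ext.{u} S.X₁ Y (m + 1)) := by
  refine ⟨fun x y => ?_⟩
  have key : ∀ x : Abelian.Ext.{u} S.X₁ Y (m + 1), x = 0 := fun x => by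
    obtain ⟨w, rfl⟩ := Abelian.Ext.contravariant_sequence_exact₁ hS Y x
      (show 1 + (m + 1) = m + 2 by omega) (Subsingleton.elim _ _)
    rw [Abelian.Ext.eq_zero_of_projective w, Abelian.Ext.comp_zero]
  rw [key x, key y]

theorem exists_extension_of_subsingleton_ext (hS : S.ShortExact) (Y : C)
    [h : Subsingleton (Abelian.Ext.{u} S.X₃ Y 1)] (φ : S.X₁ ⟶ Y) : ∃ ψ : S.X₂ ⟶ Y, S.f ≫ ψ = φ := by
  obtain ⟨w, hw⟩ := Abelian.Ext.contravariant_sequence_exact₁ hS Y (Abelian.Ext.mk₀ φ)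
    (show 1 + 0 = 1 by omega) (Subsingleton.elim _ _)
  obtain ⟨ψ, rfl⟩ := Abelian.Ext.homEquiv₀.symm.surjective w
  refine ⟨ψ, Abelian.Ext.homEquiv₀.symm.injective ?_⟩
  exact (Abelian.Ext.mk₀_comp_mk₀ _ _).symm.trans hw

end DimensionShift

namespace GradedFreeResolution

variable {𝕜 : Type u} [Field 𝕜] {A : Type u} [Ring A] [Algebra 𝕜 A] {𝒜 : ℕ → Submodule 𝕜 A}
  (P : GradedFreeResolution 𝒜)

/-- The image of the differential `P_{i+1} → P_i`. -/
abbrev syzygy (i : ℕ) : Submodule A (Fin (P.rank i) → A) := LinearMap.range (P.d i)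

theorem augShortExact : ∃ S : ShortComplex (ModuleCat.{u} A), S.ShortExact ∧
    S.X₁ = ModuleCat.of A (P.syzygy 0) ∧ S.X₃ = ModuleCat.of A (TrivialModule 𝒜) ∧
    Projective S.X₂ := by
  have hex : Function.Exact (P.syzygy 0).subtype P.aug := by
    intro x
    rw [P.exact_zero x]
    simp
  exact ⟨ModuleCat.shortComplexOfCompEqZero _ _ hex.linearMap_comp_eq_zero,
    ModuleCat.shortComplex_shortExact _ hex Subtype.val_injective P.aug_surjective, rfl, rfl,
    ModuleCat.projective_of_free (Pi.basisFun A (Fin (P.rank 0)))⟩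

theorem syzygyExact (i : ℕ) :
    Function.Exact (P.syzygy (i + 1)).subtype (P.d i).rangeRestrict := by
  intro x
  have h : ((P.d i).rangeRestrict x : Fin (P.rank i) → A) = P.d i x := rfl
  rw [← Submodule.coe_eq_zero, h, P.exact_succ i x]
  simp

theorem subsingleton_ext_syzygy (Y : ModuleCat.{u} A) (i m : ℕ)
    [h : Subsingleton (Abelian.Ext.{u} (ModuleCat.of A (TrivialModule 𝒜)) Y (i + m + 2))] :
    Subsingleton (Abelian.Ext.{u} (ModuleCat.of A (P.syzygy i)) Y (m + 1)) := by
  induction i generalizing m with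
  | zero =>
    obtain ⟨S, hS, h1, h3, h2⟩ := P.augShortExact
    rw [← h1]
    rw [← h3, zero_add] at h
    exact subsingleton_ext_of_projective hS Y m
  | succ i ih =>
    have hS := ModuleCat.shortComplex_shortExact
      (ModuleCat.shortComplexOfCompEqZero _ _ (P.syzygyExact i).linearMap_comp_eq_zero)
      (P.syzygyExact i) Subtype.val_injective (P.d i).surjective_rangeRestrict
    have : Projective (ModuleCat.of A (Fin (P.rank (i + 1)) → A)) :=
      ModuleCat.projective_of_free (Pi.basisFun A (Fin (P.rank (i + 1))))
    have h' : Subsingleton (Abelian.Ext.{u} (ModuleCat.of A (P.syzygy i)) Y (m + 2)) := by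
      rw [show i + 1 + m + 2 = i + (m + 1) + 2 by omega] at h
      exact ih (m + 1)
    exact @subsingleton_ext_of_projective _ _ _ _ _ hS this Y m h'

/-- If `Ext^{i+2}(A / A_{≥ 1}, A) = 0`, then each cocycle in degree `i + 2` of `Hom_A(P, A)` is a
coboundary. -/
theorem exists_comp_d_eq (i : ℕ)
    [h : Subsingleton (Abelian.Ext.{u} (ModuleCat.of A (TrivialModule 𝒜)) (ModuleCat.of A A)
      (i + 2))] (φ : P.Cochain (i + 2)) (hφ : φ ∘ₗ P.d (i + 2) = 0) :
    ∃ ψ : P.Cochain (i + 1), ψ ∘ₗ P.d (i + 1) = φ := by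
  have h1 : Subsingleton (Abelian.Ext.{u} (ModuleCat.of A (P.syzygy i)) (ModuleCat.of A A) 1) :=
    P.subsingleton_ext_syzygy (ModuleCat.of A A) i 0
  have hS := ModuleCat.shortComplex_shortExact
    (ModuleCat.shortComplexOfCompEqZero _ _ (P.syzygyExact i).linearMap_comp_eq_zero)
    (P.syzygyExact i) Subtype.val_injective (P.d i).surjective_rangeRestrict
  have hker : LinearMap.ker (P.d (i + 1)) ≤ LinearMap.ker φ := by
    intro x hx
    obtain ⟨y, rfl⟩ := (P.exact_succ (i + 1) x).mp hx
    exact LinearMap.congr_fun hφ y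
  let φ' : P.syzygy (i + 1) →ₗ[A] A :=
    (Submodule.liftQ _ φ hker) ∘ₗ (P.d (i + 1)).quotKerEquivRange.symm.toLinearMap
  have hφ' : ∀ x, φ' ⟨P.d (i + 1) x, x, rfl⟩ = φ x := by
    intro x
    have : (P.d (i + 1)).quotKerEquivRange.symm ⟨P.d (i + 1) x, x, rfl⟩
        = (LinearMap.ker (P.d (i + 1))).mkQ x :=
      LinearMap.quotKerEquivRange_symm_apply_image _ _ _
    change Submodule.liftQ _ φ hker _ = _
    erw [this]
    rfl
  obtain ⟨ψ, hψ⟩ := exists_extension_of_subsingleton_ext hS (ModuleCat.of A A)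
    (h := h1) (ModuleCat.ofHom φ')
  refine ⟨ψ.hom, LinearMap.ext fun x => ?_⟩
  rw [← hφ' x]
  exact LinearMap.congr_fun (congrArg ModuleCat.Hom.hom hψ) ⟨P.d (i + 1) x, x, rfl⟩

end GradedFreeResolution

section KoszulDimension

variable {𝕜 : Type u} [Field 𝕜] {A : Type u} [Ring A] [Algebra 𝕜 A]
variable {n : ℕ} {q e : 𝕜} {a b c d : A} {𝒜 : ℕ → Submodule 𝕜 A} {wa wb wc wd : ℕ}

/-- Otherwise the basis element of the top cochains would be a coboundary, and `1` would be in the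
right ideal generated by `a, b, c, d`. -/
theorem not_subsingleton_ext_of_koszul (h : KoszulData n q e a b c d) (hn : 1 ≤ n)
    (hg : KoszulGrading 𝒜 n a b c d wa wb wc wd) :
    ¬ Subsingleton (Abelian.Ext.{u} (ModuleCat.of A (TrivialModule 𝒜)) (ModuleCat.of A A) 4) := by
  intro hsub
  let P := koszulResolution h hn hg
  obtain ⟨φ, hφ⟩ := exists_linearMap_single (fun _ : Fin 1 => (1 : A))
  obtain ⟨ψ, hψ⟩ := P.exists_comp_d_eq 2 φ (LinearMap.pi_ext' fun s => s.elim0)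
  have h1 := (koszulMatrix₃_mulVec _).symm.trans
    ((comp_vecMulLinear_single (koszulMatrix₃ q a b c d) ψ 0).symm.trans
      ((LinearMap.congr_fun hψ _).trans (hφ 0)))
  refine h.right_one (-ψ (Pi.single (3 : Fin 4) 1)) (ψ (Pi.single (2 : Fin 4) 1))
    (-(q⁻¹ • ψ (Pi.single (1 : Fin 4) 1))) (q • ψ (Pi.single (0 : Fin 4) 1)) (Eq.trans ?_ h1)
  have h3 : ∀ w x y z : A, -z + y + -x + w = w - x + y - z := by
    intro w x y z
    abel
  rw [mul_neg, mul_neg, mul_smul_comm, mul_smul_comm]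
  exact h3 _ _ _ _

theorem injectiveDimension_of_koszul (h : KoszulData n q e a b c d) (hn : 1 ≤ n)
    (hg : KoszulGrading 𝒜 n a b c d wa wb wc wd)
    (hA : ∀ M : ModuleCat.{u} A, HasInjectiveDimensionLT M 5) :
    injectiveDimension (ModuleCat.of A A) = 4 := by
  refine le_antisymm ((injectiveDimension_le_iff _ 4).mpr (hA _))
    ((injectiveDimension_ge_iff _ 4).mpr fun h4 => ?_)
  exact not_subsingleton_ext_of_koszul h hn hg (h4.subsingleton _ 4 4 le_rfl _)

theorem globalDim_of_koszul (h : KoszulData n q e a b c d) (hn : 1 ≤ n)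
    (hg : KoszulGrading 𝒜 n a b c d wa wb wc wd)
    (hA : ∀ M : ModuleCat.{u} A, HasInjectiveDimensionLT M 5) : globalDim A = 4 := by
  refine le_antisymm (iSup_le fun M => (projectiveDimension_le_iff _ 4).mpr ?_)
    (le_trans ((projectiveDimension_ge_iff (ModuleCat.of A (TrivialModule 𝒜)) 4).mpr
      fun h4 => ?_) (le_iSup (fun M : ModuleCat.{u} A => projectiveDimension M) _))
  · exact HasProjectiveDimensionLT.mk fun i hi Y x =>
      ((hA Y).subsingleton _ 5 i hi M).elim _ _
  · exact not_subsingleton_ext_of_koszul h hn hg (h4.subsingleton _ 4 4 le_rfl _)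

/-- The dimension and `Ext` conditions of Artin-Schelter regularity of dimension four. -/
theorem isASRegular_of_koszul (h : KoszulData n q e a b c d) (hn : 1 ≤ n)
    (hg : KoszulGrading 𝒜 n a b c d wa wb wc wd)
    (hA : ∀ M : ModuleCat.{u} A, HasInjectiveDimensionLT M 5)
    (hA' : ∀ M : ModuleCat.{u} Aᵐᵒᵖ, HasInjectiveDimensionLT M 5)
    (hc : IsConnectedGraded 𝒜) (hgk : gkDim 𝕜 A < ⊤) : IsASRegular 𝒜 4 where
  gorenstein :=
    { connectedGraded := hc
      left_injdim := injectiveDimension_of_koszul h hn hg hA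
      right_injdim := by
        have e : Aᵐᵒᵖ ≃ₗ[Aᵐᵒᵖ] A :=
          { MulOpposite.opAddEquiv.symm with map_smul' := fun _ _ => rfl }
        rw [← injectiveDimension_eq_of_iso e.toModuleIso]
        exact injectiveDimension_of_koszul h.op hn hg.op hA'
      ext := ⟨_, extCondition_of_koszul h hn hg, extCondition_of_koszul h.op hn hg.op⟩ }
  left_gldim := globalDim_of_koszul h hn hg hA
  right_gldim := globalDim_of_koszul h.op hn hg.op hA'
  gkDim_lt_top := hgk

end KoszulDimension

/-! ### Skew triples and their monomials -/

section SkewTriple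

/-- The coefficients `θ_i` in `b a ^ i = p ^ i a ^ i b + θ_i a ^ (i - 1) c ^ n`. -/
def skewCoeff {K : Type*} [CommRing K] (n : ℕ) (p q : K) : ℕ → K
  | 0 => 0
  | i + 1 => p * skewCoeff n p q i + q ^ (n * i)

/-- Elements with `c a = q a c`, `b c = q c b` and `b a = p a b + c ^ n`. For `p = 1` these are
the generators `a, b, c` of `OreAlg n q`; for `n = 1` the elements `u, v, z` of the down-up algebra
are of this type. -/
structure SkewTriple {K : Type*} [CommRing K] {A : Type*} [Ring A] [Algebra K A] (n : ℕ)
    (p q : K) (a b c : A) : Prop where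
  ca : c * a = q • (a * c)
  bc : b * c = q • (c * b)
  ba : b * a = p • (a * b) + c ^ n

/-- The ordered monomials `a ^ i c ^ j b ^ k`. -/
def skewMonomial {A : Type*} [Monoid A] (a b c : A) (m : (ℕ × ℕ) × ℕ) : A :=
  a ^ m.1.1 * c ^ m.1.2 * b ^ m.2

theorem mul_pow_of_skew {K : Type*} [CommRing K] {A : Type*} [Ring A] [Algebra K A] {r : K}
    {x y : A} (h : y * x = r • (x * y)) (i : ℕ) : y * x ^ i = r ^ i • (x ^ i * y) := by
  induction i with
  | zero => simp
  | succ i ih =>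
    rw [pow_succ, ← mul_assoc, ih, smul_mul_assoc, mul_assoc, h, mul_smul_comm, smul_smul,
      pow_succ, mul_assoc]

theorem pow_mul_of_skew {K : Type*} [CommRing K] {A : Type*} [Ring A] [Algebra K A] {r : K}
    {x y : A} (h : y * x = r • (x * y)) (i : ℕ) : y ^ i * x = r ^ i • (x * y ^ i) := by
  induction i with
  | zero => simp
  | succ i ih =>
    rw [pow_succ, mul_assoc, h, mul_smul_comm, ← mul_assoc, ih, smul_mul_assoc, smul_smul,
      pow_succ', mul_assoc]

theorem pow_mul_pow_of_skew {K : Type*} [CommRing K] {A : Type*} [Ring A] [Algebra K A] {r : K}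
    {x y : A} (h : y * x = r • (x * y)) (i j : ℕ) :
    y ^ j * x ^ i = r ^ (j * i) • (x ^ i * y ^ j) := by
  rw [mul_pow_of_skew (pow_mul_of_skew h j), pow_mul]

namespace SkewTriple

variable {K : Type*} [CommRing K] {A : Type*} [Ring A] [Algebra K A] {n : ℕ} {p q : K} {a b c : A}

theorem b_mul_pow (h : SkewTriple n p q a b c) (i : ℕ) :
    b * a ^ i = p ^ i • (a ^ i * b) + skewCoeff n p q i • (a ^ (i - 1) * c ^ n) := by
  induction i with
  | zero => simp [skewCoeff]
  | succ i ih =>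
    have h1 : skewCoeff n p q i • (a * a ^ (i - 1)) = skewCoeff n p q i • a ^ i := by
      rcases i with _ | i
      · simp [skewCoeff]
      · rw [Nat.add_sub_cancel, ← pow_succ']
    rw [pow_succ', ← mul_assoc, h.ba, add_mul, smul_mul_assoc, mul_assoc, ih, mul_add,
      mul_smul_comm, mul_smul_comm, ← mul_assoc a, ← mul_assoc a, ← smul_mul_assoc
      (skewCoeff n p q i), h1, pow_mul_pow_of_skew h.ca, Nat.add_sub_cancel, skewCoeff, add_smul,
      smul_add, smul_smul, smul_mul_assoc, smul_smul, ← pow_succ', ← pow_succ', add_assoc]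

theorem a_mul_monomial (_h : SkewTriple n p q a b c) (i j k : ℕ) :
    a * skewMonomial a b c ((i, j), k) = skewMonomial a b c ((i + 1, j), k) := by
  simp only [skewMonomial, pow_succ', mul_assoc]

theorem c_mul_monomial (h : SkewTriple n p q a b c) (i j k : ℕ) :
    c * skewMonomial a b c ((i, j), k) = q ^ i • skewMonomial a b c ((i, j + 1), k) := by
  simp only [skewMonomial]
  rw [← mul_assoc, ← mul_assoc, mul_pow_of_skew h.ca, pow_succ', smul_mul_assoc, smul_mul_assoc,
    mul_assoc (a ^ i)]

theorem b_mul_monomial (h : SkewTriple n p q a b c) (i j k : ℕ) :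
    b * skewMonomial a b c ((i, j), k) = (p ^ i * q ^ j) • skewMonomial a b c ((i, j), k + 1)
      + skewCoeff n p q i • skewMonomial a b c ((i - 1, j + n), k) := by
  simp only [skewMonomial]
  rw [← mul_assoc, ← mul_assoc, h.b_mul_pow, add_mul, add_mul, smul_mul_assoc, mul_assoc (a ^ i),
    mul_pow_of_skew h.bc, add_comm j n, pow_add c n j, pow_succ' b]
  simp only [mul_smul_comm, smul_mul_assoc, smul_smul, mul_assoc]

end SkewTriple

/-! ### The representation on the space with basis the monomials -/

section Model

variable {K : Type*} [CommRing K] (n : ℕ) (p q : K)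

/-- Left multiplication by `a` on ordered monomials. -/
noncomputable def modelA : Module.End K (((ℕ × ℕ) × ℕ) →₀ K) :=
  Finsupp.linearCombination K fun m => Finsupp.single ((m.1.1 + 1, m.1.2), m.2) 1

/-- Left multiplication by `c` on ordered monomials. -/
noncomputable def modelC : Module.End K (((ℕ × ℕ) × ℕ) →₀ K) :=
  Finsupp.linearCombination K fun m => q ^ m.1.1 • Finsupp.single ((m.1.1, m.1.2 + 1), m.2) 1

/-- Left multiplication by `b` on ordered monomials. -/
noncomputable def modelB : Module.End K (((ℕ × ℕ) × ℕ) →₀ K) :=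
  Finsupp.linearCombination K fun m =>
    (p ^ m.1.1 * q ^ m.1.2) • Finsupp.single ((m.1.1, m.1.2), m.2 + 1) 1
      + skewCoeff n p q m.1.1 • Finsupp.single ((m.1.1 - 1, m.1.2 + n), m.2) 1

variable {n p q}

theorem modelA_single (i j k : ℕ) : modelA (Finsupp.single ((i, j), k) (1 : K))
    = Finsupp.single ((i + 1, j), k) 1 := by
  simp [modelA]

theorem modelC_single (i j k : ℕ) : modelC q (Finsupp.single ((i, j), k) (1 : K))
    = q ^ i • Finsupp.single ((i, j + 1), k) 1 := by
  simp [modelC]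

theorem modelB_single (i j k : ℕ) : modelB n p q (Finsupp.single ((i, j), k) (1 : K))
    = (p ^ i * q ^ j) • Finsupp.single ((i, j), k + 1) 1
      + skewCoeff n p q i • Finsupp.single ((i - 1, j + n), k) 1 := by
  simp [modelB]

theorem modelC_pow_single (i j k m : ℕ) : (modelC q ^ m) (Finsupp.single ((i, j), k) (1 : K))
    = q ^ (m * i) • Finsupp.single ((i, j + m), k) 1 := by
  induction m with
  | zero => simp
  | succ m ih =>
    rw [pow_succ', Module.End.mul_apply, ih, map_smul, modelC_single, smul_smul, ← pow_add,
      ← add_assoc, add_one_mul]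

theorem modelA_pow_single (i j k m : ℕ) : ((modelA : Module.End K _) ^ m)
    (Finsupp.single ((i, j), k) (1 : K)) = Finsupp.single ((i + m, j), k) 1 := by
  induction m with
  | zero => simp
  | succ m ih => rw [pow_succ', Module.End.mul_apply, ih, modelA_single, add_assoc]

theorem modelB_pow_single (k m : ℕ) : (modelB n p q ^ m) (Finsupp.single ((0, 0), k) (1 : K))
    = Finsupp.single ((0, 0), k + m) 1 := by
  induction m with
  | zero => simp
  | succ m ih =>
    rw [pow_succ', Module.End.mul_apply, ih, modelB_single]
    simp [skewCoeff, add_assoc]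

theorem skewTriple_model : SkewTriple n p q (modelA : Module.End K _) (modelB n p q)
    (modelC q) where
  ca := by
    refine Finsupp.lhom_ext' fun ⟨⟨i, j⟩, k⟩ => LinearMap.ext_ring ?_
    simp only [LinearMap.comp_apply, Finsupp.lsingle_apply, Module.End.mul_apply,
      LinearMap.smul_apply, modelA_single, modelC_single, map_smul, smul_smul]
    rw [pow_succ']
  bc := by
    refine Finsupp.lhom_ext' fun ⟨⟨i, j⟩, k⟩ => LinearMap.ext_ring ?_
    simp only [LinearMap.comp_apply, Finsupp.lsingle_apply, Module.End.mul_apply,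
      LinearMap.smul_apply, modelB_single, modelC_single, map_smul, smul_smul, map_add, smul_add]
    rcases i with _ | i
    · simp [skewCoeff, pow_succ']
    · rw [Nat.add_sub_cancel, add_right_comm j 1 n]
      congr 2 <;> ring
  ba := by
    refine Finsupp.lhom_ext' fun ⟨⟨i, j⟩, k⟩ => LinearMap.ext_ring ?_
    simp only [LinearMap.comp_apply, Finsupp.lsingle_apply, Module.End.mul_apply,
      LinearMap.smul_apply, LinearMap.add_apply, modelB_single, modelA_single, map_smul, smul_smul,
      map_add, smul_add, modelC_pow_single, skewCoeff, add_smul]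
    rcases i with _ | i
    · simp [skewCoeff]
    · rw [Nat.add_sub_cancel, Nat.add_sub_cancel, ← mul_assoc, ← pow_succ', ← add_assoc]

theorem skewMonomial_model (m : (ℕ × ℕ) × ℕ) :
    skewMonomial (modelA : Module.End K _) (modelB n p q) (modelC q) m
      (Finsupp.single ((0, 0), 0) 1) = Finsupp.single m 1 := by
  obtain ⟨⟨i, j⟩, k⟩ := m
  simp only [skewMonomial, Module.End.mul_apply, modelB_pow_single, modelC_pow_single,
    mul_zero, pow_zero, one_smul, modelA_pow_single, zero_add]

end Model

theorem adjoin_le_of_mul_mem {K A : Type*} [CommRing K] [Ring A] [Algebra K A] (G : Set A)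
    (W : Submodule K A) (h1 : (1 : A) ∈ W) (h : ∀ g ∈ G, ∀ w ∈ W, g * w ∈ W) :
    Subalgebra.toSubmodule (Algebra.adjoin K G) ≤ W := by
  have key : ∀ x ∈ Algebra.adjoin K G, ∀ w ∈ W, x * w ∈ W := by
    intro x hx
    induction hx using Algebra.adjoin_induction with
    | mem x hx => exact h x hx
    | algebraMap r =>
      intro w hw
      rw [← Algebra.smul_def]
      exact W.smul_mem r hw
    | add x y _ _ hx hy =>
      intro w hw
      rw [add_mul]
      exact W.add_mem (hx w hw) (hy w hw)
    | mul x y _ _ hx hy =>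
      intro w hw
      rw [mul_assoc]
      exact hx _ (hy w hw)
  intro x hx
  simpa using key x hx 1 h1

theorem mul_mem_span_range {K A ι : Type*} [CommRing K] [Ring A] [Algebra K A] {m : ι → A}
    {g : A} (h : ∀ i, g * m i ∈ Submodule.span K (Set.range m)) :
    ∀ w ∈ Submodule.span K (Set.range m), g * w ∈ Submodule.span K (Set.range m) := by
  intro w hw
  induction hw using Submodule.span_induction with
  | mem x hx => obtain ⟨i, rfl⟩ := hx; exact h i
  | zero => rw [mul_zero]; exact zero_mem _
  | add x y _ _ hx hy => rw [mul_add]; exact add_mem hx hy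
  | smul r x _ hx => rw [mul_smul_comm]; exact Submodule.smul_mem _ r hx

theorem SkewTriple.adjoin_eq_span {K A : Type*} [CommRing K] [Ring A] [Algebra K A] {n : ℕ}
    {p q : K} {a b c : A} (h : SkewTriple n p q a b c) :
    Subalgebra.toSubmodule (Algebra.adjoin K {a, c, b})
      = Submodule.span K (Set.range (skewMonomial a b c)) := by
  refine le_antisymm (adjoin_le_of_mul_mem _ _ ?_ ?_) ?_
  · exact Submodule.subset_span ⟨((0, 0), 0), by simp [skewMonomial]⟩
  · rintro g (rfl | rfl | rfl)
    · refine mul_mem_span_range ?_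
      rintro ⟨⟨i, j⟩, k⟩
      rw [h.a_mul_monomial]
      exact Submodule.subset_span ⟨_, rfl⟩
    · refine mul_mem_span_range ?_
      rintro ⟨⟨i, j⟩, k⟩
      rw [h.c_mul_monomial]
      exact Submodule.smul_mem _ _ (Submodule.subset_span ⟨_, rfl⟩)
    · refine mul_mem_span_range ?_
      rintro ⟨⟨i, j⟩, k⟩
      rw [h.b_mul_monomial]
      exact add_mem (Submodule.smul_mem _ _ (Submodule.subset_span ⟨_, rfl⟩))
        (Submodule.smul_mem _ _ (Submodule.subset_span ⟨_, rfl⟩))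
  · rw [Submodule.span_le]
    rintro _ ⟨m, rfl⟩
    have hmem : ∀ x ∈ ({a, c, b} : Set A), x ∈ Algebra.adjoin K {a, c, b} :=
      fun x hx => Algebra.subset_adjoin hx
    rw [SetLike.mem_coe, Subalgebra.mem_toSubmodule]
    exact mul_mem (mul_mem (pow_mem (hmem a (by simp)) _) (pow_mem (hmem c (by simp)) _))
      (pow_mem (hmem b (by simp)) _)

end SkewTriple

/-! ### Bases of the down-up algebra and of the algebra on four generators -/

/-- If the products `m i * y ^ j` are a basis of `T` and the `m i` span `R`, then `T` is free as a
left `R`-module on the powers of `y`. -/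
theorem exists_unique_sum_mul_pow {𝕜 S ι : Type*} [Field 𝕜] [Ring S] [Algebra 𝕜 S]
    {R T : Subalgebra 𝕜 S} (y : S) (m : ι → S)
    (hR : Subalgebra.toSubmodule R = Submodule.span 𝕜 (Set.range m))
    (hT : Subalgebra.toSubmodule T
      = Submodule.span 𝕜 (Set.range fun s : ι × ℕ => m s.1 * y ^ s.2))
    (hli : LinearIndependent 𝕜 fun s : ι × ℕ => m s.1 * y ^ s.2) (t : S) (ht : t ∈ T) :
    ∃! p : ℕ →₀ R, t = p.sum fun i r => (r : S) * y ^ i := by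
  have hmem : ∀ s, m s ∈ R := fun s => by
    rw [← Subalgebra.mem_toSubmodule, hR]
    exact Submodule.subset_span ⟨s, rfl⟩
  have hm : LinearIndependent 𝕜 m := by
    have h := hli.comp (fun s : ι => (s, 0)) fun s s' h => (Prod.ext_iff.mp h).1
    simpa [Function.comp_def] using h
  let m' : ι → R := fun s => ⟨m s, hmem s⟩
  have hm' : LinearIndependent 𝕜 m' := LinearIndependent.of_comp R.val.toLinearMap hm
  have hspan : ⊤ ≤ Submodule.span 𝕜 (Set.range m') := by
    rintro ⟨x, hx⟩ -
    have h1 : x ∈ Submodule.span 𝕜 (Set.range m) := by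
      rw [← hR]
      exact hx
    have h2 : Set.range m = R.val.toLinearMap '' Set.range m' := by
      rw [← Set.range_comp]
      rfl
    rw [h2, ← Submodule.map_span] at h1
    obtain ⟨x', hx', hxx⟩ := h1
    have : x' = ⟨x, hx⟩ := Subtype.ext hxx
    rwa [← this]
  let bR : Module.Basis ι 𝕜 R := Module.Basis.mk hm' hspan
  let B := Finsupp.basis fun _ : ℕ => bR
  let F : (ℕ →₀ R) →ₗ[𝕜] S :=
    Finsupp.lsum 𝕜 fun i => LinearMap.mulRight 𝕜 (y ^ i) ∘ₗ R.val.toLinearMap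
  have hF : ∀ p : ℕ →₀ R, F p = p.sum fun i r => (r : S) * y ^ i := fun p => rfl
  have hFB : ∀ x, F (B x) = m x.2 * y ^ x.1 := by
    rintro ⟨i, s⟩
    simp [F, B, bR, m']
  have hli' : LinearIndependent 𝕜 (F ∘ B) := by
    have h := hli.comp (fun x : Σ _ : ℕ, ι => (x.2, x.1)) fun x x' h => by
      obtain ⟨i, s⟩ := x
      obtain ⟨i', s'⟩ := x'
      obtain ⟨rfl, rfl⟩ := Prod.ext_iff.mp h
      rfl
    convert h using 1
    exact funext hFB
  have hinj : Function.Injective F := by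
    have h : F = Finsupp.linearCombination 𝕜 (F ∘ B) ∘ₗ B.repr.toLinearMap :=
      B.ext fun x => by simp
    rw [h]
    exact (show Function.Injective (Finsupp.linearCombination 𝕜 (F ∘ B)) from hli').comp
      B.repr.injective
  have hsurj : t ∈ LinearMap.range F := by
    have h1 : t ∈ Submodule.span 𝕜 (Set.range fun s : ι × ℕ => m s.1 * y ^ s.2) := by
      rw [← hT]
      exact ht
    refine Submodule.span_le.mpr ?_ h1
    rintro _ ⟨⟨s, i⟩, rfl⟩
    exact ⟨B ⟨i, s⟩, hFB _⟩
  obtain ⟨p, rfl⟩ := hsurj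
  exact ⟨p, hF p, fun p' hp' => hinj (hp'.symm.trans rfl)⟩

namespace OreAlg

open Polynomial

variable {𝕜 : Type u} [Field 𝕜] (n : ℕ) (q : 𝕜)

section Relations

theorem a_mul_d : gen n q .a * gen n q .d = gen n q .d * gen n q .a := by
  simpa [gen] using RingQuot.mkAlgHom_rel 𝕜 (OreRel.ad (n := n) (q := q))

theorem b_mul_d : gen n q .b * gen n q .d = gen n q .d * gen n q .b := by
  simpa [gen] using RingQuot.mkAlgHom_rel 𝕜 (OreRel.bd (n := n) (q := q))

theorem c_mul_d : gen n q .c * gen n q .d = gen n q .d * gen n q .c := by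
  simpa [gen] using RingQuot.mkAlgHom_rel 𝕜 (OreRel.cd (n := n) (q := q))

theorem skewTriple : SkewTriple n 1 q (gen n q .a) (gen n q .b) (gen n q .c) where
  ca := by simpa [gen] using RingQuot.mkAlgHom_rel 𝕜 (OreRel.ca (n := n) (q := q))
  bc := by simpa [gen] using RingQuot.mkAlgHom_rel 𝕜 (OreRel.bc (n := n) (q := q))
  ba := by simpa [gen] using RingQuot.mkAlgHom_rel 𝕜 (OreRel.ba (n := n) (q := q))

end Relations

variable {n q} {B : Type*} [Ring B] [Algebra 𝕜 B]

/-- Four elements satisfying the relations, as a map from the generators. -/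
def fourElements (a b c d : B) : FourGen → B
  | .a => a
  | .b => b
  | .c => c
  | .d => d

/-- The algebra map from `OreAlg n q` given by four elements satisfying the relations. -/
noncomputable def lift {a b c d : B} (h : SkewTriple n 1 q a b c) (ad : a * d = d * a)
    (bd : b * d = d * b) (cd : c * d = d * c) : OreAlg n q →ₐ[𝕜] B :=
  RingQuot.liftAlgHom 𝕜 ⟨FreeAlgebra.lift 𝕜 (fourElements a b c d), by
    intro x y hxy
    cases hxy <;> simp only [map_mul, map_add, map_pow, map_smul, FreeAlgebra.lift_ι_apply,
      fourElements, ad, bd, cd, h.ca, h.bc, h.ba, one_smul]⟩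

theorem lift_gen {a b c d : B} (h : SkewTriple n 1 q a b c) (ad : a * d = d * a)
    (bd : b * d = d * b) (cd : c * d = d * c) (i : FourGen) :
    lift h ad bd cd (gen n q i) = fourElements a b c d i := by
  rw [lift, gen, RingQuot.liftAlgHom_mkAlgHom_apply, FreeAlgebra.lift_ι_apply]

theorem algHom_ext {φ ψ : OreAlg n q →ₐ[𝕜] B} (h : ∀ i, φ (gen n q i) = ψ (gen n q i)) :
    φ = ψ := by
  refine RingQuot.ringQuot_ext' 𝕜 φ ψ (FreeAlgebra.hom_ext (funext fun i => ?_))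
  exact h i

theorem adjoin_gen : Algebra.adjoin 𝕜 {gen n q .a, gen n q .c, gen n q .b, gen n q .d} = ⊤ := by
  rw [eq_top_iff]
  rintro x -
  obtain ⟨x, rfl⟩ := RingQuot.mkAlgHom_surjective 𝕜 (OreRel n q) x
  induction x using FreeAlgebra.induction with
  | grade0 r => rw [AlgHom.commutes]; exact Subalgebra.algebraMap_mem _ r
  | grade1 i => exact Algebra.subset_adjoin (by cases i <;> simp [gen])
  | mul x y hx hy => rw [map_mul]; exact mul_mem hx hy
  | add x y hx hy => rw [map_add]; exact add_mem hx hy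

/-- The ordered monomials `a ^ i c ^ j b ^ k d ^ l`. -/
noncomputable def monomial (n : ℕ) (q : 𝕜) (m : ((ℕ × ℕ) × ℕ) × ℕ) : OreAlg n q :=
  skewMonomial (gen n q .a) (gen n q .b) (gen n q .c) m.1 * gen n q .d ^ m.2

theorem a_mul_monomial (i j k l : ℕ) : gen n q .a * monomial n q (((i, j), k), l)
    = monomial n q (((i + 1, j), k), l) := by
  rw [monomial, ← mul_assoc, (skewTriple n q).a_mul_monomial, monomial]

theorem c_mul_monomial (i j k l : ℕ) : gen n q .c * monomial n q (((i, j), k), l)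
    = q ^ i • monomial n q (((i, j + 1), k), l) := by
  rw [monomial, ← mul_assoc, (skewTriple n q).c_mul_monomial, smul_mul_assoc, monomial]

theorem b_mul_monomial (i j k l : ℕ) : gen n q .b * monomial n q (((i, j), k), l)
    = q ^ j • monomial n q (((i, j), k + 1), l)
      + skewCoeff n 1 q i • monomial n q (((i - 1, j + n), k), l) := by
  rw [monomial, ← mul_assoc, (skewTriple n q).b_mul_monomial, add_mul, smul_mul_assoc,
    smul_mul_assoc, one_pow, one_mul, monomial, monomial]

theorem commute_d (x : OreAlg n q) : Commute (gen n q .d) x := by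
  have hx : x ∈ Algebra.adjoin 𝕜 {gen n q .a, gen n q .c, gen n q .b, gen n q .d} := by
    rw [adjoin_gen]
    trivial
  induction hx using Algebra.adjoin_induction with
  | mem x hx =>
    rcases hx with rfl | rfl | rfl | rfl
    · exact (a_mul_d n q).symm
    · exact (c_mul_d n q).symm
    · exact (b_mul_d n q).symm
    · exact Commute.refl _
  | algebraMap r => exact (Algebra.commutes r _).symm
  | add x y _ _ hx hy => exact hx.add_right hy
  | mul x y _ _ hx hy => exact hx.mul_right hy

theorem d_mul_monomial (i j k l : ℕ) : gen n q .d * monomial n q (((i, j), k), l)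
    = monomial n q (((i, j), k), l + 1) := by
  rw [(commute_d _).eq, monomial, mul_assoc, ← pow_succ, monomial]

variable (n q)

theorem span_monomial : Submodule.span 𝕜 (Set.range (monomial n q)) = ⊤ := by
  rw [eq_top_iff, ← Algebra.top_toSubmodule, ← adjoin_gen]
  refine adjoin_le_of_mul_mem _ _ ?_ ?_
  · exact Submodule.subset_span ⟨(((0, 0), 0), 0), by simp [monomial, skewMonomial]⟩
  · rintro g (rfl | rfl | rfl | rfl) <;> refine mul_mem_span_range ?_ <;>
      rintro ⟨⟨⟨i, j⟩, k⟩, l⟩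
    · rw [a_mul_monomial]
      exact Submodule.subset_span ⟨_, rfl⟩
    · rw [c_mul_monomial]
      exact Submodule.smul_mem _ _ (Submodule.subset_span ⟨_, rfl⟩)
    · rw [b_mul_monomial]
      exact add_mem (Submodule.smul_mem _ _ (Submodule.subset_span ⟨_, rfl⟩))
        (Submodule.smul_mem _ _ (Submodule.subset_span ⟨_, rfl⟩))
    · rw [d_mul_monomial]
      exact Submodule.subset_span ⟨_, rfl⟩

/-- The representation on the free `𝕜[X]`-module on the monomials in `a, b, c`, on which `d` acts
as `X`. -/
noncomputable def modelHom : OreAlg n q →ₐ[𝕜] Module.End 𝕜[X] (((ℕ × ℕ) × ℕ) →₀ 𝕜[X]) :=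
  have h := skewTriple_model (n := n) (p := (1 : 𝕜[X])) (q := C q)
  lift (a := modelA) (b := modelB n 1 (C q)) (c := modelC (C q)) (d := algebraMap 𝕜[X] _ X)
    { ca := by rw [h.ca, ← Polynomial.algebraMap_eq, algebraMap_smul]
      bc := by rw [h.bc, ← Polynomial.algebraMap_eq, algebraMap_smul]
      ba := by rw [h.ba, one_smul, one_smul] }
    (Algebra.commutes _ _).symm (Algebra.commutes _ _).symm (Algebra.commutes _ _).symm

theorem modelHom_monomial (m : (ℕ × ℕ) × ℕ) (l : ℕ) :
    modelHom n q (monomial n q (m, l)) (Finsupp.single ((0, 0), 0) 1)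
      = Finsupp.single m (X ^ l) := by
  have hd : ∀ x : ((ℕ × ℕ) × ℕ) →₀ 𝕜[X],
      (modelHom n q (gen n q .d ^ l)) x = (X : 𝕜[X]) ^ l • x := by
    intro x
    rw [map_pow, modelHom, lift_gen, fourElements, ← map_pow]
    rfl
  have hm : modelHom n q (skewMonomial (gen n q .a) (gen n q .b) (gen n q .c) m)
      = skewMonomial modelA (modelB n 1 (C q)) (modelC (C q)) m := by
    simp only [skewMonomial, map_mul, map_pow, modelHom, lift_gen, fourElements]
  rw [monomial, map_mul, Module.End.mul_apply, hd, map_smul, hm, skewMonomial_model]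
  simp

/-- In the representation `modelHom`, the monomials send a fixed vector to independent vectors. -/
theorem linearIndependent_monomial : LinearIndependent 𝕜 (monomial n q) := by
  let ev : OreAlg n q →ₗ[𝕜] (((ℕ × ℕ) × ℕ) →₀ 𝕜[X]) :=
    { toFun := fun x => modelHom n q x (Finsupp.single ((0, 0), 0) 1)
      map_add' := fun x y => by rw [map_add]; rfl
      map_smul' := fun r x => by rw [map_smul]; rfl }
  have h1 : LinearIndependent 𝕜 fun x : Σ _ : (ℕ × ℕ) × ℕ, ℕ =>
      (Finsupp.single x.1 ((X : 𝕜[X]) ^ x.2)) := by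
    have h0 : LinearIndependent 𝕜 fun l : ℕ => (X : 𝕜[X]) ^ l := by
      convert (Polynomial.basisMonomials 𝕜).linearIndependent using 1
      funext l
      simp [Polynomial.X_pow_eq_monomial]
    exact Finsupp.linearIndependent_single (f := fun _ l => (X : 𝕜[X]) ^ l) fun _ => h0
  have h2 := h1.comp (fun x : ((ℕ × ℕ) × ℕ) × ℕ => (⟨x.1, x.2⟩ : Σ _ : (ℕ × ℕ) × ℕ, ℕ))
    fun x y h => by
      cases x
      cases y
      cases h
      rfl
  refine LinearIndependent.of_comp ev ?_
  convert h2 using 1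
  funext ⟨m, l⟩
  exact modelHom_monomial n q m l

/-- The basis of ordered monomials `a ^ i c ^ j b ^ k d ^ l`. -/
noncomputable def basis : Module.Basis (((ℕ × ℕ) × ℕ) × ℕ) 𝕜 (OreAlg n q) :=
  Module.Basis.mk (linearIndependent_monomial n q) (span_monomial n q).ge

theorem basis_apply (m : ((ℕ × ℕ) × ℕ) × ℕ) : basis n q m = monomial n q m := by
  simp [basis]

end OreAlg

namespace TaftDownUp

variable {𝕜 : Type u} [Field 𝕜] (k : ℕ) (ω s : 𝕜)

theorem skewTriple : SkewTriple 1 (ω⁻¹ ^ (k + 1)) (ω⁻¹ ^ (k + 1) * s) (u k ω s) (v k ω s)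
    (z k ω s) := by
  have h1 : v k ω s ^ 2 * u k ω s = (ω⁻¹ ^ (k + 1) * (1 + s)) • (v k ω s * u k ω s * v k ω s)
      + (-(ω⁻¹ ^ (2 * (k + 1)) * s)) • (u k ω s * v k ω s ^ 2) := DownUp.rel_vvu
  have h2 : v k ω s * u k ω s ^ 2 = (ω⁻¹ ^ (k + 1) * (1 + s)) • (u k ω s * v k ω s * u k ω s)
      + (-(ω⁻¹ ^ (2 * (k + 1)) * s)) • (u k ω s ^ 2 * v k ω s) := DownUp.rel_vuu
  rw [mul_comm 2, pow_mul] at h1 h2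
  simp only [pow_two, mul_assoc] at h1 h2
  set r := ω⁻¹ ^ (k + 1)
  constructor
  · simp only [z, sub_mul, mul_sub, smul_sub, mul_assoc, smul_mul_assoc, mul_smul_comm, h2]
    match_scalars <;> ring
  · simp only [z, sub_mul, mul_sub, smul_sub, mul_assoc, smul_mul_assoc, mul_smul_comm, h1]
    match_scalars <;> ring
  · simp only [z, pow_one]
    abel

variable {k ω s} in
/-- The relations of the down-up algebra, in terms of `u, v, z`. -/
theorem lift_rel {B : Type*} [Ring B] [Algebra 𝕜 B] {U V Z : B}
    (h : SkewTriple 1 (ω⁻¹ ^ (k + 1)) (ω⁻¹ ^ (k + 1) * s) U V Z) :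
    V ^ 2 * U = (ω⁻¹ ^ (k + 1) * (1 + s)) • (V * U * V)
        + (-(ω⁻¹ ^ (2 * (k + 1)) * s)) • (U * V ^ 2) ∧
      V * U ^ 2 = (ω⁻¹ ^ (k + 1) * (1 + s)) • (U * V * U)
        + (-(ω⁻¹ ^ (2 * (k + 1)) * s)) • (U ^ 2 * V) := by
  rw [mul_comm 2, pow_mul]
  set r := ω⁻¹ ^ (k + 1)
  have h1 := h.ba
  have h2 := h.bc
  have h3 := h.ca
  rw [pow_one] at h1
  have hZ : Z = V * U - r • (U * V) := by rw [h1]; abel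
  rw [hZ] at h2 h3
  simp only [pow_two, mul_assoc, sub_mul, mul_sub, smul_mul_assoc, mul_smul_comm, smul_sub] at *
  constructor
  · rw [sub_eq_iff_eq_add] at h2
    rw [h2]
    match_scalars <;> ring
  · rw [sub_eq_iff_eq_add] at h3
    rw [h3]
    match_scalars <;> ring

/-- The algebra map from the down-up algebra given by elements `U, V, Z` which satisfy the
relations of `u, v, z`. -/
noncomputable def lift {k : ℕ} {ω s : 𝕜} {B : Type*} [Ring B] [Algebra 𝕜 B] {U V Z : B}
    (h : SkewTriple 1 (ω⁻¹ ^ (k + 1)) (ω⁻¹ ^ (k + 1) * s) U V Z) : TaftDownUp k ω s →ₐ[𝕜] B :=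
  RingQuot.liftAlgHom 𝕜 ⟨FreeAlgebra.lift 𝕜 fun | .u => U | .v => V, by
    intro x y hxy
    cases hxy
    · simpa only [map_mul, map_add, map_pow, map_smul, FreeAlgebra.lift_ι_apply]
        using (lift_rel h).1
    · simpa only [map_mul, map_add, map_pow, map_smul, FreeAlgebra.lift_ι_apply]
        using (lift_rel h).2⟩

variable {k ω s} in
theorem lift_u {B : Type*} [Ring B] [Algebra 𝕜 B] {U V Z : B}
    (h : SkewTriple 1 (ω⁻¹ ^ (k + 1)) (ω⁻¹ ^ (k + 1) * s) U V Z) : lift h (u k ω s) = U :=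
  (RingQuot.liftAlgHom_mkAlgHom_apply 𝕜 _ _ (FreeAlgebra.ι 𝕜 DownUpGen.u)).trans
    (FreeAlgebra.lift_ι_apply _ DownUpGen.u)

variable {k ω s} in
theorem lift_v {B : Type*} [Ring B] [Algebra 𝕜 B] {U V Z : B}
    (h : SkewTriple 1 (ω⁻¹ ^ (k + 1)) (ω⁻¹ ^ (k + 1) * s) U V Z) : lift h (v k ω s) = V :=
  (RingQuot.liftAlgHom_mkAlgHom_apply 𝕜 _ _ (FreeAlgebra.ι 𝕜 DownUpGen.v)).trans
    (FreeAlgebra.lift_ι_apply _ DownUpGen.v)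

variable {k ω s} in
theorem lift_z {B : Type*} [Ring B] [Algebra 𝕜 B] {U V Z : B}
    (h : SkewTriple 1 (ω⁻¹ ^ (k + 1)) (ω⁻¹ ^ (k + 1) * s) U V Z) : lift h (z k ω s) = Z := by
  rw [z, map_sub, map_smul, map_mul, map_mul, lift_u, lift_v, h.ba, pow_one, add_sub_cancel_left]

theorem adjoin_gen : Algebra.adjoin 𝕜 {u k ω s, z k ω s, v k ω s} = ⊤ := by
  rw [eq_top_iff]
  rintro x -
  induction x using induction with
  | hu => exact Algebra.subset_adjoin (by simp)
  | hv => exact Algebra.subset_adjoin (by simp)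
  | hc r => exact Subalgebra.algebraMap_mem _ r
  | hmul x y hx hy => exact mul_mem hx hy
  | hadd x y hx hy => exact add_mem hx hy

/-- The ordered monomials `u ^ i z ^ j v ^ l`. -/
noncomputable def monomial (m : (ℕ × ℕ) × ℕ) : TaftDownUp k ω s :=
  skewMonomial (u k ω s) (v k ω s) (z k ω s) m

theorem span_monomial : Submodule.span 𝕜 (Set.range (monomial k ω s)) = ⊤ := by
  rw [← Algebra.top_toSubmodule, ← adjoin_gen k ω s, (skewTriple k ω s).adjoin_eq_span]
  rfl

theorem linearIndependent_monomial : LinearIndependent 𝕜 (monomial k ω s) := by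
  let φ := lift (skewTriple_model (n := 1) (p := ω⁻¹ ^ (k + 1)) (q := ω⁻¹ ^ (k + 1) * s))
  let ev : TaftDownUp k ω s →ₗ[𝕜] (((ℕ × ℕ) × ℕ) →₀ 𝕜) :=
    LinearMap.applyₗ (Finsupp.single ((0, 0), 0) 1) ∘ₗ φ.toLinearMap
  refine LinearIndependent.of_comp ev ?_
  convert (Finsupp.basisSingleOne (R := 𝕜) (ι := (ℕ × ℕ) × ℕ)).linearIndependent using 1
  funext m
  have hm : φ (monomial k ω s m) = skewMonomial modelA
      (modelB 1 (ω⁻¹ ^ (k + 1)) (ω⁻¹ ^ (k + 1) * s)) (modelC (ω⁻¹ ^ (k + 1) * s)) m := by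
    simp only [monomial, skewMonomial, map_mul, map_pow, φ, lift_u, lift_v, lift_z]
  change φ (monomial k ω s m) (Finsupp.single ((0, 0), 0) 1) = _
  rw [hm, skewMonomial_model, Finsupp.coe_basisSingleOne]

/-- The basis of ordered monomials `u ^ i z ^ j v ^ l`. -/
noncomputable def basis : Module.Basis ((ℕ × ℕ) × ℕ) 𝕜 (TaftDownUp k ω s) :=
  Module.Basis.mk (linearIndependent_monomial k ω s) (span_monomial k ω s).ge

theorem basis_apply (m : (ℕ × ℕ) × ℕ) : basis k ω s m = monomial k ω s m := by
  simp [basis]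

end TaftDownUp

/-! ### The iterated Ore extension and its global dimension -/

section OreStep

open CategoryTheory

variable {𝕜 : Type u} [Field 𝕜] {S : Type u} [Ring S] [Algebra 𝕜 S]

theorem skew_mem_adjoin (G : Set S) (φ : S →ₐ[𝕜] S) (y : S)
    (hφ : ∀ g ∈ G, φ g ∈ Algebra.adjoin 𝕜 G)
    (hδ : ∀ g ∈ G, y * g - φ g * y ∈ Algebra.adjoin 𝕜 G) :
    ∀ r ∈ Algebra.adjoin 𝕜 G, φ r ∈ Algebra.adjoin 𝕜 G ∧ y * r - φ r * y ∈ Algebra.adjoin 𝕜 G := by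
  intro r hr
  induction hr using Algebra.adjoin_induction with
  | mem x hx => exact ⟨hφ x hx, hδ x hx⟩
  | algebraMap t =>
    rw [AlgHom.commutes, ← Algebra.commutes t y, sub_self]
    exact ⟨Subalgebra.algebraMap_mem _ t, zero_mem _⟩
  | add x x' _ _ hx hx' =>
    rw [map_add, mul_add, add_mul, add_sub_add_comm]
    exact ⟨add_mem hx.1 hx'.1, add_mem hx.2 hx'.2⟩
  | mul x x' hxm hxm' hx hx' =>
    rw [map_mul]
    refine ⟨mul_mem hx.1 hx'.1, ?_⟩
    have : y * (x * x') - φ x * φ x' * y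
        = φ x * (y * x' - φ x' * y) + (y * x - φ x * y) * x' := by noncomm_ring
    rw [this]
    exact add_mem (mul_mem hx.1 hx'.2) (mul_mem hx.2 hxm')

/-- A subalgebra generated by `G` and a further element `y` which skew commutes with `G`, up to an
automorphism `φ` and terms in the subalgebra, form an Ore extension as soon as the monomials in
`y` over a basis are linearly independent. -/
theorem exists_isOreExtension {ι : Type*} (G : Set S) (T : Subalgebra 𝕜 S) (y : S)
    (φ : S ≃ₐ[𝕜] S) (m : ι → S)
    (hR : Subalgebra.toSubmodule (Algebra.adjoin 𝕜 G) = Submodule.span 𝕜 (Set.range m))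
    (hT : Subalgebra.toSubmodule T
      = Submodule.span 𝕜 (Set.range fun s : ι × ℕ => m s.1 * y ^ s.2))
    (hli : LinearIndependent 𝕜 fun s : ι × ℕ => m s.1 * y ^ s.2) (hy : y ∈ T)
    (hφ : ∀ g ∈ G, φ g ∈ Algebra.adjoin 𝕜 G) (hφ' : ∀ g ∈ G, φ.symm g ∈ Algebra.adjoin 𝕜 G)
    (hδ : ∀ g ∈ G, y * g - φ g * y ∈ Algebra.adjoin 𝕜 G) :
    ∃ (σ : Algebra.adjoin 𝕜 G ≃ₐ[𝕜] Algebra.adjoin 𝕜 G)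
      (δ : Algebra.adjoin 𝕜 G →ₗ[𝕜] Algebra.adjoin 𝕜 G),
      (∀ r, (σ r : S) = φ r) ∧ (∀ r, (δ r : S) = y * r - φ r * y) ∧
      IsOreExtension (Algebra.adjoin 𝕜 G) T y σ δ := by
  have hmem := skew_mem_adjoin G φ.toAlgHom y hφ hδ
  have hmap : (Algebra.adjoin 𝕜 G).map φ.toAlgHom = Algebra.adjoin 𝕜 G := by
    refine le_antisymm ?_ ?_
    · rintro _ ⟨r, hr, rfl⟩
      exact (hmem r hr).1
    · refine Algebra.adjoin_le fun g hg => ⟨φ.symm g, hφ' g hg, φ.apply_symm_apply g⟩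
  let σ : Algebra.adjoin 𝕜 G ≃ₐ[𝕜] Algebra.adjoin 𝕜 G :=
    (φ.subalgebraMap (Algebra.adjoin 𝕜 G)).trans (Subalgebra.equivOfEq _ _ hmap)
  have hσ : ∀ r, (σ r : S) = φ r := fun r => rfl
  let δ : Algebra.adjoin 𝕜 G →ₗ[𝕜] Algebra.adjoin 𝕜 G :=
    { toFun := fun r => ⟨y * r - φ r * y, (hmem r r.2).2⟩
      map_add' := fun r r' => Subtype.ext <| by
        simp only [Subalgebra.coe_add, map_add, mul_add, add_mul]
        abel
      map_smul' := fun t r => Subtype.ext <| by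
        simp only [Subalgebra.coe_smul, map_smul, mul_smul_comm, smul_mul_assoc, smul_sub,
          RingHom.id_apply] }
  have hδ' : ∀ r, (δ r : S) = y * r - φ r * y := fun r => rfl
  refine ⟨σ, δ, hσ, hδ', ?_, hy, ?_, ?_, ?_⟩
  · rw [← Subalgebra.toSubmodule.le_iff_le, hR, hT, Submodule.span_le]
    rintro _ ⟨i, rfl⟩
    exact Submodule.subset_span ⟨(i, 0), by simp⟩
  · intro r r'
    apply Subtype.ext
    simp only [Subalgebra.coe_add, Subalgebra.coe_mul, hδ', hσ, map_mul]
    noncomm_ring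
  · intro r
    rw [hδ', hσ]
    abel
  · exact exists_unique_sum_mul_pow y m hR hT hli

theorem IsOreExtension.hasInjectiveDimensionLT {R T : Subalgebra 𝕜 S} {y : S} {σ : R ≃ₐ[𝕜] R}
    {δ : R →ₗ[𝕜] R} (h : IsOreExtension R T y σ δ) (n : ℕ)
    (hR : ∀ M : ModuleCat.{u} R, HasInjectiveDimensionLT M (n + 1)) (M : ModuleCat.{u} T) :
    HasInjectiveDimensionLT M (n + 2) := by
  refine hasInjectiveDimensionLT_of_ore (Subalgebra.inclusion h.le).toRingHom ⟨y, h.mem⟩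
    (σ : R →+* R) δ (fun r => Subtype.ext (h.comm r)) ?_ n hR M
  rintro ⟨t, ht⟩
  have hsum : ∀ p : ℕ →₀ R, ((p.sum fun i r => (Subalgebra.inclusion h.le).toRingHom r
      * (⟨y, h.mem⟩ : T) ^ i : T) : S) = p.sum fun i r => (r : S) * y ^ i := by
    intro p
    rw [Finsupp.sum, Finsupp.sum, AddSubmonoidClass.coe_finsetSum]
    rfl
  obtain ⟨p, hp, huniq⟩ := h.basis t ht
  refine ⟨p, Subtype.ext (hp.trans (hsum p).symm), fun p' hp' => huniq p' ?_⟩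
  exact (congrArg Subtype.val hp').trans (hsum p')

/-- A bound for the injective dimensions of all modules is invariant under ring isomorphisms. -/
theorem hasInjectiveDimensionLT_of_ringEquiv {R S : Type u} [Ring R] [Ring S] (e : R ≃+* S)
    (n : ℕ) (hR : ∀ M : ModuleCat.{u} R, HasInjectiveDimensionLT M (n + 1))
    (M : ModuleCat.{u} S) : HasInjectiveDimensionLT M (n + 1) := by
  let N : ModuleCat.{u} R := (ModuleCat.restrictScalars e.toRingHom).obj M
  let := RingHomInvPair.of_ringEquiv e
  let := RingHomInvPair.of_ringEquiv e.symm
  have E : N ≃ₛₗ[RingHomClass.toRingHom e] M :=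
    { AddEquiv.refl M with map_smul' := fun _ _ => rfl }
  exact (ModuleCat.hasInjectiveDimensionLE_iff_of_semiLinearEquiv e E n).mp (hR N)

end OreStep

namespace OreAlg

open CategoryTheory

variable {𝕜 : Type u} [Field 𝕜] {n : ℕ} {q : 𝕜}

variable (q) in
theorem skewTriple_scale (μ ν κ : 𝕜) (h : μ * ν = κ ^ n) :
    SkewTriple n 1 q (μ • gen n q .a) (ν • gen n q .b) (κ • gen n q .c) := by
  have t := skewTriple n q
  constructor
  · simp only [smul_mul_assoc, mul_smul_comm, t.ca, smul_smul]
    congr 1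
    ring
  · simp only [smul_mul_assoc, mul_smul_comm, t.bc, smul_smul]
    congr 1
    ring
  · simp only [smul_mul_assoc, mul_smul_comm, t.ba, smul_smul, smul_add, smul_pow, one_smul, ← h]
    rw [mul_comm ν μ, one_mul]

/-- The endomorphism which multiplies `a, b, c` by `μ, ν, κ` and fixes `d`. -/
noncomputable def scaleHom (μ ν κ : 𝕜) (h : μ * ν = κ ^ n) : OreAlg n q →ₐ[𝕜] OreAlg n q :=
  lift (skewTriple_scale q μ ν κ h) (commute_d _).symm (commute_d _).symm (commute_d _).symm

theorem scaleHom_gen (μ ν κ : 𝕜) (h : μ * ν = κ ^ n) (i : FourGen) :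
    scaleHom (q := q) μ ν κ h (gen n q i)
      = fourElements (μ • gen n q .a) (ν • gen n q .b) (κ • gen n q .c) (gen n q .d) i :=
  lift_gen (skewTriple_scale q μ ν κ h) (commute_d _).symm (commute_d _).symm (commute_d _).symm i

theorem scaleHom_comp (μ ν κ μ' ν' κ' : 𝕜) (h : μ * ν = κ ^ n) (h' : μ' * ν' = κ' ^ n)
    (hμ : μ * μ' = 1) (hν : ν * ν' = 1) (hκ : κ * κ' = 1) :
    (scaleHom (q := q) μ ν κ h).comp (scaleHom μ' ν' κ' h') = AlgHom.id 𝕜 _ := by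
  refine algHom_ext fun i => ?_
  rw [AlgHom.comp_apply, scaleHom_gen]
  cases i <;>
    simp only [fourElements, map_smul, scaleHom_gen, smul_smul, AlgHom.coe_id, id_eq, mul_comm μ',
      mul_comm ν', mul_comm κ', hμ, hν, hκ, one_smul]

/-- The automorphism which multiplies `a, b, c` by `μ, ν, κ` and fixes `d`. -/
noncomputable def scale (μ ν κ : 𝕜) (h : μ * ν = κ ^ n) (hμ : μ ≠ 0) (hν : ν ≠ 0) (hκ : κ ≠ 0) :
    OreAlg n q ≃ₐ[𝕜] OreAlg n q :=
  AlgEquiv.ofAlgHom (scaleHom μ ν κ h)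
    (scaleHom μ⁻¹ ν⁻¹ κ⁻¹ (by rw [← mul_inv, h, inv_pow]))
    (scaleHom_comp _ _ _ _ _ _ _ _ (mul_inv_cancel₀ hμ) (mul_inv_cancel₀ hν) (mul_inv_cancel₀ hκ))
    (scaleHom_comp _ _ _ _ _ _ _ _ (inv_mul_cancel₀ hμ) (inv_mul_cancel₀ hν) (inv_mul_cancel₀ hκ))

theorem scale_gen (μ ν κ : 𝕜) (h : μ * ν = κ ^ n) (hμ : μ ≠ 0) (hν : ν ≠ 0) (hκ : κ ≠ 0)
    (i : FourGen) : scale (q := q) μ ν κ h hμ hν hκ (gen n q i)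
      = fourElements (μ • gen n q .a) (ν • gen n q .b) (κ • gen n q .c) (gen n q .d) i :=
  scaleHom_gen μ ν κ h i

theorem scale_symm_gen (μ ν κ : 𝕜) (h : μ * ν = κ ^ n) (hμ : μ ≠ 0) (hν : ν ≠ 0) (hκ : κ ≠ 0)
    (i : FourGen) : (scale (q := q) μ ν κ h hμ hν hκ).symm (gen n q i)
      = fourElements (μ⁻¹ • gen n q .a) (ν⁻¹ • gen n q .b) (κ⁻¹ • gen n q .c) (gen n q .d) i :=
  scaleHom_gen μ⁻¹ ν⁻¹ κ⁻¹ (by rw [← mul_inv, h, inv_pow]) i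

variable (n q)

theorem adjoin_a : Subalgebra.toSubmodule (Algebra.adjoin 𝕜 {gen n q .a})
    = Submodule.span 𝕜 (Set.range fun i : ℕ => gen n q .a ^ i) := by
  refine le_antisymm (adjoin_le_of_mul_mem _ _ ?_ ?_) ?_
  · exact Submodule.subset_span ⟨0, pow_zero _⟩
  · rintro g rfl
    refine mul_mem_span_range fun i => ?_
    rw [← pow_succ']
    exact Submodule.subset_span ⟨i + 1, rfl⟩
  · rw [Submodule.span_le]
    rintro _ ⟨i, rfl⟩
    exact (Subalgebra.mem_toSubmodule _).mpr
      (pow_mem (Algebra.subset_adjoin (Set.mem_singleton _)) i)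

theorem adjoin_ac : Subalgebra.toSubmodule (Algebra.adjoin 𝕜 {gen n q .a, gen n q .c})
    = Submodule.span 𝕜 (Set.range fun m : ℕ × ℕ => gen n q .a ^ m.1 * gen n q .c ^ m.2) := by
  refine le_antisymm (adjoin_le_of_mul_mem _ _ ?_ ?_) ?_
  · exact Submodule.subset_span ⟨(0, 0), by simp⟩
  · rintro g (rfl | rfl) <;> refine mul_mem_span_range fun m => ?_
    · rw [← mul_assoc, ← pow_succ']
      exact Submodule.subset_span ⟨(m.1 + 1, m.2), rfl⟩
    · rw [← mul_assoc, mul_pow_of_skew (skewTriple n q).ca, smul_mul_assoc, mul_assoc, ← pow_succ']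
      exact Submodule.smul_mem _ _ (Submodule.subset_span ⟨(m.1, m.2 + 1), rfl⟩)
  · rw [Submodule.span_le]
    rintro _ ⟨m, rfl⟩
    exact (Subalgebra.mem_toSubmodule _).mpr (mul_mem
      (pow_mem (Algebra.subset_adjoin (by simp)) _) (pow_mem (Algebra.subset_adjoin (by simp)) _))

theorem isOreExtension_a : IsOreExtension (⊥ : Subalgebra 𝕜 (OreAlg n q))
    (Algebra.adjoin 𝕜 {gen n q .a}) (gen n q .a) AlgEquiv.refl 0 := by
  have hli := linearIndependent_monomial n q
  have hl : LinearIndependent 𝕜 fun s : Unit × ℕ => (1 : OreAlg n q) * gen n q .a ^ s.2 := by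
    have := hli.comp (fun s : Unit × ℕ => (((s.2, 0), 0), 0)) fun s s' h => by
      simpa [Prod.ext_iff] using h
    simpa [Function.comp_def, monomial, skewMonomial] using this
  obtain ⟨σ, δ, hσ, hδ, h⟩ := exists_isOreExtension (𝕜 := 𝕜) ∅ (Algebra.adjoin 𝕜 {gen n q .a})
    (gen n q .a) AlgEquiv.refl (fun _ : Unit => (1 : OreAlg n q))
    (by simp [Algebra.adjoin_empty, Algebra.toSubmodule_bot, Submodule.one_eq_span])
    (by
      rw [adjoin_a]
      congr 1
      ext x
      simp) hl (Algebra.subset_adjoin (Set.mem_singleton _)) (by simp) (by simp) (by simp)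
  have h0 : Algebra.adjoin 𝕜 (∅ : Set (OreAlg n q)) = ⊥ := Algebra.adjoin_empty _ _
  have hσ1 : σ = AlgEquiv.refl := AlgEquiv.ext fun r => Subtype.ext (hσ r)
  have hδ0 : δ = 0 := by
    refine LinearMap.ext fun r => Subtype.ext ((hδ r).trans ?_)
    obtain ⟨r, hr⟩ := r
    rw [h0] at hr
    obtain ⟨r, rfl⟩ := hr
    exact sub_eq_zero.mpr (Algebra.commutes r _).symm
  subst hσ1 hδ0
  rw [h0] at h
  exact h

theorem isOreExtension_c (hq : q ≠ 0) :
    ∃ σ : Algebra.adjoin 𝕜 {gen n q .a} ≃ₐ[𝕜] Algebra.adjoin 𝕜 {gen n q .a},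
      (∀ r : Algebra.adjoin 𝕜 {gen n q .a}, (r : OreAlg n q) = gen n q .a →
        (σ r : OreAlg n q) = q • gen n q .a) ∧
      IsOreExtension (Algebra.adjoin 𝕜 {gen n q .a}) (Algebra.adjoin 𝕜 {gen n q .a, gen n q .c})
        (gen n q .c) σ 0 := by
  have hli := linearIndependent_monomial n q
  have t := skewTriple n q
  have hl : LinearIndependent 𝕜 fun s : ℕ × ℕ => gen n q .a ^ s.1 * gen n q .c ^ s.2 := by
    have := hli.comp (fun s : ℕ × ℕ => ((s, 0), 0)) fun s s' h => by
      simpa [Prod.ext_iff] using h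
    simpa [Function.comp_def, monomial, skewMonomial] using this
  obtain ⟨σ, δ, hσ, hδ, h⟩ := exists_isOreExtension (𝕜 := 𝕜) {gen n q .a}
    (Algebra.adjoin 𝕜 {gen n q .a, gen n q .c}) (gen n q .c)
    (scale q q⁻¹ 1 (by rw [mul_inv_cancel₀ hq, one_pow]) hq (inv_ne_zero hq) one_ne_zero)
    (fun i : ℕ => gen n q .a ^ i) (adjoin_a n q) (adjoin_ac n q) hl
    (Algebra.subset_adjoin (by simp))
    (by
      rintro g rfl
      rw [scale_gen]
      exact Subalgebra.smul_mem _ (Algebra.subset_adjoin (Set.mem_singleton _)) _)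
    (by
      rintro g rfl
      rw [scale_symm_gen]
      exact Subalgebra.smul_mem _ (Algebra.subset_adjoin (Set.mem_singleton _)) _)
    (by
      rintro g rfl
      rw [scale_gen, fourElements, t.ca, smul_mul_assoc, sub_self]
      exact zero_mem _)
  have hδ0 : δ = 0 := by
    refine LinearMap.ext fun r => Subtype.ext ((hδ r).trans ?_)
    obtain ⟨r, hr⟩ := r
    dsimp only
    induction hr using Algebra.adjoin_induction with
    | mem x hx =>
      obtain rfl := hx
      rw [scale_gen, fourElements, t.ca, smul_mul_assoc, sub_self]
      rfl
    | algebraMap r =>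
      rw [AlgEquiv.commutes, ← Algebra.commutes r, sub_self]
      rfl
    | add x y _ _ hx hy =>
      rw [map_add, mul_add, add_mul, add_sub_add_comm, hx, hy]
      exact add_zero _
    | mul x y _ _ hx hy =>
      rw [map_mul, ← mul_assoc, sub_eq_zero.mp hx, mul_assoc, sub_eq_zero.mp hy, mul_assoc,
        sub_self]
      rfl
  refine ⟨σ, fun r hr => ?_, hδ0 ▸ h⟩
  rw [hσ, hr, scale_gen]
  rfl

theorem isOreExtension_b (hq : q ≠ 0) :
    ∃ (τ : Algebra.adjoin 𝕜 {gen n q .a, gen n q .c} ≃ₐ[𝕜]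
        Algebra.adjoin 𝕜 {gen n q .a, gen n q .c})
      (δ : Algebra.adjoin 𝕜 {gen n q .a, gen n q .c} →ₗ[𝕜]
        Algebra.adjoin 𝕜 {gen n q .a, gen n q .c}),
      (∀ r : Algebra.adjoin 𝕜 {gen n q .a, gen n q .c}, (r : OreAlg n q) = gen n q .a →
        (τ r : OreAlg n q) = gen n q .a ∧ (δ r : OreAlg n q) = gen n q .c ^ n) ∧
      (∀ r : Algebra.adjoin 𝕜 {gen n q .a, gen n q .c}, (r : OreAlg n q) = gen n q .c →
        (τ r : OreAlg n q) = q • gen n q .c ∧ (δ r : OreAlg n q) = 0) ∧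
      IsOreExtension (Algebra.adjoin 𝕜 {gen n q .a, gen n q .c})
        (Algebra.adjoin 𝕜 {gen n q .a, gen n q .c, gen n q .b}) (gen n q .b) τ δ := by
  have hli := linearIndependent_monomial n q
  have t := skewTriple n q
  have hl : LinearIndependent 𝕜 fun s : (ℕ × ℕ) × ℕ =>
      gen n q .a ^ s.1.1 * gen n q .c ^ s.1.2 * gen n q .b ^ s.2 := by
    have := hli.comp (fun s : (ℕ × ℕ) × ℕ => (s, 0)) fun s s' h => by
      simpa [Prod.ext_iff] using h
    simpa [Function.comp_def, monomial, skewMonomial] using this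
  have ha : gen n q .a ∈ Algebra.adjoin 𝕜 {gen n q .a, gen n q .c} :=
    Algebra.subset_adjoin (by simp)
  have hc : gen n q .c ∈ Algebra.adjoin 𝕜 {gen n q .a, gen n q .c} :=
    Algebra.subset_adjoin (by simp)
  obtain ⟨σ, δ, hσ, hδ, h⟩ := exists_isOreExtension (𝕜 := 𝕜) {gen n q .a, gen n q .c}
    (Algebra.adjoin 𝕜 {gen n q .a, gen n q .c, gen n q .b}) (gen n q .b)
    (scale 1 (q ^ n) q (one_mul _) one_ne_zero (pow_ne_zero n hq) hq)
    (fun m : ℕ × ℕ => gen n q .a ^ m.1 * gen n q .c ^ m.2) (adjoin_ac n q) t.adjoin_eq_span hl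
    (Algebra.subset_adjoin (by simp))
    (by
      rintro g (rfl | rfl) <;> rw [scale_gen]
      · exact Subalgebra.smul_mem _ ha _
      · exact Subalgebra.smul_mem _ hc _)
    (by
      rintro g (rfl | rfl) <;> rw [scale_symm_gen]
      · exact Subalgebra.smul_mem _ ha _
      · exact Subalgebra.smul_mem _ hc _)
    (by
      rintro g (rfl | rfl) <;> rw [scale_gen]
      · rw [fourElements, t.ba, one_smul, one_smul, add_sub_cancel_left]
        exact pow_mem hc n
      · rw [fourElements, t.bc, smul_mul_assoc, sub_self]
        exact zero_mem _)
  refine ⟨σ, δ, fun r hr => ⟨?_, ?_⟩, fun r hr => ⟨?_, ?_⟩, h⟩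
  · rw [hσ, hr, scale_gen, fourElements, one_smul]
  · rw [hδ, hr, scale_gen, fourElements, t.ba, one_smul, one_smul, add_sub_cancel_left]
  · rw [hσ, hr, scale_gen, fourElements]
  · rw [hδ, hr, scale_gen, fourElements, t.bc, smul_mul_assoc, sub_self]

theorem isOreExtension_d :
    IsOreExtension (Algebra.adjoin 𝕜 {gen n q .a, gen n q .c, gen n q .b}) ⊤ (gen n q .d)
      AlgEquiv.refl 0 := by
  have hli := linearIndependent_monomial n q
  have t := skewTriple n q
  obtain ⟨σ, δ, hσ, hδ, h⟩ := exists_isOreExtension (𝕜 := 𝕜)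
    {gen n q .a, gen n q .c, gen n q .b} ⊤ (gen n q .d) AlgEquiv.refl
    (skewMonomial (gen n q .a) (gen n q .b) (gen n q .c)) t.adjoin_eq_span
    (by
      rw [Algebra.top_toSubmodule, ← span_monomial n q]
      rfl) hli trivial (fun g hg => Algebra.subset_adjoin hg)
    (fun g hg => Algebra.subset_adjoin hg)
    (fun g hg => by
      rw [(commute_d g).eq, AlgEquiv.coe_refl, id_eq, sub_self]
      exact zero_mem _)
  have hσ1 : σ = AlgEquiv.refl := AlgEquiv.ext fun r => Subtype.ext (hσ r)
  have hδ0 : δ = 0 := LinearMap.ext fun r => Subtype.ext <| (hδ r).trans <| by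
    rw [(commute_d (r : OreAlg n q)).eq, AlgEquiv.coe_refl, id_eq, sub_self]
    rfl
  subst hσ1 hδ0
  exact h

theorem isIteratedOreExtension (hq : q ≠ 0) : IsIteratedOreExtension n q :=
  ⟨isOreExtension_a n q, isOreExtension_c n q hq, isOreExtension_b n q hq, isOreExtension_d n q⟩

theorem hasInjectiveDimensionLT (hq : q ≠ 0) (M : ModuleCat.{u} (OreAlg n q)) :
    HasInjectiveDimensionLT M 5 := by
  obtain ⟨h1, ⟨σ, -, h2⟩, ⟨τ, δ, -, -, h3⟩, h4⟩ := isIteratedOreExtension n q hq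
  have h0 : ∀ M : ModuleCat.{u} (⊥ : Subalgebra 𝕜 (OreAlg n q)), HasInjectiveDimensionLT M 1 := by
    have : Nontrivial (OreAlg n q) := nontrivial_of_ne _ _ ((basis n q).ne_zero (((0, 0), 0), 0))
    have : IsSemisimpleRing (⊥ : Subalgebra 𝕜 (OreAlg n q)) :=
      (Algebra.botEquivOfInjective (FaithfulSMul.algebraMap_injective 𝕜
        (OreAlg n q))).symm.toRingEquiv.isSemisimpleRing
    exact hasInjectiveDimensionLT_one_of_isSemisimpleRing
  exact hasInjectiveDimensionLT_of_ringEquiv Subalgebra.topEquiv.toRingEquiv 4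
    (h4.hasInjectiveDimensionLT 3 (h3.hasInjectiveDimensionLT 2 (h2.hasInjectiveDimensionLT 1
      (h1.hasInjectiveDimensionLT 0 h0)))) M

end OreAlg

/-! ### Regular sequences in the algebra on four generators -/

/-- A coordinate of the image of `x` under a map which sends basis elements to multiples of basis
elements, when only one of them contributes. -/
theorem Module.Basis.repr_map_apply {K M ι : Type*} [CommRing K] [AddCommGroup M] [Module K M]
    (B : Module.Basis ι K M) (T : M →ₗ[K] M) (e : ι → ι) (w : ι → K)
    (h : ∀ i, T (B i) = w i • B (e i)) (i : ι) (hu : ∀ j, e j = e i → j = i ∨ w j = 0) (x : M) :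
    B.repr (T x) (e i) = w i * B.repr x i := by
  classical
  have key : (Finsupp.lapply (e i)) ∘ₗ B.repr.toLinearMap ∘ₗ T
      = w i • ((Finsupp.lapply i) ∘ₗ B.repr.toLinearMap) := by
    refine B.ext fun j => ?_
    simp only [LinearMap.comp_apply, h, LinearEquiv.coe_coe, map_smul, B.repr_self,
      Finsupp.lapply_apply, LinearMap.smul_apply, Finsupp.single_apply, smul_eq_mul]
    by_cases hij : j = i
    · simp [hij]
    · rw [if_neg hij, mul_zero, mul_ite, mul_one, mul_zero, ite_eq_right_iff]
      exact fun hj => (hu j hj).resolve_left hij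
  exact LinearMap.congr_fun key x

theorem Module.Basis.repr_map_apply_eq_zero {K M ι : Type*} [CommRing K] [AddCommGroup M]
    [Module K M] (B : Module.Basis ι K M) (T : M →ₗ[K] M) (e : ι → ι) (w : ι → K)
    (h : ∀ i, T (B i) = w i • B (e i)) (m : ι) (hu : ∀ j, e j = m → w j = 0) (x : M) :
    B.repr (T x) m = 0 := by
  classical
  have key : (Finsupp.lapply m) ∘ₗ B.repr.toLinearMap ∘ₗ T = 0 := by
    refine B.ext fun j => ?_
    simp only [LinearMap.comp_apply, h, LinearEquiv.coe_coe, map_smul, B.repr_self,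
      Finsupp.lapply_apply, LinearMap.zero_apply, Finsupp.single_apply, smul_eq_mul, mul_ite,
      mul_one, mul_zero, ite_eq_right_iff]
    exact hu j
  exact LinearMap.congr_fun key x

theorem Module.Basis.repr_of_map {K M ι : Type*} [CommRing K] [AddCommGroup M] [Module K M]
    (B : Module.Basis ι K M) (T : M →ₗ[K] M) (e : ι → ι) (he : Function.Injective e) (w : ι → K)
    (h : ∀ i, T (B i) = w i • B (e i)) (x : M) (i : ι) : B.repr (T x) (e i) = w i * B.repr x i :=
  B.repr_map_apply T e w h i (fun _ hj => Or.inl (he hj)) x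

theorem Module.Basis.eq_zero_of_map {K M ι : Type*} [Field K] [AddCommGroup M] [Module K M]
    (B : Module.Basis ι K M) (T : M →ₗ[K] M) (e : ι → ι) (he : Function.Injective e) (w : ι → K)
    (hw : ∀ i, w i ≠ 0) (h : ∀ i, T (B i) = w i • B (e i)) {x : M} (hx : T x = 0) : x = 0 := by
  refine B.ext_elem fun i => ?_
  have h1 := B.repr_of_map T e he w h x i
  rw [hx, map_zero, Finsupp.zero_apply] at h1
  rw [map_zero, Finsupp.zero_apply]
  exact (mul_eq_zero.mp h1.symm).resolve_left (hw i)

/-- If `σ` inverts `π` on the basis elements outside of the submodule `I`, and `π` kills the other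
ones, then the kernel of `π` is contained in `I`. -/
theorem Module.Basis.mem_of_map_eq_zero {K M N ι : Type*} [CommRing K] [AddCommGroup M]
    [Module K M] [AddCommGroup N] [Module K N] (B : Module.Basis ι K M) (I : Submodule K M)
    (π : M →ₗ[K] N) (σ : N →ₗ[K] M) (h : ∀ i, B i - σ (π (B i)) ∈ I) {x : M} (hx : π x = 0) :
    x ∈ I := by
  have h1 : ∀ y, y - σ (π y) ∈ I := by
    intro y
    have hy : y ∈ Submodule.span K (Set.range B) := B.span_eq ▸ Submodule.mem_top
    induction hy using Submodule.span_induction with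
    | mem y hy => obtain ⟨i, rfl⟩ := hy; exact h i
    | zero => simp
    | add y z _ _ hy hz =>
      rw [map_add, map_add, add_sub_add_comm]
      exact add_mem hy hz
    | smul r y _ hy =>
      rw [map_smul, map_smul, ← smul_sub]
      exact I.smul_mem r hy
  simpa [hx] using h1 x

namespace OreAlg

open CategoryTheory MulOpposite

variable {𝕜 : Type u} [Field 𝕜] {n : ℕ} {q : 𝕜}

section Opposite

theorem skewTriple_op {q' : 𝕜} (h : q * q' = 1) :
    SkewTriple n 1 q' (op ((-1 : 𝕜) • gen n q .a)) (op (gen n q .b)) (op (gen n q .c)) := by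
  have t := skewTriple n q
  constructor
  · rw [← op_mul, ← op_mul, mul_smul_comm, t.ca, smul_mul_assoc, ← op_smul]
    congr 1
    match_scalars
    linear_combination h
  · rw [← op_mul, ← op_mul, t.bc, ← op_smul, smul_smul, mul_comm q', h, one_smul]
  · rw [← op_mul, ← op_mul, ← op_pow, mul_smul_comm, t.ba, smul_mul_assoc, ← op_smul,
      ← MulOpposite.op_add]
    congr 1
    match_scalars <;> ring

/-- The anti-homomorphism which sends `a` to `-a` and fixes `b, c, d`. -/
noncomputable def opHom {q' : 𝕜} (h : q * q' = 1) : OreAlg n q' →ₐ[𝕜] (OreAlg n q)ᵐᵒᵖ :=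
  lift (skewTriple_op h) (d := op (gen n q .d)) (congrArg op (commute_d _).eq)
    (congrArg op (commute_d _).eq) (congrArg op (commute_d _).eq)

theorem opHom_gen {q' : 𝕜} (h : q * q' = 1) (i : FourGen) : opHom h (gen n q' i)
    = fourElements (op ((-1 : 𝕜) • gen n q .a)) (op (gen n q .b)) (op (gen n q .c))
      (op (gen n q .d)) i :=
  lift_gen (skewTriple_op h) _ _ _ i

theorem unop_opHom_opHom {q' : 𝕜} (h : q * q' = 1) (h' : q' * q = 1) (x : OreAlg n q') :
    (opHom h' (opHom h x).unop).unop = x := by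
  have key : (AlgHom.opComm (opHom h')).comp (opHom h) = AlgHom.id 𝕜 (OreAlg n q') := by
    refine algHom_ext fun i => ?_
    rw [AlgHom.comp_apply, opHom_gen, AlgHom.id_apply]
    cases i
    · change unop (opHom h' ((-1 : 𝕜) • gen n q .a)) = _
      rw [map_smul, opHom_gen, fourElements, ← op_smul, unop_op, smul_smul]
      simp
    all_goals exact congrArg unop (opHom_gen h' _)
  exact DFunLike.congr_fun key x

variable (n) in
theorem hasInjectiveDimensionLT_op (hq : q ≠ 0) (M : ModuleCat.{u} (OreAlg n q)ᵐᵒᵖ) :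
    HasInjectiveDimensionLT M 5 := by
  have h := mul_inv_cancel₀ hq
  have h' := inv_mul_cancel₀ hq
  have hb : Function.Bijective (opHom (n := n) h) := by
    refine ⟨Function.LeftInverse.injective (g := fun x => unop (opHom h' (unop x)))
      (unop_opHom_opHom h h'), fun x => ?_⟩
    exact ⟨_, unop_injective (unop_opHom_opHom h' h x.unop)⟩
  exact hasInjectiveDimensionLT_of_ringEquiv (AlgEquiv.ofBijective _ hb).toRingEquiv 4
    (hasInjectiveDimensionLT n q⁻¹ (inv_ne_zero hq)) M

end Opposite

section RegularSequence

open Polynomial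

theorem monomial_mul_d (m : (ℕ × ℕ) × ℕ) (l : ℕ) :
    monomial n q (m, l) * gen n q .d = monomial n q (m, l + 1) := by
  rw [monomial, mul_assoc, ← pow_succ, monomial]

theorem monomial_mul_b (i j k l : ℕ) :
    monomial n q (((i, j), k), l) * gen n q .b = monomial n q (((i, j), k + 1), l) := by
  rw [monomial, mul_assoc, ((commute_d (gen n q .b)).pow_left l).eq, ← mul_assoc, skewMonomial,
    mul_assoc _ _ (gen n q .b), ← pow_succ, monomial, skewMonomial]

theorem monomial_mul_c (i j k l : ℕ) :
    monomial n q (((i, j), k), l) * gen n q .c = q ^ k • monomial n q (((i, j + 1), k), l) := by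
  rw [monomial, mul_assoc, ((commute_d (gen n q .c)).pow_left l).eq, ← mul_assoc, skewMonomial,
    mul_assoc _ _ (gen n q .c), pow_mul_of_skew (skewTriple n q).bc, mul_smul_comm, ← mul_assoc,
    mul_assoc _ _ (gen n q .c), ← pow_succ, smul_mul_assoc, monomial, skewMonomial]

/-- The quotient by `d`, as an endomorphism. -/
noncomputable def modD (n : ℕ) (q : 𝕜) : OreAlg n q →ₐ[𝕜] OreAlg n q :=
  lift (skewTriple n q) (d := 0) (by simp) (by simp) (by simp)

theorem skewTriple_modDC (hn : 1 ≤ n) :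
    SkewTriple n 1 q (MvPolynomial.X 0 : MvPolynomial (Fin 2) 𝕜) (MvPolynomial.X 1) 0 where
  ca := by simp
  bc := by simp
  ba := by rw [zero_pow (by omega), mul_comm, one_smul, add_zero]

/-- The quotient by `c` and `d`. -/
noncomputable def modDC (n : ℕ) (hn : 1 ≤ n) (q : 𝕜) :
    OreAlg n q →ₐ[𝕜] MvPolynomial (Fin 2) 𝕜 :=
  lift (skewTriple_modDC hn) (d := 0) (by simp) (by simp) (by simp)

theorem skewTriple_modDCB (hn : 1 ≤ n) : SkewTriple n 1 q (X : 𝕜[X]) 0 0 where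
  ca := by simp
  bc := by simp
  ba := by simp [show n ≠ 0 by omega]

/-- The quotient by `b`, `c` and `d`. -/
noncomputable def modDCB (n : ℕ) (hn : 1 ≤ n) (q : 𝕜) : OreAlg n q →ₐ[𝕜] 𝕜[X] :=
  lift (skewTriple_modDCB hn) (d := 0) (by simp) (by simp) (by simp)

theorem skewTriple_augmentation (hn : 1 ≤ n) : SkewTriple n 1 q (0 : 𝕜) 0 0 where
  ca := by simp
  bc := by simp
  ba := by simp [show n ≠ 0 by omega]

/-- The augmentation, which kills all generators. -/
noncomputable def augmentation (n : ℕ) (hn : 1 ≤ n) (q : 𝕜) : OreAlg n q →ₐ[𝕜] 𝕜 :=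
  lift (skewTriple_augmentation hn) (d := 0) (by simp) (by simp) (by simp)

theorem mem_of_modD_eq_zero {x : OreAlg n q} (hx : modD n q x = 0) : ∃ y, x = y * gen n q .d := by
  have h := (basis n q).mem_of_map_eq_zero (LinearMap.range (LinearMap.mulRight 𝕜 (gen n q .d)))
    (modD n q).toLinearMap LinearMap.id (fun ⟨m, l⟩ => ?_) hx
  · obtain ⟨y, hy⟩ := h
    exact ⟨y, hy.symm⟩
  · rcases l with _ | l
    · have h1 : modD n q (monomial n q (m, 0)) = monomial n q (m, 0) := by
        simp [monomial, skewMonomial, modD, lift_gen, fourElements]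
      rw [basis_apply, AlgHom.toLinearMap_apply, h1, LinearMap.id_apply, sub_self]
      exact zero_mem _
    · have h1 : modD n q (monomial n q (m, l + 1)) = 0 := by
        simp [monomial, modD, lift_gen, fourElements]
      rw [basis_apply, AlgHom.toLinearMap_apply, h1, map_zero, sub_zero]
      exact ⟨_, monomial_mul_d m l⟩

/-- Elements `a ^ i b ^ k` lift the monomials of the quotient by `c` and `d`. -/
noncomputable def sectionDC (n : ℕ) (q : 𝕜) : MvPolynomial (Fin 2) 𝕜 →ₗ[𝕜] OreAlg n q :=
  (MvPolynomial.basisMonomials (Fin 2) 𝕜).constr 𝕜 fun m => gen n q .a ^ m 0 * gen n q .b ^ m 1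

theorem mem_of_modDC_eq_zero (hn : 1 ≤ n) (I : Submodule 𝕜 (OreAlg n q))
    (h : ∀ i j k l, (j ≠ 0 ∨ l ≠ 0) → monomial n q (((i, j), k), l) ∈ I) {x : OreAlg n q}
    (hx : modDC n hn q x = 0) : x ∈ I := by
  refine (basis n q).mem_of_map_eq_zero I (modDC n hn q).toLinearMap (sectionDC n q)
    (fun ⟨⟨⟨i, j⟩, k⟩, l⟩ => ?_) hx
  by_cases hjl : j ≠ 0 ∨ l ≠ 0
  · have h1 : modDC n hn q (monomial n q (((i, j), k), l)) = 0 := by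
      rcases hjl with hj | hl
      · simp [monomial, skewMonomial, modDC, lift_gen, fourElements, hj]
      · simp [monomial, modDC, lift_gen, fourElements, hl]
    rw [basis_apply, AlgHom.toLinearMap_apply, h1, map_zero, sub_zero]
    exact h i j k l hjl
  · obtain ⟨rfl, rfl⟩ : j = 0 ∧ l = 0 := by omega
    have h1 : modDC n hn q (monomial n q (((i, 0), k), 0))
        = MvPolynomial.basisMonomials (Fin 2) 𝕜 (Finsupp.single 0 i + Finsupp.single 1 k) := by
      simp [monomial, skewMonomial, modDC, lift_gen, fourElements, MvPolynomial.X_pow_eq_monomial,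
        MvPolynomial.monomial_mul]
    rw [basis_apply, AlgHom.toLinearMap_apply, h1, sectionDC, Module.Basis.constr_basis]
    simp [monomial, skewMonomial]

/-- Elements `a ^ i` lift the monomials of the quotient by `b`, `c` and `d`. -/
noncomputable def sectionDCB (n : ℕ) (q : 𝕜) : 𝕜[X] →ₗ[𝕜] OreAlg n q :=
  (Polynomial.basisMonomials 𝕜).constr 𝕜 fun i => gen n q .a ^ i

theorem mem_of_modDCB_eq_zero (hn : 1 ≤ n) (I : Submodule 𝕜 (OreAlg n q))
    (h : ∀ i j k l, (j ≠ 0 ∨ k ≠ 0 ∨ l ≠ 0) → monomial n q (((i, j), k), l) ∈ I) {x : OreAlg n q}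
    (hx : modDCB n hn q x = 0) : x ∈ I := by
  refine (basis n q).mem_of_map_eq_zero I (modDCB n hn q).toLinearMap (sectionDCB n q)
    (fun ⟨⟨⟨i, j⟩, k⟩, l⟩ => ?_) hx
  by_cases hjl : j ≠ 0 ∨ k ≠ 0 ∨ l ≠ 0
  · have h1 : modDCB n hn q (monomial n q (((i, j), k), l)) = 0 := by
      rcases hjl with hj | hk | hl
      · simp [monomial, skewMonomial, modDCB, lift_gen, fourElements, hj]
      · simp [monomial, skewMonomial, modDCB, lift_gen, fourElements, hk]
      · simp [monomial, modDCB, lift_gen, fourElements, hl]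
    rw [basis_apply, AlgHom.toLinearMap_apply, h1, map_zero, sub_zero]
    exact h i j k l hjl
  · obtain ⟨rfl, rfl, rfl⟩ : j = 0 ∧ k = 0 ∧ l = 0 := by omega
    have h1 : modDCB n hn q (monomial n q (((i, 0), 0), 0)) = Polynomial.basisMonomials 𝕜 i := by
      simp [monomial, skewMonomial, modDCB, lift_gen, fourElements, Polynomial.X_pow_eq_monomial]
    rw [basis_apply, AlgHom.toLinearMap_apply, h1, sectionDCB, Module.Basis.constr_basis]
    simp [monomial, skewMonomial]

theorem mul_d_eq_zero {x : OreAlg n q} (hx : x * gen n q .d = 0) : x = 0 :=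
  (basis n q).eq_zero_of_map (LinearMap.mulRight 𝕜 (gen n q .d)) (fun m => (m.1, m.2 + 1))
    (fun m m' h => by simpa [Prod.ext_iff] using h) 1 (fun _ => one_ne_zero)
    (fun ⟨m, l⟩ => by
      rw [basis_apply, basis_apply, LinearMap.mulRight_apply, monomial_mul_d, Pi.one_apply,
        one_smul]) hx

theorem mul_c_eq_zero (hq : q ≠ 0) {x : OreAlg n q} (hx : x * gen n q .c = 0) : x = 0 :=
  (basis n q).eq_zero_of_map (LinearMap.mulRight 𝕜 (gen n q .c))
    (fun m => (((m.1.1.1, m.1.1.2 + 1), m.1.2), m.2))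
    (fun m m' h => by simpa [Prod.ext_iff] using h) (fun m => q ^ m.1.2)
    (fun m => pow_ne_zero _ hq)
    (fun ⟨⟨⟨i, j⟩, k⟩, l⟩ => by
      rw [basis_apply, basis_apply, LinearMap.mulRight_apply, monomial_mul_c]) hx

theorem c_mul_eq_zero (hq : q ≠ 0) {x : OreAlg n q} (hx : gen n q .c * x = 0) : x = 0 :=
  (basis n q).eq_zero_of_map (LinearMap.mulLeft 𝕜 (gen n q .c))
    (fun m => (((m.1.1.1, m.1.1.2 + 1), m.1.2), m.2))
    (fun m m' h => by simpa [Prod.ext_iff] using h) (fun m => q ^ m.1.1.1)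
    (fun m => pow_ne_zero _ hq)
    (fun ⟨⟨⟨i, j⟩, k⟩, l⟩ => by
      rw [basis_apply, basis_apply, LinearMap.mulLeft_apply, c_mul_monomial]) hx

theorem monomial_mem_left (hq : q ≠ 0) {I : Submodule 𝕜 (OreAlg n q)}
    (hd : ∀ x, x * gen n q .d ∈ I) (hc : ∀ x, x * gen n q .c ∈ I) (i j k l : ℕ)
    (h : j ≠ 0 ∨ l ≠ 0) : monomial n q (((i, j), k), l) ∈ I := by
  rcases h with h | h
  · obtain ⟨j, rfl⟩ := Nat.exists_eq_succ_of_ne_zero h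
    rw [← inv_smul_smul₀ (pow_ne_zero k hq) (monomial n q (((i, j + 1), k), l)), ← monomial_mul_c]
    exact I.smul_mem _ (hc _)
  · obtain ⟨l, rfl⟩ := Nat.exists_eq_succ_of_ne_zero h
    rw [Nat.succ_eq_add_one, ← monomial_mul_d]
    exact hd _

theorem monomial_mem_right (hq : q ≠ 0) {I : Submodule 𝕜 (OreAlg n q)}
    (hd : ∀ x, gen n q .d * x ∈ I) (hc : ∀ x, gen n q .c * x ∈ I) (i j k l : ℕ)
    (h : j ≠ 0 ∨ l ≠ 0) : monomial n q (((i, j), k), l) ∈ I := by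
  rcases h with h | h
  · obtain ⟨j, rfl⟩ := Nat.exists_eq_succ_of_ne_zero h
    rw [← inv_smul_smul₀ (pow_ne_zero i hq) (monomial n q (((i, j + 1), k), l)), ← c_mul_monomial]
    exact I.smul_mem _ (hc _)
  · obtain ⟨l, rfl⟩ := Nat.exists_eq_succ_of_ne_zero h
    rw [Nat.succ_eq_add_one, ← d_mul_monomial]
    exact hd _

theorem monomial_mem_left' (hq : q ≠ 0) {I : Submodule 𝕜 (OreAlg n q)}
    (hd : ∀ x, x * gen n q .d ∈ I) (hc : ∀ x, x * gen n q .c ∈ I) (hb : ∀ x, x * gen n q .b ∈ I)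
    (i j k l : ℕ) (h : j ≠ 0 ∨ k ≠ 0 ∨ l ≠ 0) : monomial n q (((i, j), k), l) ∈ I := by
  by_cases hjl : j ≠ 0 ∨ l ≠ 0
  · exact monomial_mem_left hq hd hc i j k l hjl
  · obtain ⟨k, rfl⟩ := Nat.exists_eq_succ_of_ne_zero (show k ≠ 0 by tauto)
    rw [Nat.succ_eq_add_one, ← monomial_mul_b]
    exact hb _

theorem monomial_mem_right' (hn : 1 ≤ n) (hq : q ≠ 0) {I : Submodule 𝕜 (OreAlg n q)}
    (hd : ∀ x, gen n q .d * x ∈ I) (hc : ∀ x, gen n q .c * x ∈ I) (hb : ∀ x, gen n q .b * x ∈ I)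
    (i j k l : ℕ) (h : j ≠ 0 ∨ k ≠ 0 ∨ l ≠ 0) : monomial n q (((i, j), k), l) ∈ I := by
  by_cases hjl : j ≠ 0 ∨ l ≠ 0
  · exact monomial_mem_right hq hd hc i j k l hjl
  · obtain ⟨k, rfl⟩ := Nat.exists_eq_succ_of_ne_zero (show k ≠ 0 by tauto)
    obtain rfl : j = 0 := by tauto
    have h1 := b_mul_monomial (n := n) (q := q) i 0 k l
    rw [pow_zero, one_smul] at h1
    rw [Nat.succ_eq_add_one, ← add_sub_cancel_right (monomial n q (((i, 0), k + 1), l)) _, ← h1]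
    exact sub_mem (hb _) (I.smul_mem _ (monomial_mem_right hq hd hc _ _ _ _ (Or.inl (by omega))))

/-- Each regularity condition is checked in the quotient by the previous generators, which is
`OreAlg n q` modulo `d`, a commutative polynomial ring in `a, b`, or one in `a`. -/
theorem koszulData (hn : 1 ≤ n) (hq : q ≠ 0) :
    KoszulData n q 1 (gen n q .a) (gen n q .b) (gen n q .c) (gen n q .d) where
  q_ne_zero := hq
  ad := a_mul_d n q
  bd := b_mul_d n q
  cd := c_mul_d n q
  ca := (skewTriple n q).ca
  bc := (skewTriple n q).bc
  ba := by rw [(skewTriple n q).ba, one_smul, one_smul]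
  left_d r hr := mul_d_eq_zero hr
  left_c r x hr := by
    have h := congrArg (modD n q) hr
    simp only [map_mul, modD, lift_gen, fourElements, mul_zero] at h
    exact mem_of_modD_eq_zero (mul_c_eq_zero hq h)
  left_b r x₁ x₂ hr := by
    have h := congrArg (modDC n hn q) hr
    simp only [map_mul, map_add, modDC, lift_gen, fourElements, mul_zero, add_zero] at h
    have h1 := mem_of_modDC_eq_zero hn (LinearMap.range (LinearMap.mulRight 𝕜 (gen n q .d))
      ⊔ LinearMap.range (LinearMap.mulRight 𝕜 (gen n q .c))) (monomial_mem_left hq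
        (fun x => Submodule.mem_sup_left ⟨x, rfl⟩) (fun x => Submodule.mem_sup_right ⟨x, rfl⟩))
      ((mul_eq_zero.mp h).resolve_right (MvPolynomial.X_ne_zero _))
    obtain ⟨_, ⟨y₁, rfl⟩, _, ⟨y₂, rfl⟩, h2⟩ := Submodule.mem_sup.mp h1
    exact ⟨y₁, y₂, h2.symm⟩
  left_a r x₁ x₂ x₃ hr := by
    have h := congrArg (modDCB n hn q) hr
    simp only [map_mul, map_add, modDCB, lift_gen, fourElements, mul_zero, add_zero] at h
    have h1 := mem_of_modDCB_eq_zero hn (LinearMap.range (LinearMap.mulRight 𝕜 (gen n q .d))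
      ⊔ LinearMap.range (LinearMap.mulRight 𝕜 (gen n q .c))
      ⊔ LinearMap.range (LinearMap.mulRight 𝕜 (gen n q .b))) (monomial_mem_left' hq
        (fun x => Submodule.mem_sup_left (Submodule.mem_sup_left ⟨x, rfl⟩))
        (fun x => Submodule.mem_sup_left (Submodule.mem_sup_right ⟨x, rfl⟩))
        (fun x => Submodule.mem_sup_right ⟨x, rfl⟩))
      ((mul_eq_zero.mp h).resolve_right X_ne_zero)
    obtain ⟨_, h3, _, ⟨y₃, rfl⟩, rfl⟩ := Submodule.mem_sup.mp h1
    obtain ⟨_, ⟨y₁, rfl⟩, _, ⟨y₂, rfl⟩, rfl⟩ := Submodule.mem_sup.mp h3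
    exact ⟨y₁, y₂, y₃, rfl⟩
  left_one x₁ x₂ x₃ x₄ h := by
    have h := congrArg (augmentation n hn q) h
    simp [augmentation, lift_gen, fourElements] at h
  right_d r hr := mul_d_eq_zero ((commute_d r).eq ▸ hr)
  right_c r x hr := by
    have h := congrArg (modD n q) hr
    simp only [map_mul, modD, lift_gen, fourElements, zero_mul] at h
    obtain ⟨y, hy⟩ := mem_of_modD_eq_zero (c_mul_eq_zero hq h)
    exact ⟨y, hy.trans (commute_d y).eq.symm⟩
  right_b r x₁ x₂ hr := by
    have h := congrArg (modDC n hn q) hr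
    simp only [map_mul, map_add, modDC, lift_gen, fourElements, zero_mul, add_zero] at h
    have h1 := mem_of_modDC_eq_zero hn (LinearMap.range (LinearMap.mulLeft 𝕜 (gen n q .d))
      ⊔ LinearMap.range (LinearMap.mulLeft 𝕜 (gen n q .c))) (monomial_mem_right hq
        (fun x => Submodule.mem_sup_left ⟨x, rfl⟩) (fun x => Submodule.mem_sup_right ⟨x, rfl⟩))
      ((mul_eq_zero.mp h).resolve_left (MvPolynomial.X_ne_zero _))
    obtain ⟨_, ⟨y₁, rfl⟩, _, ⟨y₂, rfl⟩, h2⟩ := Submodule.mem_sup.mp h1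
    exact ⟨y₁, y₂, h2.symm⟩
  right_a r x₁ x₂ x₃ hr := by
    have h := congrArg (modDCB n hn q) hr
    simp only [map_mul, map_add, modDCB, lift_gen, fourElements, zero_mul, add_zero] at h
    have h1 := mem_of_modDCB_eq_zero hn (LinearMap.range (LinearMap.mulLeft 𝕜 (gen n q .d))
      ⊔ LinearMap.range (LinearMap.mulLeft 𝕜 (gen n q .c))
      ⊔ LinearMap.range (LinearMap.mulLeft 𝕜 (gen n q .b))) (monomial_mem_right' hn hq
        (fun x => Submodule.mem_sup_left (Submodule.mem_sup_left ⟨x, rfl⟩))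
        (fun x => Submodule.mem_sup_left (Submodule.mem_sup_right ⟨x, rfl⟩))
        (fun x => Submodule.mem_sup_right ⟨x, rfl⟩))
      ((mul_eq_zero.mp h).resolve_left X_ne_zero)
    obtain ⟨_, h3, _, ⟨y₃, rfl⟩, rfl⟩ := Submodule.mem_sup.mp h1
    obtain ⟨_, ⟨y₁, rfl⟩, _, ⟨y₂, rfl⟩, rfl⟩ := Submodule.mem_sup.mp h3
    exact ⟨y₁, y₂, y₃, rfl⟩
  right_one x₁ x₂ x₃ x₄ h := by
    have h := congrArg (augmentation n hn q) h
    simp [augmentation, lift_gen, fourElements] at h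

end RegularSequence

end OreAlg

/-! ### The grading and the growth of the algebra on four generators -/

namespace OreAlg

open Polynomial

variable {𝕜 : Type u} [Field 𝕜] {n : ℕ} {q : 𝕜}

variable (n q) in
theorem gradedMonoid : SetLike.GradedMonoid (grading n q) where
  one_mem := Submodule.subset_span ⟨[], rfl, rfl⟩
  mul_mem i j x y hx hy := by
    have h : grading n q i * grading n q j ≤ grading n q (i + j) := by
      rw [grading, grading, Submodule.span_mul_span, Submodule.span_le]
      rintro _ ⟨_, ⟨l, rfl, rfl⟩, _, ⟨l', rfl, rfl⟩, rfl⟩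
      exact Submodule.subset_span ⟨l ++ l', by simp, by simp⟩
    exact h (Submodule.mul_mem_mul hx hy)

theorem gen_mem (i : FourGen) : gen n q i ∈ grading n q (fourDegree n i) :=
  Submodule.subset_span ⟨[i], by simp, by simp⟩

/-- The degree of an ordered monomial. -/
def monomialDegree (n : ℕ) (m : ((ℕ × ℕ) × ℕ) × ℕ) : ℕ :=
  m.1.1.1 * (2 * n - 1) + m.1.1.2 * 2 + m.1.2 + m.2 * (2 * n)

theorem monomial_mem (m : ((ℕ × ℕ) × ℕ) × ℕ) :
    monomial n q m ∈ grading n q (monomialDegree n m) := by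
  obtain ⟨⟨⟨i, j⟩, k⟩, l⟩ := m
  have := gradedMonoid n q
  have h := SetLike.mul_mem_graded (SetLike.mul_mem_graded (SetLike.mul_mem_graded
    (SetLike.pow_mem_graded i (gen_mem (n := n) (q := q) .a))
    (SetLike.pow_mem_graded j (gen_mem (n := n) (q := q) .c)))
    (SetLike.pow_mem_graded k (gen_mem (n := n) (q := q) .b)))
    (SetLike.pow_mem_graded l (gen_mem (n := n) (q := q) .d))
  simpa [monomialDegree, fourDegree, monomial, skewMonomial] using h

theorem skewTriple_weight (hn : 1 ≤ n) :
    SkewTriple n 1 q (C (gen n q .a) * X ^ (2 * n - 1)) (C (gen n q .b) * X)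
      (C (gen n q .c) * X ^ 2) := by
  have t := skewTriple n q
  have key : ∀ (x y : OreAlg n q) (i j : ℕ), C x * X ^ i * (C y * X ^ j)
      = C (x * y) * X ^ (i + j) := by
    intro x y i j
    rw [mul_assoc, ← mul_assoc (X ^ i), X_pow_mul, mul_assoc (C y), ← pow_add, C_mul, mul_assoc]
  have hC : ∀ (r : 𝕜) (x : OreAlg n q), C (r • x) = r • C x := fun r x => by
    rw [smul_C]
  have hpow : (C (gen n q .c) * X ^ 2) ^ n = C (gen n q .c ^ n) * X ^ (2 * n) := by
    rw [((commute_X_pow _ 2).symm).mul_pow, ← pow_mul, C_pow]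
  have h1 := fun x y i => key x y i 1
  have h2 := fun x y i => key x y 1 i
  simp only [pow_one] at h1 h2
  constructor
  · rw [key, key, t.ca, hC, smul_mul_assoc, add_comm]
  · rw [h2, h1, t.bc, hC, smul_mul_assoc, add_comm]
  · rw [h2, h1, t.ba, C_add, add_mul, one_smul, one_smul, hpow]
    congr 3 <;> omega

/-- The algebra map to the polynomials over the algebra which multiplies the elements of degree
`m` by `X ^ m`. -/
noncomputable def weight (n : ℕ) (hn : 1 ≤ n) (q : 𝕜) : OreAlg n q →ₐ[𝕜] (OreAlg n q)[X] :=
  have key : ∀ (x : OreAlg n q) (i j : ℕ),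
      C x * X ^ i * (C (gen n q .d) * X ^ j) = C (gen n q .d) * X ^ j * (C x * X ^ i) := by
    intro x i j
    have h := (commute_d x).eq
    rw [mul_assoc, ← mul_assoc (X ^ i), X_pow_mul, mul_assoc (C _), ← pow_add, ← mul_assoc, ← C_mul,
      ← h, mul_assoc (C (gen n q .d)), ← mul_assoc (X ^ j), X_pow_mul, mul_assoc (C x), ← pow_add,
      ← mul_assoc, ← C_mul, add_comm]
  lift (skewTriple_weight hn) (d := C (gen n q .d) * X ^ (2 * n)) (key _ _ _)
    (by simpa using key (gen n q .b) 1 (2 * n)) (key _ _ _)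

theorem weight_gen (hn : 1 ≤ n) (i : FourGen) :
    weight n hn q (gen n q i) = Polynomial.monomial (fourDegree n i) (gen n q i) := by
  rw [weight, lift_gen, ← C_mul_X_pow_eq_monomial]
  cases i <;> simp [fourElements, fourDegree]

theorem weight_of_mem (hn : 1 ≤ n) {m : ℕ} {x : OreAlg n q} (hx : x ∈ grading n q m) :
    weight n hn q x = Polynomial.monomial m x := by
  induction hx using Submodule.span_induction with
  | mem x hx =>
    obtain ⟨l, rfl, rfl⟩ := hx
    induction l with
    | nil => simp
    | cons i l ih =>
      rw [List.map_cons, List.prod_cons, map_mul, ih, weight_gen, Polynomial.monomial_mul_monomial,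
        List.map_cons, List.sum_cons]
  | zero => simp
  | add x y _ _ hx hy => rw [map_add, hx, hy, map_add]
  | smul r x _ hx => rw [map_smul, hx, Polynomial.smul_monomial]

theorem coeff_weight_basis (hn : 1 ≤ n) (m : ((ℕ × ℕ) × ℕ) × ℕ) (k : ℕ) :
    (weight n hn q (basis n q m)).coeff k = if monomialDegree n m = k then basis n q m else 0 := by
  rw [basis_apply, weight_of_mem hn (monomial_mem m), Polynomial.coeff_monomial]

theorem grading_le_span (hn : 1 ≤ n) (k : ℕ) :
    grading n q k ≤ Submodule.span 𝕜 (basis n q '' {m | monomialDegree n m = k}) := by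
  intro x hx
  have h1 : (weight n hn q x).coeff k = x := by
    rw [weight_of_mem hn hx, Polynomial.coeff_monomial, if_pos rfl]
  have h2 : ∀ y : OreAlg n q, (weight n hn q y).coeff k
      ∈ Submodule.span 𝕜 (basis n q '' {m | monomialDegree n m = k}) := by
    intro y
    have hy : y ∈ Submodule.span 𝕜 (Set.range (basis n q)) :=
      (basis n q).span_eq ▸ Submodule.mem_top
    induction hy using Submodule.span_induction with
    | mem y hy =>
      obtain ⟨m, rfl⟩ := hy
      rw [coeff_weight_basis]
      split_ifs with h
      · exact Submodule.subset_span ⟨m, h, rfl⟩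
      · exact zero_mem _
    | zero => simp
    | add y z _ _ hy hz =>
      rw [map_add, Polynomial.coeff_add]
      exact add_mem hy hz
    | smul r y _ hy =>
      rw [map_smul, Polynomial.coeff_smul]
      exact Submodule.smul_mem _ r hy
  rw [← h1]
  exact h2 x

theorem isInternal_grading (hn : 1 ≤ n) : DirectSum.IsInternal (grading n q) := by
  classical
  constructor
  · intro x y hxy
    have key : ∀ (z : DirectSum ℕ fun m => grading n q m) (m : ℕ),
        (weight n hn q (DirectSum.coeAddMonoidHom (grading n q) z)).coeff m = z m := by
      intro z m
      induction z using DirectSum.induction_on with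
      | zero => simp
      | of i z =>
        rw [DirectSum.coeAddMonoidHom_of, weight_of_mem hn z.2, Polynomial.coeff_monomial]
        split_ifs with h
        · subst h
          rw [DirectSum.of_eq_same]
        · rw [DirectSum.of_eq_of_ne _ _ _ (Ne.symm h)]
          rfl
      | add z w hz hw =>
        rw [map_add, map_add, Polynomial.coeff_add, hz, hw]
        rfl
    refine DFinsupp.ext fun m => Subtype.ext ?_
    exact (key x m).symm.trans ((congrArg (fun t => (weight n hn q t).coeff m) hxy).trans (key y m))
  · intro x
    have hx : x ∈ Submodule.span 𝕜 (Set.range (monomial n q)) := by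
      rw [span_monomial]
      trivial
    have h : Submodule.span 𝕜 (Set.range (monomial n q))
        ≤ LinearMap.range (DirectSum.coeLinearMap (grading n q)) := by
      rw [Submodule.span_le]
      rintro _ ⟨m, rfl⟩
      exact ⟨DirectSum.lof 𝕜 ℕ _ _ ⟨_, monomial_mem m⟩, DirectSum.coeLinearMap_lof _ _ _⟩
    exact h hx

theorem one_ne_zero' : (1 : OreAlg n q) ≠ 0 := by
  have h := (basis n q).ne_zero (((0, 0), 0), 0)
  rwa [basis_apply, show monomial n q (((0, 0), 0), 0) = 1 by simp [monomial, skewMonomial]] at h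

theorem isConnectedGraded (hn : 1 ≤ n) : IsConnectedGraded (grading n q) where
  gradedMonoid := gradedMonoid n q
  isInternal := isInternal_grading hn
  connected := by
    have h : grading n q 0 = Submodule.span 𝕜 {1} := by
      rw [grading]
      congr 1
      ext x
      constructor
      · rintro ⟨l, hl, rfl⟩
        rcases l with _ | ⟨i, l⟩
        · rfl
        · have : fourDegree n i ≠ 0 := by cases i <;> simp [fourDegree] <;> omega
          rw [List.map_cons, List.sum_cons] at hl
          omega
      · rintro rfl
        exact ⟨[], rfl, rfl⟩
    rw [h]
    exact finrank_span_singleton one_ne_zero'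

theorem koszulGrading (hn : 1 ≤ n) : KoszulGrading (grading n q) n (gen n q .a) (gen n q .b)
    (gen n q .c) (gen n q .d) (2 * n - 1) 1 2 (2 * n) where
  graded := gradedMonoid n q
  mem_a := gen_mem .a
  mem_b := gen_mem .b
  mem_c := gen_mem .c
  mem_d := gen_mem .d
  pos_a := by omega
  pos_b := le_rfl
  pos_c := by omega
  pos_d := by omega
  weight := by omega
  left_ideal m hm x hx := by
    induction hx using Submodule.span_induction with
    | mem x hx =>
      obtain ⟨l, rfl, rfl⟩ := hx
      rcases List.eq_nil_or_concat l with rfl | ⟨l, i, rfl⟩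
      · simp at hm
      · rw [List.concat_eq_append, List.map_append, List.prod_append, List.map_singleton,
          List.prod_singleton]
        cases i
        · exact ⟨0, 0, 0, (l.map (gen n q)).prod, by simp only [zero_mul, add_zero, zero_add]⟩
        · exact ⟨0, 0, (l.map (gen n q)).prod, 0, by simp only [zero_mul, add_zero, zero_add]⟩
        · exact ⟨0, (l.map (gen n q)).prod, 0, 0, by simp only [zero_mul, add_zero, zero_add]⟩
        · exact ⟨(l.map (gen n q)).prod, 0, 0, 0, by simp only [zero_mul, add_zero]⟩
    | zero => exact ⟨0, 0, 0, 0, by simp only [zero_mul, add_zero]⟩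
    | add x y _ _ hx hy =>
      obtain ⟨x₁, x₂, x₃, x₄, rfl⟩ := hx
      obtain ⟨y₁, y₂, y₃, y₄, rfl⟩ := hy
      exact ⟨x₁ + y₁, x₂ + y₂, x₃ + y₃, x₄ + y₄, by simp only [add_mul]; abel⟩
    | smul r x _ hx =>
      obtain ⟨x₁, x₂, x₃, x₄, rfl⟩ := hx
      exact ⟨r • x₁, r • x₂, r • x₃, r • x₄, by simp only [smul_add, smul_mul_assoc]⟩
  right_ideal m hm x hx := by
    induction hx using Submodule.span_induction with
    | mem x hx =>
      obtain ⟨l, rfl, rfl⟩ := hx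
      rcases l with _ | ⟨i, l⟩
      · simp at hm
      · rw [List.map_cons, List.prod_cons]
        cases i
        · exact ⟨0, 0, 0, (l.map (gen n q)).prod, by simp only [mul_zero, add_zero, zero_add]⟩
        · exact ⟨0, 0, (l.map (gen n q)).prod, 0, by simp only [mul_zero, add_zero, zero_add]⟩
        · exact ⟨0, (l.map (gen n q)).prod, 0, 0, by simp only [mul_zero, add_zero, zero_add]⟩
        · exact ⟨(l.map (gen n q)).prod, 0, 0, 0, by simp only [mul_zero, add_zero]⟩
    | zero => exact ⟨0, 0, 0, 0, by simp only [mul_zero, add_zero]⟩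
    | add x y _ _ hx hy =>
      obtain ⟨x₁, x₂, x₃, x₄, rfl⟩ := hx
      obtain ⟨y₁, y₂, y₃, y₄, rfl⟩ := hy
      exact ⟨x₁ + y₁, x₂ + y₂, x₃ + y₃, x₄ + y₄, by simp only [mul_add]; abel⟩
    | smul r x _ hx =>
      obtain ⟨x₁, x₂, x₃, x₄, rfl⟩ := hx
      exact ⟨r • x₁, r • x₂, r • x₃, r • x₄, by simp only [smul_add, mul_smul_comm]⟩

/-- The span of the ordered monomials of degree at most `N`. -/
noncomputable def filtration (n : ℕ) (q : 𝕜) (N : ℕ) : Submodule 𝕜 (OreAlg n q) :=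
  Submodule.span 𝕜 (basis n q '' {m | monomialDegree n m ≤ N})

theorem filtration_mul_le (hn : 1 ≤ n) (N M : ℕ) :
    filtration n q N * filtration n q M ≤ filtration n q (N + M) := by
  rw [filtration, filtration, Submodule.span_mul_span, Submodule.span_le]
  rintro _ ⟨_, ⟨m, hm, rfl⟩, _, ⟨m', hm', rfl⟩, rfl⟩
  have := gradedMonoid n q
  have h : basis n q m * basis n q m' ∈ grading n q (monomialDegree n m + monomialDegree n m') := by
    rw [basis_apply, basis_apply]
    exact SetLike.mul_mem_graded (monomial_mem m) (monomial_mem m')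
  refine Submodule.span_mono (Set.image_mono ?_) (grading_le_span hn _ h)
  intro m'' hm''
  exact le_trans (le_of_eq hm'') (add_le_add hm hm')

theorem filtration_mono {N M : ℕ} (h : N ≤ M) : filtration n q N ≤ filtration n q M :=
  Submodule.span_mono (Set.image_mono fun _ hm => le_trans hm h)

theorem finrank_le_card_of_le_span {K M ι : Type*} [Field K] [AddCommGroup M] [Module K M]
    (v : ι → M) (S : Finset ι) {V : Submodule K M} (h : V ≤ Submodule.span K (v '' S)) :
    Module.finrank K V ≤ S.card := by
  classical
  rw [← Finset.coe_image] at h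
  exact (Submodule.finrank_mono h).trans
    ((finrank_span_finset_le_card _).trans Finset.card_image_le)

theorem finrank_filtration_le (hn : 1 ≤ n) (N : ℕ) (V : Submodule 𝕜 (OreAlg n q))
    (hV : V ≤ filtration n q N) : Module.finrank 𝕜 V ≤ (N + 1) ^ 4 := by
  have h1 : V ≤ Submodule.span 𝕜 (basis n q '' (((Finset.range (N + 1) ×ˢ Finset.range (N + 1)) ×ˢ
      Finset.range (N + 1)) ×ˢ Finset.range (N + 1) : Finset _)) := by
    refine hV.trans (Submodule.span_mono (Set.image_mono ?_))
    rintro ⟨⟨⟨i, j⟩, k⟩, l⟩ hm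
    have hm' : i * (2 * n - 1) + j * 2 + k + l * (2 * n) ≤ N := hm
    have hi : i ≤ i * (2 * n - 1) := Nat.le_mul_of_pos_right _ (by omega)
    have hl : l ≤ l * (2 * n) := Nat.le_mul_of_pos_right _ (by omega)
    simp only [Finset.coe_product, Finset.coe_range, Set.mem_prod, Set.mem_Iio]
    omega
  refine (finrank_le_card_of_le_span (basis n q) _ h1).trans_eq ?_
  simp only [Finset.card_product, Finset.card_range]
  ring

theorem exists_le_filtration (V : Submodule 𝕜 (OreAlg n q)) [FiniteDimensional 𝕜 V] :
    ∃ N, V ≤ filtration n q N := by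
  obtain ⟨S, rfl⟩ := (Submodule.fg_iff_finiteDimensional V).mpr inferInstance
  refine ⟨S.sup fun x => ((basis n q).repr x).support.sup (monomialDegree n), ?_⟩
  rw [Submodule.span_le]
  intro x hx
  have h1 := (basis n q).mem_span_repr_support x
  refine Submodule.span_mono (Set.image_mono ?_) h1
  intro m hm
  exact le_trans (Finset.le_sup (f := monomialDegree n) hm)
    (Finset.le_sup (f := fun x => ((basis n q).repr x).support.sup (monomialDegree n)) hx)

theorem pow_le_filtration (hn : 1 ≤ n) {N : ℕ} {V : Submodule 𝕜 (OreAlg n q)}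
    (hV : V ≤ filtration n q N) (m : ℕ) : V ^ m ≤ filtration n q (N * m) := by
  induction m with
  | zero =>
    rw [pow_zero, Submodule.one_eq_span, Submodule.span_le, Set.singleton_subset_iff]
    exact Submodule.subset_span ⟨(((0, 0), 0), 0), by simp [monomialDegree],
      by simp [basis_apply, monomial, skewMonomial]⟩
  | succ m ih =>
    rw [pow_succ]
    exact (mul_le_mul' ih hV).trans (filtration_mul_le hn _ _)

/-- The degree filtration has quartic growth; the crude bound `8` suffices for finiteness. -/
theorem gkDim_lt_top (hn : 1 ≤ n) : gkDim 𝕜 (OreAlg n q) < ⊤ := by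
  have key : gkDim 𝕜 (OreAlg n q) ≤ ((8 : ℝ) : EReal) := by
    refine iSup_le fun V => iSup_le fun hV => ?_
    obtain ⟨N, hN⟩ := exists_le_filtration V
    have h1 : (1 : Submodule 𝕜 (OreAlg n q)) ≤ filtration n q N :=
      (pow_le_filtration hn hN 0).trans (filtration_mono (by simp))
    refine Filter.limsup_le_of_le ?_ ?_
    · isBoundedDefault
    filter_upwards [Filter.eventually_ge_atTop (N + 2)] with m hm
    have h2 := finrank_filtration_le hn (N * m) _ (pow_le_filtration hn (sup_le h1 hN) m)
    have h3 : (N * m + 1) ^ 4 ≤ m ^ 8 := by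
      have : N * m + 1 ≤ m ^ 2 := by nlinarith
      calc (N * m + 1) ^ 4 ≤ (m ^ 2) ^ 4 := Nat.pow_le_pow_left this 4
        _ = m ^ 8 := by ring
    have hlog : 0 < Real.log m := Real.log_pos (by exact_mod_cast (by omega : 1 < m))
    rw [EReal.coe_le_coe_iff, div_le_iff₀ hlog]
    rcases Nat.eq_zero_or_pos (Module.finrank 𝕜 ((1 ⊔ V) ^ m : Submodule 𝕜 (OreAlg n q)))
      with h0 | h0
    · rw [h0, Nat.cast_zero, Real.log_zero]
      positivity
    · calc Real.log (Module.finrank 𝕜 ((1 ⊔ V) ^ m : Submodule 𝕜 (OreAlg n q)))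
          ≤ Real.log ((m : ℝ) ^ 8) :=
            Real.log_le_log (by exact_mod_cast h0) (by exact_mod_cast h2.trans h3)
        _ = 8 * Real.log m := by rw [Real.log_pow]; norm_num
  exact lt_of_le_of_lt key (EReal.coe_lt_top 8)

variable (q) in
theorem isASRegular (hn : 1 ≤ n) (hq : q ≠ 0) : IsASRegular (grading n q) 4 :=
  isASRegular_of_koszul (koszulData hn hq) hn (koszulGrading hn) (hasInjectiveDimensionLT n q hq)
    (hasInjectiveDimensionLT_op n hq) (isConnectedGraded hn) (gkDim_lt_top hn)

/-! ### The normal element -/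

section NormalElement

theorem f_mem (hn : 1 ≤ n) : f n q ∈ grading n q (4 * n - 2) := by
  have := gradedMonoid n q
  have h1 := SetLike.pow_mem_graded 2 (gen_mem (n := n) (q := q) .a)
  have h2 := SetLike.mul_mem_graded
    (SetLike.pow_mem_graded (2 * (n - 1)) (gen_mem (n := n) (q := q) .b)) (gen_mem .d)
  have e1 : 2 • fourDegree n .a = 4 * n - 2 := by
    simp only [fourDegree, smul_eq_mul]
    omega
  have e2 : (2 * (n - 1)) • fourDegree n .b + fourDegree n .d = 4 * n - 2 := by
    simp only [fourDegree, smul_eq_mul]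
    omega
  rw [e1] at h1
  rw [e2] at h2
  exact sub_mem h1 h2

variable (hq : q ^ n = -1)
include hq

theorem commute_a_sq_b : Commute (gen n q .a ^ 2) (gen n q .b) := by
  have t := skewTriple n q
  have h1 : gen n q .c ^ n * gen n q .a = (-1 : 𝕜) • (gen n q .a * gen n q .c ^ n) := by
    rw [pow_mul_of_skew t.ca, hq]
  change gen n q .a ^ 2 * gen n q .b = gen n q .b * gen n q .a ^ 2
  rw [pow_two, ← mul_assoc (gen n q .b), t.ba, add_mul, h1, one_smul,
    mul_assoc _ (gen n q .b), t.ba, one_smul, mul_add, mul_assoc]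
  match_scalars <;> ring

theorem commute_a_b_sq : Commute (gen n q .a) (gen n q .b ^ 2) := by
  have t := skewTriple n q
  have h1 : gen n q .b * gen n q .c ^ n = (-1 : 𝕜) • (gen n q .c ^ n * gen n q .b) := by
    rw [mul_pow_of_skew t.bc, hq]
  change gen n q .a * gen n q .b ^ 2 = gen n q .b ^ 2 * gen n q .a
  rw [pow_two, mul_assoc (gen n q .b), t.ba, one_smul, mul_add, h1, ← mul_assoc (gen n q .b), t.ba,
    one_smul, add_mul, mul_assoc]
  match_scalars <;> ring

theorem commute_f_a : Commute (f n q) (gen n q .a) := by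
  refine Commute.sub_left ((Commute.refl _).pow_left 2) (Commute.mul_left ?_ (commute_d _))
  rw [pow_mul]
  exact ((commute_a_b_sq hq).symm.pow_left _)

theorem commute_f_b : Commute (f n q) (gen n q .b) :=
  Commute.sub_left (commute_a_sq_b hq)
    (Commute.mul_left ((Commute.refl _).pow_left _) (commute_d _))

theorem f_mul_c (hn : 1 ≤ n) : f n q * gen n q .c = (q ^ 2)⁻¹ • (gen n q .c * f n q) := by
  have t := skewTriple n q
  have hq0 : q ≠ 0 := by
    rintro rfl
    rw [zero_pow (by omega)] at hq
    exact one_ne_zero (neg_eq_zero.mp hq.symm)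
  have h1 := mul_pow_of_skew t.ca 2
  have h2 := pow_mul_of_skew t.bc (2 * (n - 1))
  have h3 : q ^ (2 * (n - 1)) = (q ^ 2)⁻¹ := by
    refine eq_inv_of_mul_eq_one_left ?_
    rw [← pow_add, show 2 * (n - 1) + 2 = n * 2 by omega,
      pow_mul, hq]
    ring
  rw [f, mul_sub, sub_mul, h1, mul_assoc _ (gen n q .d), (commute_d _).eq, ← mul_assoc, h2, h3,
    ← mul_assoc, smul_sub, smul_smul, inv_mul_cancel₀ (pow_ne_zero 2 hq0), one_smul,
    smul_mul_assoc]

/-- The automorphism which describes the commutation of `f` with other elements. -/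
noncomputable def twist (hn : 1 ≤ n) : OreAlg n q ≃ₐ[𝕜] OreAlg n q :=
  have hq0 : q ≠ 0 := by
    rintro rfl
    rw [zero_pow (by omega)] at hq
    exact one_ne_zero (neg_eq_zero.mp hq.symm)
  scale 1 1 (q ^ 2)⁻¹ (by rw [inv_pow, ← pow_mul, mul_comm 2, pow_mul, hq]; norm_num) one_ne_zero
    one_ne_zero (inv_ne_zero (pow_ne_zero 2 hq0))

theorem f_mul (hn : 1 ≤ n) (x : OreAlg n q) : f n q * x = twist hq hn x * f n q := by
  have hx : x ∈ Algebra.adjoin 𝕜 {gen n q .a, gen n q .c, gen n q .b, gen n q .d} := by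
    rw [adjoin_gen]
    trivial
  induction hx using Algebra.adjoin_induction with
  | mem x hx =>
    rcases hx with rfl | rfl | rfl | rfl <;> rw [twist, scale_gen, fourElements]
    · rw [one_smul, (commute_f_a hq).eq]
    · rw [f_mul_c hq hn, smul_mul_assoc]
    · rw [one_smul, (commute_f_b hq).eq]
    · rw [(commute_d _).eq]
  | algebraMap r => rw [AlgEquiv.commutes, Algebra.commutes]
  | add x y _ _ hx hy => rw [mul_add, hx, hy, map_add, add_mul]
  | mul x y _ _ hx hy => rw [← mul_assoc, hx, mul_assoc, hy, ← mul_assoc, map_mul]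

omit hq in
/-- Left multiplication by `f` raises the exponent of `a` in the leading monomials by two, while
`b` and `d` do not raise it. -/
theorem f_mul_eq_zero {x : OreAlg n q} (hx : f n q * x = 0) : x = 0 := by
  let F : ℕ → Submodule 𝕜 (OreAlg n q) := fun I =>
    Submodule.span 𝕜 (basis n q '' {m | m.1.1.1 < I})
  have hF : ∀ (I : ℕ) (y : OreAlg n q), y ∈ F I ↔ ∀ m, I ≤ m.1.1.1 → (basis n q).repr y m = 0 := by
    intro I y
    rw [(basis n q).mem_span_image]
    constructor
    · intro h m hm
      by_contra hne
      exact absurd (h (Finsupp.mem_support_iff.mpr hne)) (not_lt.mpr hm)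
    · intro h m hm
      by_contra hlt
      exact Finsupp.mem_support_iff.mp hm (h m (not_lt.mp hlt))
  have hstable : ∀ (I : ℕ) (g : OreAlg n q), (∀ m, m.1.1.1 < I → g * basis n q m ∈ F I) →
      ∀ y ∈ F I, g * y ∈ F I := by
    intro I g hg y hy
    have : F I ≤ (F I).comap (LinearMap.mulLeft 𝕜 g) := by
      rw [Submodule.span_le]
      rintro _ ⟨m, hm, rfl⟩
      exact hg m hm
    exact this hy
  have hd : ∀ I, ∀ y ∈ F I, gen n q .d * y ∈ F I := by
    refine fun I => hstable I _ fun ⟨⟨⟨i, j⟩, k⟩, l⟩ hm => ?_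
    rw [basis_apply, d_mul_monomial, ← basis_apply]
    exact Submodule.subset_span ⟨(((i, j), k), l + 1), hm, rfl⟩
  have hb : ∀ I, ∀ y ∈ F I, gen n q .b * y ∈ F I := by
    refine fun I => hstable I _ fun ⟨⟨⟨i, j⟩, k⟩, l⟩ hm => ?_
    rw [basis_apply, b_mul_monomial, ← basis_apply, ← basis_apply]
    refine add_mem (Submodule.smul_mem _ _ (Submodule.subset_span ⟨(((i, j), k + 1), l), hm, rfl⟩))
      (Submodule.smul_mem _ _ (Submodule.subset_span ⟨(((i - 1, j + n), k), l), ?_, rfl⟩))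
    exact lt_of_le_of_lt (Nat.sub_le i 1) hm
  have hbp : ∀ (r I : ℕ), ∀ y ∈ F I, gen n q .b ^ r * y ∈ F I := by
    intro r I y hy
    induction r with
    | zero => simpa using hy
    | succ r ih =>
      rw [pow_succ', mul_assoc]
      exact hb I _ ih
  have ha : ∀ (y : OreAlg n q) (i j k l : ℕ),
      (basis n q).repr (gen n q .a ^ 2 * y) (((i + 2, j), k), l)
        = (basis n q).repr y (((i, j), k), l) := by
    intro y i j k l
    have := (basis n q).repr_of_map (LinearMap.mulLeft 𝕜 (gen n q .a ^ 2))
      (fun m => (((m.1.1.1 + 2, m.1.1.2), m.1.2), m.2))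
      (fun m m' h => by simpa [Prod.ext_iff] using h) 1
      (fun ⟨⟨⟨i, j⟩, k⟩, l⟩ => by
        rw [basis_apply, basis_apply, LinearMap.mulLeft_apply, pow_two, mul_assoc, a_mul_monomial,
          a_mul_monomial, Pi.one_apply, one_smul]) y (((i, j), k), l)
    simpa using this
  have hstep : ∀ I, x ∈ F (I + 1) → x ∈ F I := by
    intro I hI
    have h1 : gen n q .a ^ 2 * x ∈ F (I + 1) := by
      rw [f, sub_mul, sub_eq_zero, mul_assoc] at hx
      rw [hx]
      exact hbp _ _ _ (hd _ _ hI)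
    rw [hF] at h1 ⊢
    rintro ⟨⟨⟨i, j⟩, k⟩, l⟩ hm
    rw [← ha]
    exact h1 _ (Nat.succ_le_succ (Nat.le_succ_of_le hm))
  have hall : ∀ I, x ∈ F I → x = 0 := by
    intro I
    induction I with
    | zero =>
      intro h
      rw [hF] at h
      exact (basis n q).ext_elem fun m => by simpa using h m (Nat.zero_le _)
    | succ I ih => exact fun h => ih (hstep I h)
  refine hall ((((basis n q).repr x).support.sup fun m => m.1.1.1) + 1) ?_
  rw [hF]
  intro m hm
  by_contra hne
  have h := Finset.le_sup (f := fun m : ((ℕ × ℕ) × ℕ) × ℕ => m.1.1.1)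
    (Finsupp.mem_support_iff.mpr hne)
  omega

theorem isRegular_f (hn : 1 ≤ n) : IsRegular (f n q) := by
  constructor
  · intro x y hxy
    refine sub_eq_zero.mp (f_mul_eq_zero ?_)
    rw [mul_sub]
    exact sub_eq_zero.mpr hxy
  · intro x y hxy
    have h : ∀ z, z * f n q = f n q * (twist hq hn).symm z := fun z => by
      rw [f_mul hq hn, AlgEquiv.apply_symm_apply]
    refine (twist hq hn).symm.injective (sub_eq_zero.mp (f_mul_eq_zero (n := n) (q := q) ?_))
    rw [mul_sub, ← h, ← h]
    exact sub_eq_zero.mpr hxy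

end NormalElement

end OreAlg

/-! ### The action of the Taft algebra on ordered monomials -/

namespace TaftDownUp

variable {𝕜 : Type u} [Field 𝕜]

/-- The coefficient of `u v ^ (l - 1)` in `x · v ^ l`. -/
def coeffA (ω : 𝕜) : ℕ → 𝕜
  | 0 => 0
  | l + 1 => ω⁻¹ * coeffA ω l + 1

/-- The coefficient of `z v ^ (l - 2)` in `x · v ^ l`. -/
def coeffB (k : ℕ) (ω s : 𝕜) : ℕ → 𝕜
  | 0 => 0
  | l + 1 => ω ^ k * coeffA ω l + s⁻¹ * coeffB k ω s l

section Coefficients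

variable {n : ℕ} {ω s : 𝕜}

theorem coeffA_mul (hs : s ^ 2 = ω) (l : ℕ) :
    coeffA ω l * (1 - s⁻¹ ^ 2) = 1 - s⁻¹ ^ (2 * l) := by
  induction l with
  | zero => simp [coeffA]
  | succ l ih =>
    rw [coeffA, add_mul, mul_assoc, ih, ← hs, ← inv_pow]
    ring

theorem coeffB_mul (k : ℕ) (hs : s ^ 2 = ω) (hs0 : s ≠ 0) (l : ℕ) :
    coeffB k ω s l * (1 - s) * (1 - s⁻¹ ^ 2)
      = ω ^ (k + 1) * ((1 - s⁻¹ ^ l) * (s⁻¹ ^ l - s⁻¹)) := by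
  induction l with
  | zero => simp [coeffB]
  | succ l ih =>
    have h1 := coeffA_mul hs l
    have h2 : ω ^ k = ω ^ (k + 1) * s⁻¹ ^ 2 := by
      rw [inv_pow, hs, pow_succ, mul_assoc, mul_inv_cancel₀ (hs ▸ pow_ne_zero 2 hs0), mul_one]
    have h3 : s⁻¹ * s = 1 := inv_mul_cancel₀ hs0
    have h4 : s⁻¹ ^ (2 * l) = (s⁻¹ ^ l) ^ 2 := by rw [← pow_mul, mul_comm]
    rw [coeffB, h2, pow_succ s⁻¹ l]
    rw [h4] at h1
    linear_combination ω ^ (k + 1) * s⁻¹ ^ 2 * (1 - s) * h1 + s⁻¹ * ih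
      + (-(ω ^ (k + 1) * s⁻¹ * (1 - (s⁻¹ ^ l) ^ 2))) * h3

theorem coeffA_ne_zero (hs : s ^ 2 = ω) (hprim : IsPrimitiveRoot s (2 * n)) {l : ℕ}
    (hl : ¬ n ∣ l) : coeffA ω l ≠ 0 := by
  intro h
  have h1 := coeffA_mul hs l
  rw [h, zero_mul, eq_comm, sub_eq_zero, eq_comm, inv_pow, inv_eq_one] at h1
  exact hl (Nat.dvd_of_mul_dvd_mul_left two_pos ((hprim.pow_eq_one_iff_dvd _).mp h1))

theorem coeffB_ne_zero (k : ℕ) (hn : 2 ≤ n) (hs : s ^ 2 = ω) (hprim : IsPrimitiveRoot s (2 * n))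
    {l : ℕ} (hl : 2 ≤ l % (2 * n)) : coeffB k ω s l ≠ 0 := by
  intro h
  have hs0 : s ≠ 0 := hprim.ne_zero (by omega)
  have h1 := coeffB_mul k hs hs0 l
  rw [h, zero_mul, zero_mul, eq_comm, mul_eq_zero, mul_eq_zero, sub_eq_zero, sub_eq_zero] at h1
  rcases h1 with h1 | h1 | h1
  · exact pow_ne_zero _ (hs ▸ pow_ne_zero 2 hs0) h1
  · rw [eq_comm, inv_pow, inv_eq_one, hprim.pow_eq_one_iff_dvd] at h1
    omega
  · obtain ⟨m, rfl⟩ : ∃ m, l = m + 1 := ⟨l - 1, by rcases l with _ | l <;> simp at hl ⊢⟩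
    rw [pow_succ, mul_eq_right₀ (inv_ne_zero hs0), inv_pow, inv_eq_one,
      hprim.pow_eq_one_iff_dvd] at h1
    obtain ⟨c, rfl⟩ := h1
    rw [Nat.mul_add_mod, Nat.mod_eq_of_lt (by omega)] at hl
    omega

end Coefficients

variable (k : ℕ) {ω s : 𝕜} (hω : ω ≠ 0) (hs : s ^ 2 = ω)

theorem gAct_z : gAct k hω hs (z k ω s) = ω ^ (2 * k + 1) • z k ω s := by
  rw [z, map_sub, map_smul, gAct_mul, gAct_mul, gAct_u, gAct_v]
  simp only [smul_mul_assoc, mul_smul_comm, smul_smul, smul_sub]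
  match_scalars <;> ring

theorem xAct_z : xAct k hω hs (z k ω s) = 0 := by
  rw [z, map_sub, map_smul, xAct_mul, xAct_mul, gAct_u, gAct_v, xAct_u, xAct_v, mul_zero, zero_mul,
    zero_add, add_zero, smul_mul_assoc, smul_smul, ← mul_pow, inv_mul_cancel₀ hω, one_pow, one_smul,
    sub_self]

theorem gAct_monomial (i j : ℕ) : gAct k hω hs (u k ω s ^ i * z k ω s ^ j)
    = (ω ^ ((k + 1) * i) * ω ^ ((2 * k + 1) * j)) • (u k ω s ^ i * z k ω s ^ j) := by
  have hp : ∀ (y : TaftDownUp k ω s) (r : 𝕜), gAct k hω hs y = r • y → ∀ m : ℕ,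
      gAct k hω hs (y ^ m) = r ^ m • y ^ m := by
    intro y r hy m
    induction m with
    | zero => simpa using gAct_algebraMap k hω hs 1
    | succ m ih => rw [pow_succ, gAct_mul, ih, hy, smul_mul_smul_comm, pow_succ]
  rw [gAct_mul, hp _ _ (gAct_u k hω hs), hp _ _ (gAct_z k hω hs), smul_mul_smul_comm, ← pow_mul,
    ← pow_mul]

theorem xAct_pow_eq_zero {y : TaftDownUp k ω s} (hy : xAct k hω hs y = 0) (m : ℕ) :
    xAct k hω hs (y ^ m) = 0 := by
  induction m with
  | zero => simpa using xAct_algebraMap k hω hs 1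
  | succ m ih => rw [pow_succ, xAct_mul, ih, hy, mul_zero, zero_mul, add_zero]

theorem xAct_v_pow (l : ℕ) : xAct k hω hs (v k ω s ^ l)
    = coeffA ω l • (u k ω s * v k ω s ^ (l - 1))
      + coeffB k ω s l • (z k ω s * v k ω s ^ (l - 2)) := by
  have t := skewTriple k ω s
  have hs0 : s ≠ 0 := by rintro rfl; exact hω (by simpa using hs.symm)
  induction l with
  | zero => simpa [coeffA, coeffB] using xAct_algebraMap k hω hs 1
  | succ l ih =>
    have hA : coeffA ω l • (u k ω s * (v k ω s * v k ω s ^ (l - 1)))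
        = coeffA ω l • (u k ω s * v k ω s ^ l) := by
      rcases l with _ | l
      · simp [coeffA]
      · rw [Nat.add_sub_cancel, ← pow_succ']
    have hB : coeffB k ω s l • (z k ω s * (v k ω s * v k ω s ^ (l - 2)))
        = coeffB k ω s l • (z k ω s * v k ω s ^ (l - 1)) := by
      rcases l with _ | _ | l
      · simp [coeffB]
      · simp [coeffB, coeffA]
      · rw [← pow_succ']
        rfl
    have h1 : v k ω s * (u k ω s * v k ω s ^ (l - 1)) = ω⁻¹ ^ (k + 1) • (u k ω s *
        (v k ω s * v k ω s ^ (l - 1))) + z k ω s * v k ω s ^ (l - 1) := by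
      rw [← mul_assoc, t.ba, pow_one, add_mul, smul_mul_assoc, mul_assoc]
    have h2 : v k ω s * (z k ω s * v k ω s ^ (l - 2)) = (ω⁻¹ ^ (k + 1) * s) • (z k ω s *
        (v k ω s * v k ω s ^ (l - 2))) := by
      rw [← mul_assoc, t.bc, smul_mul_assoc, mul_assoc]
    have e1 : ω ^ k * ω⁻¹ ^ (k + 1) = ω⁻¹ := by
      rw [pow_succ, ← mul_assoc, ← mul_pow, mul_inv_cancel₀ hω, one_pow, one_mul]
    have e2 : ω⁻¹ * s = s⁻¹ := by
      rw [← hs, pow_two, mul_inv, mul_assoc, inv_mul_cancel₀ hs0, mul_one]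
    rw [pow_succ', xAct_mul, ih, gAct_v, xAct_v, smul_mul_assoc, mul_add, mul_smul_comm,
      mul_smul_comm, h1, h2, smul_add, smul_add (coeffA ω l),
      smul_comm (coeffA ω l) (ω⁻¹ ^ (k + 1)), hA, smul_comm (coeffB k ω s l), hB,
      coeffA, coeffB, Nat.add_sub_cancel, show l + 1 - 2 = l - 1 by omega]
    match_scalars
    · linear_combination coeffA ω l * e1
    · linear_combination coeffB k ω s l * (s * e1 + e2)

/-- The scalar by which `g` acts on `u ^ i z ^ j`. -/
def groupWeight (k : ℕ) (ω : 𝕜) (i j : ℕ) : 𝕜 := ω ^ ((k + 1) * i) * ω ^ ((2 * k + 1) * j)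

include hω in
theorem groupWeight_ne_zero (i j : ℕ) : groupWeight k ω i j ≠ 0 :=
  mul_ne_zero (pow_ne_zero _ hω) (pow_ne_zero _ hω)

theorem xAct_basis (i j l : ℕ) : xAct k hω hs (basis k ω s ((i, j), l))
    = (groupWeight k ω i j * coeffA ω l * (ω⁻¹ ^ (k + 1) * s) ^ j) •
        basis k ω s ((i + 1, j), l - 1)
      + (groupWeight k ω i j * coeffB k ω s l) • basis k ω s ((i, j + 1), l - 2) := by
  have t := skewTriple k ω s
  have h0 : xAct k hω hs (u k ω s ^ i * z k ω s ^ j) = 0 := by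
    rw [xAct_mul, xAct_pow_eq_zero k hω hs (xAct_u k hω hs),
      xAct_pow_eq_zero k hω hs (xAct_z k hω hs), mul_zero, zero_mul, add_zero]
  simp only [basis_apply, monomial, skewMonomial]
  rw [xAct_mul, h0, zero_mul, add_zero, gAct_monomial, xAct_v_pow, mul_add, mul_smul_comm,
    mul_smul_comm, smul_mul_assoc, smul_mul_assoc, groupWeight, mul_assoc (u k ω s ^ i),
    mul_assoc (u k ω s ^ i), ← mul_assoc (z k ω s ^ j), ← mul_assoc (z k ω s ^ j),
    pow_mul_of_skew t.ca, ← pow_succ, smul_mul_assoc, mul_smul_comm, pow_succ (u k ω s)]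
  simp only [smul_smul, mul_assoc]
  match_scalars <;> ring

/-- The part of the action of `x` which exchanges a factor `v` for `u`. -/
noncomputable def xActU (k : ℕ) (ω s : 𝕜) : Module.End 𝕜 (TaftDownUp k ω s) :=
  (basis k ω s).constr 𝕜 fun m =>
    (groupWeight k ω m.1.1 m.1.2 * coeffA ω m.2 * (ω⁻¹ ^ (k + 1) * s) ^ m.1.2) •
      basis k ω s ((m.1.1 + 1, m.1.2), m.2 - 1)

/-- The part of the action of `x` which exchanges two factors `v` for `z`. -/
noncomputable def xActZ (k : ℕ) (ω s : 𝕜) : Module.End 𝕜 (TaftDownUp k ω s) :=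
  (basis k ω s).constr 𝕜 fun m =>
    (groupWeight k ω m.1.1 m.1.2 * coeffB k ω s m.2) • basis k ω s ((m.1.1, m.1.2 + 1), m.2 - 2)

theorem xAct_eq_add : xAct k hω hs = xActU k ω s + xActZ k ω s := by
  refine (basis k ω s).ext fun ⟨⟨i, j⟩, l⟩ => ?_
  rw [xAct_basis, LinearMap.add_apply, xActU, xActZ, Module.Basis.constr_basis,
    Module.Basis.constr_basis]

section Coordinates

variable (y : TaftDownUp k ω s) (i j l : ℕ)

omit hω hs

theorem repr_xActU : (basis k ω s).repr (xActU k ω s y) ((i + 1, j), l)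
    = groupWeight k ω i j * coeffA ω (l + 1) * (ω⁻¹ ^ (k + 1) * s) ^ j *
      (basis k ω s).repr y ((i, j), l + 1) := by
  refine (basis k ω s).repr_map_apply (xActU k ω s)
    (fun m => ((m.1.1 + 1, m.1.2), m.2 - 1))
    (fun m => groupWeight k ω m.1.1 m.1.2 * coeffA ω m.2 * (ω⁻¹ ^ (k + 1) * s) ^ m.1.2)
    (fun m => Module.Basis.constr_basis _ _ _ _) ((i, j), l + 1) ?_ y
  rintro ⟨⟨i', j'⟩, l'⟩ h
  rcases l' with _ | l'
  · exact Or.inr (by simp [coeffA])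
  · left
    simpa [Prod.ext_iff] using h

theorem repr_xActU_zero : (basis k ω s).repr (xActU k ω s y) ((0, j), l) = 0 := by
  refine (basis k ω s).repr_map_apply_eq_zero (xActU k ω s)
    (fun m => ((m.1.1 + 1, m.1.2), m.2 - 1))
    (fun m => groupWeight k ω m.1.1 m.1.2 * coeffA ω m.2 * (ω⁻¹ ^ (k + 1) * s) ^ m.1.2)
    (fun m => Module.Basis.constr_basis _ _ _ _) ((0, j), l) ?_ y
  rintro ⟨⟨i', j'⟩, l'⟩ h
  simp [Prod.ext_iff] at h

theorem repr_xActZ : (basis k ω s).repr (xActZ k ω s y) ((i, j + 1), l)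
    = groupWeight k ω i j * coeffB k ω s (l + 2) * (basis k ω s).repr y ((i, j), l + 2) := by
  refine (basis k ω s).repr_map_apply (xActZ k ω s)
    (fun m => ((m.1.1, m.1.2 + 1), m.2 - 2))
    (fun m => groupWeight k ω m.1.1 m.1.2 * coeffB k ω s m.2)
    (fun m => Module.Basis.constr_basis _ _ _ _) ((i, j), l + 2) ?_ y
  rintro ⟨⟨i', j'⟩, l'⟩ h
  rcases l' with _ | _ | l'
  · exact Or.inr (by simp [coeffB])
  · exact Or.inr (by simp [coeffB, coeffA])
  · left
    simpa [Prod.ext_iff] using h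

theorem repr_xActZ_zero : (basis k ω s).repr (xActZ k ω s y) ((i, 0), l) = 0 := by
  refine (basis k ω s).repr_map_apply_eq_zero (xActZ k ω s)
    (fun m => ((m.1.1, m.1.2 + 1), m.2 - 2))
    (fun m => groupWeight k ω m.1.1 m.1.2 * coeffB k ω s m.2)
    (fun m => Module.Basis.constr_basis _ _ _ _) ((i, 0), l) ?_ y
  rintro ⟨⟨i', j'⟩, l'⟩ h
  simp [Prod.ext_iff] at h

end Coordinates

/-- An element killed by `x` vanishes as soon as its coordinates at `u ^ i z ^ j v ^ (2nm)` and
`u ^ (i + n - 1) z ^ j v ^ (2nm + n)` do: the equation `x y = 0` determines the other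
coordinates, since the coefficient of `u v ^ (l - 1)` in `x · v ^ l` is zero only if `n ∣ l`, and
the one of `z v ^ (l - 2)` only if `l` is `0` or `1` modulo `2n`. -/
theorem eq_zero_of_xAct_eq_zero {n : ℕ} (hn : 2 ≤ n) (hprim : IsPrimitiveRoot s (2 * n))
    {y : TaftDownUp k ω s} (hy : xAct k hω hs y = 0)
    (h1 : ∀ i j m, (basis k ω s).repr y ((i, j), 2 * n * m) = 0)
    (h2 : ∀ i j m, (basis k ω s).repr y ((i + (n - 1), j), 2 * n * m + n) = 0) : y = 0 := by
  have hs0 : s ≠ 0 := hprim.ne_zero (by omega)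
  have hw := groupWeight_ne_zero k hω
  have hr : ω⁻¹ ^ (k + 1) * s ≠ 0 := mul_ne_zero (pow_ne_zero _ (inv_ne_zero hω)) hs0
  have hcoord : ∀ m, (basis k ω s).repr (xActU k ω s y) m
      + (basis k ω s).repr (xActZ k ω s y) m = 0 := by
    intro m
    rw [← Finsupp.add_apply, ← map_add, ← LinearMap.add_apply, ← xAct_eq_add k hω hs, hy, map_zero,
      Finsupp.zero_apply]
  -- coordinates at low powers of `u`, by comparison of coordinates at higher powers of `z`
  have hlow : ∀ i j l, i + 2 ≤ l % (2 * n) → (basis k ω s).repr y ((i, j), l) = 0 := by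
    intro i
    induction i with
    | zero =>
      intro j l hl
      obtain ⟨l, rfl⟩ : ∃ m, l = m + 2 := ⟨l - 2, by have := Nat.mod_le l (2 * n); omega⟩
      have h := hcoord ((0, j + 1), l)
      rw [repr_xActU_zero, zero_add, repr_xActZ] at h
      exact (mul_eq_zero.mp h).resolve_left
        (mul_ne_zero (hw _ _) (coeffB_ne_zero k hn hs hprim (by omega)))
    | succ i ih =>
      intro j l hl
      obtain ⟨l, rfl⟩ : ∃ m, l = m + 2 := ⟨l - 2, by have := Nat.mod_le l (2 * n); omega⟩
      have h := hcoord ((i + 1, j + 1), l)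
      have hmod : i + 2 ≤ (l + 1) % (2 * n) := by
        have h3 := Nat.mod_add_div (l + 2) (2 * n)
        have h4 := Nat.mod_lt (l + 2) (show 0 < 2 * n by omega)
        have h5 : l + 1 = ((l + 2) % (2 * n) - 1) + 2 * n * ((l + 2) / (2 * n)) := by omega
        rw [h5, Nat.add_mul_mod_self_left, Nat.mod_eq_of_lt (by omega)]
        omega
      rw [repr_xActU, repr_xActZ, ih _ _ hmod, mul_zero, zero_add] at h
      exact (mul_eq_zero.mp h).resolve_left
        (mul_ne_zero (hw _ _) (coeffB_ne_zero k hn hs hprim (by omega)))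
  have hdvd : ∀ i j l, n ∣ l → (basis k ω s).repr y ((i, j), l) = 0 := by
    rintro i j _ ⟨c, rfl⟩
    obtain ⟨m, rfl | rfl⟩ := Nat.even_or_odd' c
    · rw [show n * (2 * m) = 2 * n * m by ring]
      exact h1 i j m
    · rw [show n * (2 * m + 1) = 2 * n * m + n by ring]
      by_cases hi : n - 1 ≤ i
      · obtain ⟨i, rfl⟩ := Nat.exists_eq_add_of_le' hi
        exact h2 i j m
      · refine hlow i j _ ?_
        rw [Nat.mul_add_mod, Nat.mod_eq_of_lt (by omega)]
        omega
  -- the remaining coordinates, by induction on the exponent of `z`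
  have hall : ∀ j i l, (basis k ω s).repr y ((i, j), l) = 0 := by
    intro j
    induction j with
    | zero =>
      intro i l
      by_cases hl : n ∣ l
      · exact hdvd i _ l hl
      · obtain ⟨l, rfl⟩ : ∃ m, l = m + 1 := ⟨l - 1, by rcases l with _ | l <;> simp at hl ⊢⟩
        have h := hcoord ((i + 1, 0), l)
        rw [repr_xActZ_zero, add_zero, repr_xActU] at h
        exact (mul_eq_zero.mp h).resolve_left (mul_ne_zero (mul_ne_zero (hw _ _)
          (coeffA_ne_zero hs hprim hl)) (pow_ne_zero _ hr))
    | succ j ih =>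
      intro i l
      by_cases hl : n ∣ l
      · exact hdvd i _ l hl
      · obtain ⟨l, rfl⟩ : ∃ m, l = m + 1 := ⟨l - 1, by rcases l with _ | l <;> simp at hl ⊢⟩
        have h := hcoord ((i + 1, j + 1), l)
        rw [repr_xActZ, ih, mul_zero, add_zero, repr_xActU] at h
        exact (mul_eq_zero.mp h).resolve_left (mul_ne_zero (mul_ne_zero (hw _ _)
          (coeffA_ne_zero hs hprim hl)) (pow_ne_zero _ hr))
  exact (basis k ω s).ext_elem fun m => by simpa using hall m.1.2 m.1.1 m.2

end TaftDownUp

/-! ### Bihomogeneous elements of the down-up algebra -/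

theorem SkewTriple.pow_mul_a {K : Type*} [CommRing K] {A : Type*} [Ring A] [Algebra K A]
    {p q : K} {a b c : A} (h : SkewTriple 1 p q a b c) (m : ℕ) :
    b ^ m * a = p ^ m • (a * b ^ m) + skewCoeff 1 p q m • (c * b ^ (m - 1)) := by
  induction m with
  | zero => simp [skewCoeff]
  | succ m ih =>
    have h1 : skewCoeff 1 p q m • (c * b ^ (m - 1) * b) = skewCoeff 1 p q m • (c * b ^ m) := by
      rcases m with _ | m
      · simp [skewCoeff]
      · rw [Nat.add_sub_cancel, mul_assoc, ← pow_succ]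
    rw [pow_succ, mul_assoc, h.ba, pow_one, mul_add, mul_smul_comm, ← mul_assoc, ih, add_mul,
      smul_mul_assoc, smul_mul_assoc, h1, pow_mul_of_skew h.bc, skewCoeff, one_mul,
      Nat.add_sub_cancel, mul_assoc a, ← pow_succ]
    match_scalars <;> ring

theorem skewCoeff_one_mul {K : Type*} [CommRing K] (p q : K) (m : ℕ) :
    skewCoeff 1 p q m * (p - q) = p ^ m - q ^ m := by
  induction m with
  | zero => simp [skewCoeff]
  | succ m ih =>
    rw [skewCoeff, one_mul]
    linear_combination p * ih

/-- A linear functional of `T y`, when only one basis element in the support of `y` contributes. -/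
theorem Module.Basis.repr_apply_of_support {K M N ι : Type*} [CommRing K] [AddCommGroup M]
    [Module K M] [AddCommGroup N] [Module K N] (B : Module.Basis ι K M) (T : M →ₗ[K] N)
    (f : N →ₗ[K] K) {y : M} (i : ι)
    (h : ∀ j, B.repr y j ≠ 0 → j ≠ i → f (T (B j)) = 0) :
    f (T y) = B.repr y i * f (T (B i)) := by
  conv_lhs => rw [← B.linearCombination_repr y]
  rw [Finsupp.linearCombination_apply, Finsupp.sum, map_sum, map_sum,
    Finset.sum_eq_single i]
  · simp
  · intro j hj hji
    rw [map_smul, map_smul, h j (Finsupp.mem_support_iff.mp hj) hji, smul_zero]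
  · intro hi
    rw [Finsupp.notMem_support_iff.mp hi, zero_smul, map_zero, map_zero]

namespace TaftDownUp

variable {𝕜 : Type u} [Field 𝕜] (k : ℕ) {ω s : 𝕜}

section Scale

variable (ω s)

theorem skewTriple_scale (μ ν : 𝕜) : SkewTriple 1 (ω⁻¹ ^ (k + 1)) (ω⁻¹ ^ (k + 1) * s)
    (μ • u k ω s) (ν • v k ω s) ((μ * ν) • z k ω s) := by
  have t := skewTriple k ω s
  constructor
  · rw [smul_mul_smul_comm, smul_mul_smul_comm, t.ca]
    match_scalars
    ring
  · rw [smul_mul_smul_comm, smul_mul_smul_comm, t.bc]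
    match_scalars
    ring
  · rw [smul_mul_smul_comm, smul_mul_smul_comm, t.ba, pow_one, pow_one]
    match_scalars <;> ring

/-- The endomorphism which multiplies `u` by `μ` and `v` by `ν`. -/
noncomputable def scale (μ ν : 𝕜) : TaftDownUp k ω s →ₐ[𝕜] TaftDownUp k ω s :=
  lift (skewTriple_scale k ω s μ ν)

theorem scale_basis (μ ν : 𝕜) (m : (ℕ × ℕ) × ℕ) : scale k ω s μ ν (basis k ω s m)
    = (μ ^ (m.1.1 + m.1.2) * ν ^ (m.1.2 + m.2)) • basis k ω s m := by
  simp only [basis_apply, monomial, skewMonomial, map_mul, map_pow, scale, lift_u, lift_v, lift_z,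
    smul_pow, smul_mul_smul_comm]
  congr 1
  ring

end Scale

/-- Elements of degree `N` in `u` and `M` in `v`, described as simultaneous eigenvectors of the
torus scaling `u` and `v`. -/
def IsBihomogeneous (N M : ℕ) (y : TaftDownUp k ω s) : Prop :=
  ∀ μ ν : 𝕜, μ ≠ 0 → ν ≠ 0 → scale k ω s μ ν y = (μ ^ N * ν ^ M) • y

namespace IsBihomogeneous

variable {k} {N M N' M' : ℕ} {y y' : TaftDownUp k ω s}

theorem mul (h : IsBihomogeneous k N M y) (h' : IsBihomogeneous k N' M' y') :
    IsBihomogeneous k (N + N') (M + M') (y * y') := by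
  intro μ ν hμ hν
  rw [map_mul, h μ ν hμ hν, h' μ ν hμ hν, smul_mul_smul_comm]
  congr 1
  ring

theorem sub (h : IsBihomogeneous k N M y) (h' : IsBihomogeneous k N M y') :
    IsBihomogeneous k N M (y - y') := by
  intro μ ν hμ hν
  rw [map_sub, h μ ν hμ hν, h' μ ν hμ hν, smul_sub]

theorem smul (h : IsBihomogeneous k N M y) (r : 𝕜) : IsBihomogeneous k N M (r • y) := by
  intro μ ν hμ hν
  rw [map_smul, h μ ν hμ hν, smul_comm]

theorem basis (i j l : ℕ) : IsBihomogeneous k (i + j) (j + l) (basis k ω s ((i, j), l)) :=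
  fun μ ν _ _ => scale_basis k ω s μ ν _

theorem eq_of_repr_ne_zero [CharZero 𝕜] (h : IsBihomogeneous k N M y) {m : (ℕ × ℕ) × ℕ}
    (hm : (TaftDownUp.basis k ω s).repr y m ≠ 0) : m.1.1 + m.1.2 = N ∧ m.1.2 + m.2 = M := by
  have h1 : ∀ μ ν : 𝕜, μ ≠ 0 → ν ≠ 0 →
      μ ^ (m.1.1 + m.1.2) * ν ^ (m.1.2 + m.2) = μ ^ N * ν ^ M := by
    intro μ ν hμ hν
    have h2 := (TaftDownUp.basis k ω s).repr_of_map (scale k ω s μ ν).toLinearMap id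
      Function.injective_id _ (scale_basis k ω s μ ν) y m
    rw [AlgHom.toLinearMap_apply, h μ ν hμ hν, map_smul, Finsupp.smul_apply, smul_eq_mul] at h2
    exact (mul_right_cancel₀ hm h2).symm
  -- in characteristic zero, the powers of `2` are distinct
  have hinj : ∀ a b : ℕ, (2 : 𝕜) ^ a = 2 ^ b → a = b := fun a b hab =>
    Nat.pow_right_injective le_rfl (by exact_mod_cast hab)
  constructor
  · have := h1 2 1 two_ne_zero one_ne_zero
    simp only [one_pow, mul_one] at this
    exact hinj _ _ this
  · have := h1 1 2 one_ne_zero two_ne_zero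
    simp only [one_pow, one_mul] at this
    exact hinj _ _ this

theorem mem_span [CharZero 𝕜] (h : IsBihomogeneous k N M y) : y ∈ Submodule.span 𝕜
    (TaftDownUp.basis k ω s '' {m | m.1.1 + m.1.2 = N ∧ m.1.2 + m.2 = M}) := by
  rw [Module.Basis.mem_span_image]
  intro m hm
  exact h.eq_of_repr_ne_zero (Finsupp.mem_support_iff.mp hm)

theorem z_mul [CharZero 𝕜] (h : IsBihomogeneous k N M y) :
    (ω⁻¹ ^ (k + 1) * s) ^ M • (z k ω s * y) = (ω⁻¹ ^ (k + 1) * s) ^ N • (y * z k ω s) := by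
  have t := skewTriple k ω s
  have hy := h.mem_span
  clear h
  induction hy using Submodule.span_induction with
  | mem y hy =>
    obtain ⟨⟨⟨i, j⟩, l⟩, ⟨h1, h2⟩, rfl⟩ := hy
    dsimp only at h1 h2
    rw [basis_apply, monomial, t.c_mul_monomial, skewMonomial, skewMonomial]
    dsimp only
    rw [mul_assoc _ (v k ω s ^ l), pow_mul_of_skew t.bc, mul_smul_comm, ← mul_assoc _ (z k ω s),
      mul_assoc _ _ (z k ω s), ← pow_succ, smul_smul, smul_smul, ← pow_add, ← pow_add, ← h1, ← h2]
    congr 2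
    ring
  | zero => simp
  | add x y _ _ hx hy => rw [mul_add, add_mul, smul_add, smul_add, hx, hy]
  | smul r x _ hx => rw [mul_smul_comm, smul_mul_assoc, smul_comm, hx, smul_comm]

end IsBihomogeneous

/-- The action of `x` replaces one factor `v` by `u`. -/
theorem scale_xAct (hω : ω ≠ 0) (hs : s ^ 2 = ω) (μ ν : 𝕜) (y : TaftDownUp k ω s) :
    ν • scale k ω s μ ν (xAct k hω hs y) = μ • xAct k hω hs (scale k ω s μ ν y) := by
  have key : ν • ((scale k ω s μ ν).toLinearMap ∘ₗ xAct k hω hs)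
      = μ • (xAct k hω hs ∘ₗ (scale k ω s μ ν).toLinearMap) := by
    refine (basis k ω s).ext ?_
    rintro ⟨⟨i, j⟩, l⟩
    simp only [LinearMap.smul_apply, LinearMap.comp_apply, AlgHom.toLinearMap_apply, scale_basis,
      xAct_basis, map_add, map_smul]
    rcases l with _ | _ | l
    · simp [coeffA, coeffB]
    · simp only [coeffB, coeffA, mul_zero, zero_smul, add_zero]
      match_scalars
      simp only [Nat.sub_self, zero_add]
      ring
    · simp only [show l + 1 + 1 - 1 = l + 1 by omega, show l + 1 + 1 - 2 = l by omega]
      match_scalars <;> ring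
  exact LinearMap.congr_fun key y

theorem IsBihomogeneous.xAct (hω : ω ≠ 0) (hs : s ^ 2 = ω) {N M : ℕ} {y : TaftDownUp k ω s}
    (h : IsBihomogeneous k N (M + 1) y) : IsBihomogeneous k (N + 1) M (xAct k hω hs y) := by
  intro μ ν hμ hν
  refine smul_right_injective _ hν ?_
  dsimp only
  rw [scale_xAct, h μ ν hμ hν, map_smul, smul_smul, smul_smul]
  congr 1
  ring

section Coordinates

variable (hω : ω ≠ 0) (hs : s ^ 2 = ω) (y : TaftDownUp k ω s)

theorem repr_xAct_u_pow (i l : ℕ) : (basis k ω s).repr (xAct k hω hs y) ((i + 1, 0), l)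
    = groupWeight k ω i 0 * coeffA ω (l + 1) * (basis k ω s).repr y ((i, 0), l + 1) := by
  rw [xAct_eq_add, LinearMap.add_apply, map_add, Finsupp.add_apply, repr_xActZ_zero, repr_xActU,
    add_zero, pow_zero, mul_one]

theorem repr_xAct_z_pow (j l : ℕ) : (basis k ω s).repr (xAct k hω hs y) ((0, j + 1), l)
    = groupWeight k ω 0 j * coeffB k ω s (l + 2) * (basis k ω s).repr y ((0, j), l + 2) := by
  rw [xAct_eq_add, LinearMap.add_apply, map_add, Finsupp.add_apply, repr_xActU_zero, repr_xActZ,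
    zero_add]

end Coordinates

/-! ### The invariants `v ^ (2n)` and `x ^ (n - 1) · v ^ (2n - 1)` -/

section Roots

variable {n : ℕ}

theorem inv_pow_mul_pow_two_mul (hs : s ^ 2 = ω)
    (hprim : IsPrimitiveRoot s (2 * n)) : (ω⁻¹ ^ (k + 1)) ^ (2 * n) = 1 ∧
      (ω⁻¹ ^ (k + 1) * s) ^ (2 * n) = 1 := by
  have h1 : (ω⁻¹ ^ (k + 1)) ^ (2 * n) = 1 := by
    rw [← hs, ← pow_mul, inv_pow, ← pow_mul,
      show 2 * ((k + 1) * (2 * n)) = 2 * n * (2 * (k + 1)) by ring, pow_mul, hprim.pow_eq_one, one_pow, inv_one]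
  exact ⟨h1, by rw [mul_pow, h1, hprim.pow_eq_one, one_mul]⟩

theorem commute_v_pow (hn : 2 ≤ n) (hs : s ^ 2 = ω) (hprim : IsPrimitiveRoot s (2 * n))
    (y : TaftDownUp k ω s) : Commute (v k ω s ^ (2 * n)) y := by
  have t := skewTriple k ω s
  obtain ⟨h1, h2⟩ := inv_pow_mul_pow_two_mul k hs hprim
  have hs0 : s ≠ 0 := hprim.ne_zero (by omega)
  have hs1 : s ≠ 1 := hprim.ne_one (by omega)
  have h3 : skewCoeff 1 (ω⁻¹ ^ (k + 1)) (ω⁻¹ ^ (k + 1) * s) (2 * n) = 0 := by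
    have h4 := skewCoeff_one_mul (ω⁻¹ ^ (k + 1)) (ω⁻¹ ^ (k + 1) * s) (2 * n)
    rw [h1, h2, sub_self, mul_eq_zero] at h4
    refine h4.resolve_right fun h5 => hs1 ?_
    rw [sub_eq_zero, eq_comm] at h5
    exact (mul_eq_left₀ (pow_ne_zero _ (inv_ne_zero (hs ▸ pow_ne_zero 2 hs0)))).mp h5
  have hy : y ∈ Algebra.adjoin 𝕜 {u k ω s, z k ω s, v k ω s} := by
    rw [adjoin_gen]
    trivial
  induction hy using Algebra.adjoin_induction with
  | mem x hx =>
    rcases hx with rfl | rfl | rfl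
    · rw [Commute, SemiconjBy, t.pow_mul_a, h1, h3, one_smul, zero_smul, add_zero]
    · rw [Commute, SemiconjBy, pow_mul_of_skew t.bc, h2, one_smul]
    · exact (Commute.refl _).pow_left _
  | algebraMap r => exact (Algebra.commutes r _).symm
  | add x y _ _ hx hy => exact hx.add_right hy
  | mul x y _ _ hx hy => exact hx.mul_right hy

theorem xAct_v_pow_two_mul (hn : 2 ≤ n) (hω : ω ≠ 0) (hs : s ^ 2 = ω)
    (hprim : IsPrimitiveRoot s (2 * n)) : xAct k hω hs (v k ω s ^ (2 * n)) = 0 := by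
  have hs0 : s ≠ 0 := hprim.ne_zero (by omega)
  have hs1 : 1 - s ≠ 0 := sub_ne_zero.mpr (hprim.ne_one (by omega)).symm
  have hs2 : 1 - s⁻¹ ^ 2 ≠ 0 := by
    rw [sub_ne_zero, ne_comm, inv_pow, Ne, inv_eq_one, hprim.pow_eq_one_iff_dvd]
    intro h
    have := Nat.le_of_dvd two_pos h
    omega
  have h1 : s⁻¹ ^ (2 * n) = 1 := by rw [inv_pow, hprim.pow_eq_one, inv_one]
  have hA := coeffA_mul hs (2 * n)
  have hB := coeffB_mul k hs hs0 (2 * n)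
  rw [mul_comm 2 (2 * n), pow_mul, h1, one_pow, sub_self, mul_eq_zero] at hA
  rw [h1, sub_self, zero_mul, mul_zero, mul_eq_zero, mul_eq_zero] at hB
  rw [xAct_v_pow, hA.resolve_right hs2, (hB.resolve_right hs2).resolve_right hs1, zero_smul,
    zero_smul, add_zero]

end Roots

section Element

variable {n : ℕ} (hn : 2 ≤ n) (hω : IsPrimitiveRoot ω n) (hs : s ^ 2 = ω)

theorem aElt_eq : aElt n k hn hω hs
    = (xAct k (hω.ne_zero (by omega)) hs ^ (n - 1)) (v k ω s ^ (2 * n - 1)) := by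
  rw [aElt, map_pow (taftAction n k hn hω hs), taftAction_x]

theorem isBihomogeneous_xAct_pow (h0 : ω ≠ 0) (l m : ℕ) : IsBihomogeneous k m l
    ((xAct k h0 hs ^ m) (v k ω s ^ (l + m))) := by
  induction m generalizing l with
  | zero =>
    have h := IsBihomogeneous.basis (k := k) (ω := ω) (s := s) 0 0 l
    simpa [basis_apply, monomial, skewMonomial] using h
  | succ m ih =>
    rw [pow_succ', Module.End.mul_apply, show l + (m + 1) = l + 1 + m by ring]
    exact (ih (l + 1)).xAct k h0 hs

theorem isBihomogeneous_aElt : IsBihomogeneous k (n - 1) n (aElt n k hn hω hs) := by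
  rw [aElt_eq, show 2 * n - 1 = n + (n - 1) by omega]
  exact isBihomogeneous_xAct_pow k hs _ n (n - 1)

theorem xAct_aElt : xAct k (hω.ne_zero (by omega)) hs (aElt n k hn hω hs) = 0 := by
  rw [aElt_eq, ← Module.End.mul_apply, ← pow_succ', show n - 1 + 1 = n by omega,
    xAct_pow k _ hs hn hω, LinearMap.zero_apply]

/-- Along `v ^ (2n - 1), x · v ^ (2n - 1), …`, the coordinate at `u ^ m v ^ (2n - 1 - m)` is multiplied
by `coeffA` at the exponents `2n - 1, …, n + 1`, none of which is divisible by `n`. -/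
theorem repr_aElt_u_ne_zero (hprim : IsPrimitiveRoot s (2 * n)) :
    (basis k ω s).repr (aElt n k hn hω hs) ((n - 1, 0), n) ≠ 0 := by
  have h0 : ω ≠ 0 := hω.ne_zero (by omega)
  have key : ∀ m, m < n → (basis k ω s).repr ((xAct k h0 hs ^ m) (v k ω s ^ (2 * n - 1)))
      ((m, 0), 2 * n - 1 - m) ≠ 0 := by
    intro m
    induction m with
    | zero =>
      intro _
      have h : v k ω s ^ (2 * n - 1) = basis k ω s ((0, 0), 2 * n - 1) := by
        simp [basis_apply, monomial, skewMonomial]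
      rw [pow_zero, Module.End.one_apply, h, Module.Basis.repr_self]
      simp
    | succ m ih =>
      intro hm
      rw [pow_succ', Module.End.mul_apply, repr_xAct_u_pow,
        show 2 * n - 1 - (m + 1) + 1 = 2 * n - 1 - m by omega]
      refine mul_ne_zero (mul_ne_zero (groupWeight_ne_zero k h0 _ _)
        (coeffA_ne_zero hs hprim ?_)) (ih (by omega))
      rintro ⟨c, hc⟩
      rcases c with _ | _ | c
      · omega
      · omega
      · rw [mul_add, mul_add] at hc
        omega
  have h := key (n - 1) (by omega)
  rwa [← aElt_eq, show 2 * n - 1 - (n - 1) = n by omega] at h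

/-- Along the same sequence, the coordinate at `z ^ m v ^ (2n - 1 - 2m)` is multiplied by `coeffB` at the
exponents `2n - 1, 2n - 3, …, 3`. -/
theorem repr_aElt_z_ne_zero (hprim : IsPrimitiveRoot s (2 * n)) :
    (basis k ω s).repr (aElt n k hn hω hs) ((0, n - 1), 1) ≠ 0 := by
  have h0 : ω ≠ 0 := hω.ne_zero (by omega)
  have key : ∀ m, m < n → (basis k ω s).repr ((xAct k h0 hs ^ m) (v k ω s ^ (2 * n - 1)))
      ((0, m), 2 * n - 1 - 2 * m) ≠ 0 := by
    intro m
    induction m with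
    | zero =>
      intro _
      have h : v k ω s ^ (2 * n - 1) = basis k ω s ((0, 0), 2 * n - 1) := by
        simp [basis_apply, monomial, skewMonomial]
      rw [pow_zero, Module.End.one_apply, h, Module.Basis.repr_self]
      simp
    | succ m ih =>
      intro hm
      rw [pow_succ', Module.End.mul_apply, repr_xAct_z_pow,
        show 2 * n - 1 - 2 * (m + 1) + 2 = 2 * n - 1 - 2 * m by omega]
      refine mul_ne_zero (mul_ne_zero (groupWeight_ne_zero k h0 _ _)
        (coeffB_ne_zero k hn hs hprim ?_)) (ih (by omega))
      rw [Nat.mod_eq_of_lt (by omega)]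
      omega
  have h := key (n - 1) (by omega)
  rwa [← aElt_eq, show 2 * n - 1 - 2 * (n - 1) = 1 by omega] at h

end Element

end TaftDownUp

/-! ### Relations between the invariants -/

namespace TaftDownUp

variable {𝕜 : Type u} [Field 𝕜] (k : ℕ) {ω s : 𝕜}

theorem mul_u_basis (i j l : ℕ) : basis k ω s ((i, j), l) * u k ω s
    = ((ω⁻¹ ^ (k + 1)) ^ l * (ω⁻¹ ^ (k + 1) * s) ^ j) • basis k ω s ((i + 1, j), l)
      + skewCoeff 1 (ω⁻¹ ^ (k + 1)) (ω⁻¹ ^ (k + 1) * s) l •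
        basis k ω s ((i, j + 1), l - 1) := by
  have t := skewTriple k ω s
  simp only [basis_apply, monomial, skewMonomial]
  rw [mul_assoc _ (v k ω s ^ l), t.pow_mul_a, mul_add, mul_smul_comm, mul_smul_comm,
    ← mul_assoc _ (u k ω s), mul_assoc _ _ (u k ω s), pow_mul_of_skew t.ca, pow_succ (u k ω s),
    ← mul_assoc _ (z k ω s), mul_assoc _ _ (z k ω s), ← pow_succ (z k ω s)]
  simp only [mul_smul_comm, smul_mul_assoc, smul_smul, mul_assoc]

theorem u_mul_basis (i j l : ℕ) : u k ω s * basis k ω s ((i, j), l)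
    = basis k ω s ((i + 1, j), l) := by
  rw [basis_apply, monomial, (skewTriple k ω s).a_mul_monomial, basis_apply, monomial]

theorem basis_sandwich (i j L i' j' l : ℕ) :
    u k ω s ^ i * z k ω s ^ j * basis k ω s ((i', j'), l) * v k ω s ^ L
      = (ω⁻¹ ^ (k + 1) * s) ^ (j * i') • basis k ω s ((i + i', j + j'), l + L) := by
  have t := skewTriple k ω s
  simp only [basis_apply, monomial, skewMonomial]
  rw [show u k ω s ^ i * z k ω s ^ j * (u k ω s ^ i' * z k ω s ^ j' * v k ω s ^ l) * v k ω s ^ L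
    = u k ω s ^ i * (z k ω s ^ j * u k ω s ^ i') * z k ω s ^ j' * (v k ω s ^ l * v k ω s ^ L) by
      simp only [mul_assoc], pow_mul_pow_of_skew t.ca, pow_add (u k ω s), pow_add (z k ω s),
    pow_add (v k ω s)]
  simp only [mul_smul_comm, smul_mul_assoc, mul_assoc]

section Torus

variable (ω s)

/-- The shift of functions on `ℕ`. -/
def shiftEnd (𝕜 : Type*) [Field 𝕜] : Module.End 𝕜 (ℕ → 𝕜) := LinearMap.funLeft 𝕜 𝕜 Nat.succ

/-- Multiplication by the powers of `r` on functions on `ℕ`. -/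
def powEnd (r : 𝕜) : Module.End 𝕜 (ℕ → 𝕜) where
  toFun f m := r ^ m * f m
  map_add' f g := by funext m; exact mul_add _ _ _
  map_smul' c f := by funext m; exact mul_left_comm _ _ _

theorem skewTriple_shift : SkewTriple 1 (ω⁻¹ ^ (k + 1)) (ω⁻¹ ^ (k + 1) * s)
    (powEnd (ω⁻¹ ^ (k + 1))) (shiftEnd 𝕜) 0 where
  ca := by simp
  bc := by simp
  ba := by
    refine LinearMap.ext fun f => funext fun m => ?_
    simp only [pow_one, add_zero, Module.End.mul_apply, LinearMap.smul_apply, Pi.smul_apply]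
    change (ω⁻¹ ^ (k + 1)) ^ (m + 1) * f (m + 1)
      = ω⁻¹ ^ (k + 1) * ((ω⁻¹ ^ (k + 1)) ^ m * f (m + 1))
    ring

/-- The representation on functions on `ℕ` which factors through the quantum plane `A / (z)`. -/
noncomputable def shiftHom : TaftDownUp k ω s →ₐ[𝕜] Module.End 𝕜 (ℕ → 𝕜) :=
  lift (skewTriple_shift k ω s)

theorem shiftHom_mul_ne_zero (N M : ℕ) :
    shiftHom k ω s (u k ω s ^ N * v k ω s ^ M) ≠ 0 := by
  intro h
  have h1 := congrFun (LinearMap.congr_fun h (fun _ => 1)) 0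
  have hV : ∀ M : ℕ, (shiftEnd 𝕜 ^ M) (fun _ => 1) = fun _ => 1 := by
    intro M
    induction M with
    | zero => rfl
    | succ M ih => rw [pow_succ, Module.End.mul_apply]; exact ih
  have hU : ∀ (N : ℕ) (f : ℕ → 𝕜), (powEnd (ω⁻¹ ^ (k + 1)) ^ N) f 0 = f 0 := by
    intro N
    induction N with
    | zero => intro f; rfl
    | succ N ih =>
      intro f
      rw [pow_succ, Module.End.mul_apply, ih]
      exact (congrArg (· * f 0) (pow_zero _)).trans (one_mul _)
  rw [map_mul, map_pow, map_pow, shiftHom, lift_u, lift_v, Module.End.mul_apply, hU, hV] at h1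
  exact one_ne_zero h1

variable {ω s}

theorem shiftHom_of_isBihomogeneous [CharZero 𝕜] {N M : ℕ} {y : TaftDownUp k ω s}
    (h : IsBihomogeneous k N M y) : shiftHom k ω s y
      = (basis k ω s).repr y ((N, 0), M) • shiftHom k ω s (u k ω s ^ N * v k ω s ^ M) := by
  have hy := h.mem_span
  clear h
  induction hy using Submodule.span_induction with
  | mem y hy =>
    obtain ⟨⟨⟨i, j⟩, l⟩, ⟨h1, h2⟩, rfl⟩ := hy
    dsimp only at h1 h2
    rw [Module.Basis.repr_self]
    rcases j with _ | j
    · obtain rfl : i = N := by omega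
      obtain rfl : l = M := by omega
      simp [basis_apply, monomial, skewMonomial]
    · have hz : shiftHom k ω s (z k ω s) = 0 := lift_z (skewTriple_shift k ω s)
      rw [basis_apply, monomial, skewMonomial, map_mul, map_mul, map_pow _ (z k ω s), hz]
      simp
  | zero => simp
  | add x y _ _ hx hy => rw [map_add, map_add, Finsupp.add_apply, add_smul, hx, hy]
  | smul r x _ hx => rw [map_smul, map_smul, Finsupp.smul_apply, smul_assoc, hx]

end Torus

section Relations

variable [CharZero 𝕜] {n : ℕ} (hn : 2 ≤ n) (hω : IsPrimitiveRoot ω n) (hs : s ^ 2 = ω)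

omit [CharZero 𝕜] in
theorem xAct_mul_eq_zero (h0 : ω ≠ 0) {y y' : TaftDownUp k ω s} (h : xAct k h0 hs y = 0)
    (h' : xAct k h0 hs y' = 0) : xAct k h0 hs (y * y') = 0 := by
  rw [xAct_mul, h, h', mul_zero, zero_mul, add_zero]

theorem z_mul_aElt (hprim : IsPrimitiveRoot s (2 * n)) : z k ω s * aElt n k hn hω hs
    = (ω ^ k * s) • (aElt n k hn hω hs * z k ω s) := by
  have h0 : ω ≠ 0 := hω.ne_zero (by omega)
  have hs0 : s ≠ 0 := hprim.ne_zero (by omega)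
  have hr : ω⁻¹ ^ (k + 1) * s ≠ 0 := mul_ne_zero (pow_ne_zero _ (inv_ne_zero h0)) hs0
  have hq : ω⁻¹ ^ (k + 1) * s * (ω ^ k * s) = 1 := by
    rw [inv_pow, pow_succ, mul_mul_mul_comm, ← pow_two, hs]
    field_simp
  have h := (isBihomogeneous_aElt k hn hω hs).z_mul
  obtain ⟨n, rfl⟩ : ∃ m, n = m + 1 := ⟨n - 1, by omega⟩
  refine smul_right_injective _ (pow_ne_zero (n + 1) hr) ?_
  dsimp only
  rw [h, Nat.add_sub_cancel, smul_smul, pow_succ (ω⁻¹ ^ (k + 1) * s) n, mul_assoc, hq, mul_one]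

/-- Among the coordinates determining an invariant, only the ones at `z ^ n` and `u ^ n v ^ n`
have the right bidegree, and the latter cancels. -/
theorem aElt_mul_u (hprim : IsPrimitiveRoot s (2 * n)) :
    aElt n k hn hω hs * u k ω s = u k ω s * aElt n k hn hω hs
      + (basis k ω s).repr (aElt n k hn hω hs) ((0, n - 1), 1) • z k ω s ^ n := by
  have h0 : ω ≠ 0 := hω.ne_zero (by omega)
  have hu := xAct_u k h0 hs
  have hz := xAct_z k h0 hs
  have ha := xAct_aElt k hn hω hs
  have hba := isBihomogeneous_aElt k hn hω hs
  have hbu : IsBihomogeneous k 1 0 (u k ω s) := by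
    simpa [basis_apply, monomial, skewMonomial]
      using IsBihomogeneous.basis (k := k) (ω := ω) (s := s) 1 0 0
  have hzn : z k ω s ^ n = basis k ω s ((0, n), 0) := by
    simp [basis_apply, monomial, skewMonomial]
  have hbz : IsBihomogeneous k n n (z k ω s ^ n) := by
    have := IsBihomogeneous.basis (k := k) (ω := ω) (s := s) 0 n 0
    rwa [zero_add, add_zero, ← hzn] at this
  have hb1 : IsBihomogeneous k n n (aElt n k hn hω hs * u k ω s) := by
    have := hba.mul hbu
    rwa [add_zero, show n - 1 + 1 = n by omega] at this
  have hb2 : IsBihomogeneous k n n (u k ω s * aElt n k hn hω hs) := by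
    have := hbu.mul hba
    rwa [zero_add, show 1 + (n - 1) = n by omega] at this
  set y := aElt n k hn hω hs with hy
  have hmulz : (basis k ω s).repr (y * u k ω s) ((0, n), 0)
      = (basis k ω s).repr y ((0, n - 1), 1) := by
    have h := (basis k ω s).repr_apply_of_support (LinearMap.mulRight 𝕜 (u k ω s))
      ((Finsupp.lapply ((0, n), 0)) ∘ₗ (basis k ω s).repr.toLinearMap) (y := y) ((0, n - 1), 1) ?_
    · simp only [LinearMap.comp_apply, LinearMap.mulRight_apply, LinearEquiv.coe_coe,
        Finsupp.lapply_apply, mul_u_basis, map_add, map_smul, Module.Basis.repr_self,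
        Finsupp.single_apply] at h
      rw [h]
      simp [skewCoeff, show n - 1 + 1 = n by omega]
    · rintro ⟨⟨i, j⟩, l⟩ hj hne
      have hd := hba.eq_of_repr_ne_zero hj
      dsimp only at hd
      simp only [LinearMap.comp_apply, LinearMap.mulRight_apply, LinearEquiv.coe_coe,
        Finsupp.lapply_apply, mul_u_basis, map_add, map_smul, Module.Basis.repr_self,
        Finsupp.single_apply, Prod.mk.injEq]
      rw [if_neg (by omega), if_neg, smul_zero, smul_zero, add_zero]
      rintro ⟨⟨rfl, hj'⟩, hl⟩
      exact hne (by rw [show j = n - 1 by omega, show l = 1 by omega])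
  have hmulu : (basis k ω s).repr (y * u k ω s) ((n, 0), n)
      = (basis k ω s).repr y ((n - 1, 0), n) := by
    have h := (basis k ω s).repr_apply_of_support (LinearMap.mulRight 𝕜 (u k ω s))
      ((Finsupp.lapply ((n, 0), n)) ∘ₗ (basis k ω s).repr.toLinearMap) (y := y) ((n - 1, 0), n) ?_
    · simp only [LinearMap.comp_apply, LinearMap.mulRight_apply, LinearEquiv.coe_coe,
        Finsupp.lapply_apply, mul_u_basis, map_add, map_smul, Module.Basis.repr_self,
        Finsupp.single_apply] at h
      have h1 : (ω⁻¹ ^ (k + 1)) ^ n = 1 := by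
        rw [← pow_mul, mul_comm, pow_mul, inv_pow, hω.pow_eq_one, inv_one, one_pow]
      rw [h, h1]
      simp [show n - 1 + 1 = n by omega]
    · rintro ⟨⟨i, j⟩, l⟩ hj hne
      have hd := hba.eq_of_repr_ne_zero hj
      dsimp only at hd
      simp only [LinearMap.comp_apply, LinearMap.mulRight_apply, LinearEquiv.coe_coe,
        Finsupp.lapply_apply, mul_u_basis, map_add, map_smul, Module.Basis.repr_self,
        Finsupp.single_apply, Prod.mk.injEq]
      rw [if_neg, if_neg (by omega), smul_zero, smul_zero, add_zero]
      rintro ⟨⟨hi, rfl⟩, hl⟩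
      exact hne (by rw [show i = n - 1 by omega, hl])
  have hleftz : (basis k ω s).repr (u k ω s * y) ((0, n), 0) = 0 := by
    refine (basis k ω s).repr_map_apply_eq_zero (LinearMap.mulLeft 𝕜 (u k ω s))
      (fun m => ((m.1.1 + 1, m.1.2), m.2)) (fun _ => 1) ?_ _ ?_ y
    · rintro ⟨⟨i, j⟩, l⟩
      rw [LinearMap.mulLeft_apply, u_mul_basis, one_smul]
    · rintro ⟨⟨i, j⟩, l⟩ h
      simp at h
  have hleftu : (basis k ω s).repr (u k ω s * y) ((n, 0), n)
      = (basis k ω s).repr y ((n - 1, 0), n) := by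
    have h := (basis k ω s).repr_of_map (LinearMap.mulLeft 𝕜 (u k ω s))
      (fun m => ((m.1.1 + 1, m.1.2), m.2)) ?_ (fun _ => 1) ?_ y ((n - 1, 0), n)
    · rw [one_mul] at h
      rw [← h, LinearMap.mulLeft_apply, show n - 1 + 1 = n by omega]
    · rintro ⟨⟨i, j⟩, l⟩ ⟨⟨i', j'⟩, l'⟩ h
      simpa using h
    · rintro ⟨⟨i, j⟩, l⟩
      rw [LinearMap.mulLeft_apply, u_mul_basis, one_smul]
  rw [← sub_eq_iff_eq_add', ← sub_eq_zero]
  have hb := (hb1.sub hb2).sub (hbz.smul ((basis k ω s).repr y ((0, n - 1), 1)))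
  refine eq_zero_of_xAct_eq_zero k h0 hs hn hprim ?_ (fun i j m => ?_) (fun i j m => ?_)
  · rw [map_sub, map_sub, map_smul, xAct_mul_eq_zero k hs h0 ha hu, xAct_mul_eq_zero k hs h0 hu ha,
      xAct_pow_eq_zero k h0 hs hz, smul_zero, sub_zero, sub_zero]
  · by_contra hne
    have hd := hb.eq_of_repr_ne_zero hne
    dsimp only at hd
    obtain rfl : m = 0 := by
      rcases m with _ | m
      · rfl
      · rw [mul_add] at hd
        omega
    obtain rfl : i = 0 := by omega
    obtain rfl : j = n := by omega
    refine hne ?_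
    rw [mul_zero, map_sub, map_sub, map_smul, Finsupp.sub_apply, Finsupp.sub_apply,
      Finsupp.smul_apply, hmulz, hleftz, hzn, Module.Basis.repr_self, Finsupp.single_eq_same]
    simp
  · by_contra hne
    have hd := hb.eq_of_repr_ne_zero hne
    dsimp only at hd
    obtain rfl : m = 0 := by
      rcases m with _ | m
      · rfl
      · rw [mul_add] at hd
        omega
    obtain rfl : i = 1 := by omega
    obtain rfl : j = 0 := by omega
    refine hne ?_
    rw [mul_zero, zero_add, show 1 + (n - 1) = n by omega, map_sub, map_sub, map_smul,
      Finsupp.sub_apply, Finsupp.sub_apply, Finsupp.smul_apply, hmulu, hleftu, hzn,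
      Module.Basis.repr_self, Finsupp.single_eq_of_ne, smul_zero, sub_self, sub_self]
    simp only [ne_eq, Prod.mk.injEq]
    omega

/-- The only coordinate determining an invariant which has the bidegree of the square of
`x ^ (n - 1) · v ^ (2n - 1)` is the one at `u ^ (2n - 2) v ^ (2n)`; it can be computed in the
quantum plane `A / (z)`, a domain. -/
theorem exists_aElt_sq (hprim : IsPrimitiveRoot s (2 * n)) : ∃ κ : 𝕜, κ ≠ 0 ∧
    aElt n k hn hω hs ^ 2 = κ • (u k ω s ^ (2 * (n - 1)) * v k ω s ^ (2 * n)) := by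
  have h0 : ω ≠ 0 := hω.ne_zero (by omega)
  have hu := xAct_u k h0 hs
  have ha := xAct_aElt k hn hω hs
  have hba := isBihomogeneous_aElt k hn hω hs
  have hla := repr_aElt_u_ne_zero k hn hω hs hprim
  set y := aElt n k hn hω hs with hy
  have hb1 : IsBihomogeneous k (2 * (n - 1)) (2 * n) (y ^ 2) := by
    rw [pow_two, two_mul, two_mul]
    exact hba.mul hba
  have huv : u k ω s ^ (2 * (n - 1)) * v k ω s ^ (2 * n)
      = basis k ω s ((2 * (n - 1), 0), 2 * n) := by
    simp [basis_apply, monomial, skewMonomial]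
  have hb2 : IsBihomogeneous k (2 * (n - 1)) (2 * n)
      (u k ω s ^ (2 * (n - 1)) * v k ω s ^ (2 * n)) := by
    have := IsBihomogeneous.basis (k := k) (ω := ω) (s := s) (2 * (n - 1)) 0 (2 * n)
    rwa [zero_add, add_zero, ← huv] at this
  have hmain : y ^ 2 = (basis k ω s).repr (y ^ 2) ((2 * (n - 1), 0), 2 * n) •
      (u k ω s ^ (2 * (n - 1)) * v k ω s ^ (2 * n)) := by
    rw [← sub_eq_zero]
    have hb := hb1.sub (hb2.smul ((basis k ω s).repr (y ^ 2) ((2 * (n - 1), 0), 2 * n)))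
    refine eq_zero_of_xAct_eq_zero k h0 hs hn hprim ?_ (fun i j m => ?_) (fun i j m => ?_)
    · rw [map_sub, map_smul, xAct_pow_eq_zero k h0 hs ha, xAct_mul_eq_zero k hs h0
        (xAct_pow_eq_zero k h0 hs hu _) (xAct_v_pow_two_mul k hn h0 hs hprim), smul_zero, sub_zero]
    · by_contra hne
      have hd := hb.eq_of_repr_ne_zero hne
      dsimp only at hd
      obtain rfl : m = 1 := by
        rcases m with _ | _ | m
        · omega
        · rfl
        · rw [mul_add, mul_add] at hd
          omega
      obtain rfl : i = 2 * (n - 1) := by omega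
      obtain rfl : j = 0 := by omega
      refine hne ?_
      rw [mul_one, map_sub, map_smul, Finsupp.sub_apply, Finsupp.smul_apply, huv,
        Module.Basis.repr_self, Finsupp.single_eq_same, smul_eq_mul, mul_one, sub_self]
    · by_contra hne
      have hd := hb.eq_of_repr_ne_zero hne
      dsimp only at hd
      rcases m with _ | m
      · omega
      · rw [mul_add] at hd
        omega
  refine ⟨_, fun hκ => ?_, hmain⟩
  rw [hκ, zero_smul] at hmain
  have h1 := congrArg (shiftHom k ω s) hmain
  have hU : shiftHom k ω s (u k ω s) = powEnd (ω⁻¹ ^ (k + 1)) := lift_u (skewTriple_shift k ω s)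
  have hV : shiftHom k ω s (v k ω s) = shiftEnd 𝕜 := lift_v (skewTriple_shift k ω s)
  have hVU : shiftEnd 𝕜 * powEnd (ω⁻¹ ^ (k + 1))
      = ω⁻¹ ^ (k + 1) • (powEnd (ω⁻¹ ^ (k + 1)) * shiftEnd 𝕜) := by
    have := (skewTriple_shift k ω s).ba
    rwa [pow_one, add_zero] at this
  have h3 : shiftHom k ω s (u k ω s ^ (n - 1) * v k ω s ^ n) ^ 2
      = (ω⁻¹ ^ (k + 1)) ^ (n * (n - 1)) •
        shiftHom k ω s (u k ω s ^ (2 * (n - 1)) * v k ω s ^ (2 * n)) := by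
    simp only [map_mul, map_pow, hU, hV]
    rw [pow_two, mul_assoc, ← mul_assoc (shiftEnd 𝕜 ^ n), pow_mul_pow_of_skew hVU, smul_mul_assoc,
      mul_smul_comm, two_mul, two_mul,
      pow_add (powEnd (ω⁻¹ ^ (k + 1))), pow_add (shiftEnd 𝕜)]
    simp only [mul_assoc]
  rw [map_pow, map_zero, shiftHom_of_isBihomogeneous k hba, smul_pow, h3, smul_smul,
    smul_eq_zero, mul_eq_zero] at h1
  rcases h1 with (h1 | h1) | h1
  · exact hla (pow_eq_zero_iff two_ne_zero |>.mp h1)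
  · exact pow_ne_zero _ (pow_ne_zero _ (inv_ne_zero h0)) h1
  · exact shiftHom_mul_ne_zero k ω s _ _ h1

end Relations

end TaftDownUp

/-! ### The algebra on four generators with seven relations -/

theorem Module.Basis.linearIndependent_of_coord {K M ι κ : Type*} [Field K] [AddCommGroup M]
    [Module K M] (B : Module.Basis ι K M) (E : κ → M) (pos : κ → ι) (w : κ → K)
    (hw : ∀ i, w i ≠ 0) (hdiag : ∀ i, B.repr (E i) (pos i) = w i)
    (hoff : ∀ i j, i ≠ j → B.repr (E i) (pos j) = 0) : LinearIndependent K E := by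
  rw [linearIndependent_iff']
  intro S g hg i hi
  have h := congrArg (fun y => B.repr y (pos i)) hg
  simp only [map_sum, map_smul, Finsupp.coe_finsetSum, Finset.sum_apply, Finsupp.smul_apply,
    map_zero, Finsupp.zero_apply] at h
  rw [Finset.sum_eq_single i (fun j _ hj => by rw [hoff j i hj, smul_zero])
    (fun h => absurd hi h), hdiag, smul_eq_mul] at h
  exact (mul_eq_zero.mp h).resolve_right (hw i)

/-- If the coordinates of the vectors `E i` at the positions `pos j` form an invertible diagonal
matrix, and the coordinates at these positions determine the elements of the subspace `P`, then
the vectors `E i` span `P`. -/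
theorem Module.Basis.le_span_of_coord {K M ι κ : Type*} [Field K] [AddCommGroup M]
    [Module K M] (B : Module.Basis ι K M) (P : Submodule K M) (E : κ → M) (hE : ∀ i, E i ∈ P)
    (pos : κ → ι) (w : κ → K) (hw : ∀ i, w i ≠ 0) (hdiag : ∀ i, B.repr (E i) (pos i) = w i)
    (hoff : ∀ i j, i ≠ j → B.repr (E i) (pos j) = 0)
    (key : ∀ y ∈ P, (∀ i, B.repr y (pos i) = 0) → y = 0) : P ≤ Submodule.span K (Set.range E) := by
  classical
  intro y hy
  have hpos : Function.Injective pos := fun i j hij => by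
    by_contra h
    exact hw i (by rw [← hdiag i, hij, hoff i j h])
  let S := (B.repr y).support.preimage pos hpos.injOn
  have h : y - ∑ i ∈ S, (B.repr y (pos i) / w i) • E i = 0 := by
    refine key _ (sub_mem hy (sum_mem fun i _ => P.smul_mem _ (hE i))) fun j => ?_
    simp only [map_sub, map_sum, map_smul, Finsupp.sub_apply, Finsupp.coe_finsetSum,
      Finset.sum_apply, Finsupp.smul_apply]
    rw [Finset.sum_eq_single j (fun i _ hi => by rw [hoff i j hi, smul_zero]), hdiag, smul_eq_mul,
      div_mul_cancel₀ _ (hw j), sub_self]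
    intro hj
    rw [Finset.mem_preimage, Finsupp.notMem_support_iff] at hj
    rw [hj, zero_div, zero_smul]
  rw [sub_eq_zero] at h
  rw [h]
  exact sum_mem fun i _ => Submodule.smul_mem _ _ (Submodule.subset_span ⟨i, rfl⟩)

theorem LinearMap.injective_of_linearIndependent_comp {K M N κ : Type*} [CommRing K]
    [AddCommGroup M] [Module K M] [AddCommGroup N] [Module K N] (f : M →ₗ[K] N) (m : κ → M)
    (hm : ⊤ ≤ Submodule.span K (Set.range m)) (h : LinearIndependent K (f ∘ m)) :
    Function.Injective f := by
  rw [injective_iff_map_eq_zero]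
  intro x hx
  have hx' : x ∈ Submodule.span K (Set.range m) := hm trivial
  rw [Finsupp.mem_span_range_iff_exists_finsupp] at hx'
  obtain ⟨c, rfl⟩ := hx'
  rw [linearIndependent_iff] at h
  rw [h c, Finsupp.sum_zero_index]
  rw [Finsupp.linearCombination_apply, ← hx, map_finsuppSum]
  simp

namespace FactorAlg

variable {𝕜 : Type u} [Field 𝕜] (n : ℕ) (q : 𝕜)

theorem a_mul_d : gen n q .a * gen n q .d = gen n q .d * gen n q .a := by
  simpa [gen] using RingQuot.mkAlgHom_rel 𝕜 (FactorRel.ore (OreRel.ad (n := n) (q := q)))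

theorem b_mul_d : gen n q .b * gen n q .d = gen n q .d * gen n q .b := by
  simpa [gen] using RingQuot.mkAlgHom_rel 𝕜 (FactorRel.ore (OreRel.bd (n := n) (q := q)))

theorem c_mul_d : gen n q .c * gen n q .d = gen n q .d * gen n q .c := by
  simpa [gen] using RingQuot.mkAlgHom_rel 𝕜 (FactorRel.ore (OreRel.cd (n := n) (q := q)))

theorem skewTriple : SkewTriple n 1 q (gen n q .a) (gen n q .b) (gen n q .c) where
  ca := by simpa [gen] using RingQuot.mkAlgHom_rel 𝕜 (FactorRel.ore (OreRel.ca (n := n) (q := q)))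
  bc := by simpa [gen] using RingQuot.mkAlgHom_rel 𝕜 (FactorRel.ore (OreRel.bc (n := n) (q := q)))
  ba := by simpa [gen] using RingQuot.mkAlgHom_rel 𝕜 (FactorRel.ore (OreRel.ba (n := n) (q := q)))

theorem a_sq : gen n q .a ^ 2 = gen n q .b ^ (2 * (n - 1)) * gen n q .d := by
  simpa [gen] using RingQuot.mkAlgHom_rel 𝕜 (FactorRel.aa (n := n) (q := q))

variable {n q} {B : Type*} [Ring B] [Algebra 𝕜 B]

/-- The algebra map from `FactorAlg n q` given by four elements satisfying the relations. -/
noncomputable def lift {a b c d : B} (h : SkewTriple n 1 q a b c) (ad : a * d = d * a)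
    (bd : b * d = d * b) (cd : c * d = d * c) (aa : a ^ 2 = b ^ (2 * (n - 1)) * d) :
    FactorAlg n q →ₐ[𝕜] B :=
  RingQuot.liftAlgHom 𝕜 ⟨FreeAlgebra.lift 𝕜 (OreAlg.fourElements a b c d), by
    intro x y hxy
    rcases hxy with hxy | _
    · cases hxy <;> simp only [map_mul, map_add, map_pow, map_smul, FreeAlgebra.lift_ι_apply,
        OreAlg.fourElements, ad, bd, cd, h.ca, h.bc, h.ba, one_smul]
    · simp only [map_mul, map_pow, FreeAlgebra.lift_ι_apply, OreAlg.fourElements, aa]⟩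

theorem lift_gen {a b c d : B} (h : SkewTriple n 1 q a b c) (ad : a * d = d * a)
    (bd : b * d = d * b) (cd : c * d = d * c) (aa : a ^ 2 = b ^ (2 * (n - 1)) * d) (i : FourGen) :
    lift h ad bd cd aa (gen n q i) = OreAlg.fourElements a b c d i := by
  rw [lift, gen, RingQuot.liftAlgHom_mkAlgHom_apply, FreeAlgebra.lift_ι_apply]

theorem adjoin_gen : Algebra.adjoin 𝕜 {gen n q .a, gen n q .c, gen n q .b, gen n q .d} = ⊤ := by
  rw [eq_top_iff]
  rintro x -
  obtain ⟨x, rfl⟩ := RingQuot.mkAlgHom_surjective 𝕜 (FactorRel n q) x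
  induction x using FreeAlgebra.induction with
  | grade0 r => rw [AlgHom.commutes]; exact Subalgebra.algebraMap_mem _ r
  | grade1 i => exact Algebra.subset_adjoin (by cases i <;> simp [gen])
  | mul x y hx hy => rw [map_mul]; exact mul_mem hx hy
  | add x y hx hy => rw [map_add]; exact add_mem hx hy

theorem commute_d (x : FactorAlg n q) : Commute (gen n q .d) x := by
  have hx : x ∈ Algebra.adjoin 𝕜 {gen n q .a, gen n q .c, gen n q .b, gen n q .d} := by
    rw [adjoin_gen]
    trivial
  induction hx using Algebra.adjoin_induction with
  | mem x hx =>
    rcases hx with rfl | rfl | rfl | rfl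
    · exact (a_mul_d n q).symm
    · exact (c_mul_d n q).symm
    · exact (b_mul_d n q).symm
    · exact Commute.refl _
  | algebraMap r => exact (Algebra.commutes r _).symm
  | add x y _ _ hx hy => exact hx.add_right hy
  | mul x y _ _ hx hy => exact hx.mul_right hy

/-- With `b` and `a` exchanged, the generators form a skew triple again, since `q ^ n = -1`. -/
theorem skewTriple_swap (hq : q ^ n = -1) (hq0 : q ≠ 0) :
    SkewTriple n 1 q⁻¹ (gen n q .b) (gen n q .a) (q • gen n q .c) := by
  have t := skewTriple n q
  constructor
  · rw [smul_mul_assoc, mul_smul_comm, t.bc, smul_smul, smul_smul, inv_mul_cancel₀ hq0, one_mul]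
  · rw [smul_mul_assoc, mul_smul_comm, t.ca, smul_smul, inv_mul_cancel₀ hq0, one_smul]
  · rw [smul_pow, hq, t.ba]
    match_scalars <;> ring

/-- The monomials `b ^ i (q c) ^ j a ^ ε d ^ m` with `ε ≤ 1`. -/
noncomputable def monomial (n : ℕ) (q : 𝕜) (m : ((ℕ × ℕ) × Fin 2) × ℕ) : FactorAlg n q :=
  skewMonomial (gen n q .b) (gen n q .a) (q • gen n q .c) (m.1.1, (m.1.2 : ℕ)) * gen n q .d ^ m.2

theorem span_monomial (hq : q ^ n = -1) (hq0 : q ≠ 0) :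
    ⊤ ≤ Submodule.span 𝕜 (Set.range (monomial n q)) := by
  have t := skewTriple_swap hq hq0
  have hmem : ∀ m, monomial n q m ∈ Submodule.span 𝕜 (Set.range (monomial n q)) :=
    fun m => Submodule.subset_span ⟨m, rfl⟩
  have hb : ∀ w ∈ Submodule.span 𝕜 (Set.range (monomial n q)),
      gen n q .b * w ∈ Submodule.span 𝕜 (Set.range (monomial n q)) := by
    refine mul_mem_span_range ?_
    rintro ⟨⟨⟨i, j⟩, ε⟩, m⟩
    rw [monomial, ← mul_assoc, t.a_mul_monomial]
    exact hmem (((i + 1, j), ε), m)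
  have hd : ∀ w ∈ Submodule.span 𝕜 (Set.range (monomial n q)),
      gen n q .d * w ∈ Submodule.span 𝕜 (Set.range (monomial n q)) := by
    refine mul_mem_span_range ?_
    rintro ⟨⟨⟨i, j⟩, ε⟩, m⟩
    rw [(commute_d _).eq, monomial, mul_assoc, ← pow_succ]
    exact hmem (((i, j), ε), m + 1)
  have hc : ∀ w ∈ Submodule.span 𝕜 (Set.range (monomial n q)),
      gen n q .c * w ∈ Submodule.span 𝕜 (Set.range (monomial n q)) := by
    refine mul_mem_span_range ?_
    rintro ⟨⟨⟨i, j⟩, ε⟩, m⟩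
    have h1 : gen n q .c = q⁻¹ • (q • gen n q .c) := by
      rw [smul_smul, inv_mul_cancel₀ hq0, one_smul]
    rw [h1, smul_mul_assoc, monomial, ← mul_assoc, t.c_mul_monomial, smul_mul_assoc]
    exact Submodule.smul_mem _ _ (Submodule.smul_mem _ _ (hmem (((i, j + 1), ε), m)))
  have ha : ∀ w ∈ Submodule.span 𝕜 (Set.range (monomial n q)),
      gen n q .a * w ∈ Submodule.span 𝕜 (Set.range (monomial n q)) := by
    refine mul_mem_span_range ?_
    rintro ⟨⟨⟨i, j⟩, ε⟩, m⟩
    rw [monomial, ← mul_assoc, t.b_mul_monomial, add_mul, smul_mul_assoc, smul_mul_assoc]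
    refine add_mem (Submodule.smul_mem _ _ ?_)
      (Submodule.smul_mem _ _ (hmem (((i - 1, j + n), ε), m)))
    fin_cases ε
    · exact hmem (((i, j), 1), m)
    -- a second factor `a` is removed by the last relation
    · have h2 : gen n q .b ^ i * (q • gen n q .c) ^ j * gen n q .a ^ 2 * gen n q .d ^ m
          = (q⁻¹ ^ (j * (2 * (n - 1)))) • monomial n q (((i + 2 * (n - 1), j), 0), m + 1) := by
        rw [a_sq, monomial, skewMonomial]
        dsimp only [Fin.val_zero]
        rw [show ∀ x y z w : FactorAlg n q, gen n q .b ^ i * x * (y * z) * w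
          = gen n q .b ^ i * (x * y) * (z * w) by intros; simp only [mul_assoc],
          pow_mul_pow_of_skew t.ca, ← pow_succ', pow_zero, mul_one, mul_smul_comm, smul_mul_assoc,
          ← mul_assoc (gen n q .b ^ i), ← pow_add]
      exact h2 ▸ Submodule.smul_mem _ _ (hmem _)
  have h := adjoin_le_of_mul_mem {gen n q .a, gen n q .c, gen n q .b, gen n q .d}
    (Submodule.span 𝕜 (Set.range (monomial n q)))
    (by simpa [monomial, skewMonomial] using hmem (((0, 0), 0), 0)) ?_
  · rwa [adjoin_gen, Algebra.top_toSubmodule] at h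
  · rintro g (rfl | rfl | rfl | rfl)
    exacts [ha, hc, hb, hd]

section Projection

variable (n q)

/-- The projection from the algebra with six relations. -/
noncomputable def ofOreAlg : OreAlg n q →ₐ[𝕜] FactorAlg n q :=
  OreAlg.lift (skewTriple n q) (a_mul_d n q) (b_mul_d n q) (c_mul_d n q)

theorem ofOreAlg_gen (i : FourGen) : ofOreAlg n q (OreAlg.gen n q i) = gen n q i := by
  rw [ofOreAlg, OreAlg.lift_gen]
  cases i <;> rfl

theorem ofOreAlg_surjective : Function.Surjective (ofOreAlg n q) := by
  rw [← AlgHom.range_eq_top, eq_top_iff, ← adjoin_gen, Algebra.adjoin_le_iff]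
  rintro _ (rfl | rfl | rfl | rfl) <;> exact ⟨_, ofOreAlg_gen n q _⟩

theorem ofOreAlg_f : ofOreAlg n q (OreAlg.f n q) = 0 := by
  rw [OreAlg.f, map_sub, map_mul, map_pow, map_pow, ofOreAlg_gen, ofOreAlg_gen, ofOreAlg_gen, a_sq,
    sub_self]

/-- The quotient by the ideal generated by `f` satisfies the seven relations. -/
theorem mem_span_f_of_ofOreAlg_eq_zero {x : OreAlg n q} (hx : ofOreAlg n q x = 0) :
    x ∈ TwoSidedIdeal.span {OreAlg.f n q} := by
  let I : TwoSidedIdeal (OreAlg n q) := TwoSidedIdeal.span {OreAlg.f n q}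
  let π : OreAlg n q →ₐ[𝕜] I.ringCon.Quotient := I.ringCon.mkₐ 𝕜
  have hπ : ∀ y, π y = 0 ↔ y ∈ I := fun y => I.ringCon.eq
  have t := OreAlg.skewTriple n q
  have tπ : SkewTriple n 1 q (π (OreAlg.gen n q .a)) (π (OreAlg.gen n q .b))
      (π (OreAlg.gen n q .c)) :=
    { ca := by rw [← map_mul, t.ca, map_smul, map_mul]
      bc := by rw [← map_mul, t.bc, map_smul, map_mul]
      ba := by rw [← map_mul, t.ba, map_add, map_smul, map_mul, map_pow] }
  let ψ : FactorAlg n q →ₐ[𝕜] I.ringCon.Quotient := lift tπ (d := π (OreAlg.gen n q .d))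
    (by rw [← map_mul, OreAlg.a_mul_d, map_mul]) (by rw [← map_mul, OreAlg.b_mul_d, map_mul])
    (by rw [← map_mul, OreAlg.c_mul_d, map_mul]) (by
      rw [← map_pow, ← map_pow, ← map_mul, ← sub_eq_zero, ← map_sub, hπ]
      exact TwoSidedIdeal.subset_span (Set.mem_singleton _))
  have h : ψ.comp (ofOreAlg n q) = π := OreAlg.algHom_ext fun i => by
    rw [AlgHom.comp_apply, ofOreAlg_gen, lift_gen]
    cases i <;> rfl
  rw [← hπ, ← h, AlgHom.comp_apply, hx, map_zero]

end Projection

end FactorAlg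

/-! ### The presentation of the invariants -/

namespace TaftDownUp

variable {𝕜 : Type u} [Field 𝕜] (n k : ℕ) {ω s : 𝕜} (hn : 2 ≤ n) (hω : IsPrimitiveRoot ω n)
  (hs : s ^ 2 = ω)

theorem mem_xInvariants {y : TaftDownUp k ω s} :
    y ∈ xInvariants n k hn hω hs ↔ xAct k (hω.ne_zero (by omega)) hs y = 0 := by
  rw [← taftAction_x n k hn hω hs]
  rfl

/-- The monomials `u ^ i z ^ j w ^ ε v ^ (2nm)` with `ε ≤ 1`, where `w = x ^ (n - 1) · v ^ (2n - 1)`.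
They are a basis of the invariants. -/
noncomputable def invMonomial (m : ((ℕ × ℕ) × Fin 2) × ℕ) : TaftDownUp k ω s :=
  u k ω s ^ m.1.1.1 * z k ω s ^ m.1.1.2 * aElt n k hn hω hs ^ (m.1.2 : ℕ)
    * v k ω s ^ (2 * n * m.2)

/-- The basis element of `A` that occurs in `invMonomial m` but in no other one. -/
def invPosition (m : ((ℕ × ℕ) × Fin 2) × ℕ) : (ℕ × ℕ) × ℕ :=
  ((m.1.1.1 + m.1.2 * (n - 1), m.1.1.2), 2 * n * m.2 + m.1.2 * n)

/-- The coordinate of `invMonomial m` at `invPosition m`. -/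
noncomputable def invCoeff (m : ((ℕ × ℕ) × Fin 2) × ℕ) : 𝕜 :=
  if m.1.2 = 0 then 1 else (basis k ω s).repr (aElt n k hn hω hs) ((n - 1, 0), n)
    * (ω⁻¹ ^ (k + 1) * s) ^ (m.1.1.2 * (n - 1))

theorem two_mul_mul_add_inj {n m m' e e' : ℕ} (he : e < 2 * n) (he' : e' < 2 * n)
    (h : 2 * n * m + e = 2 * n * m' + e') : m = m' ∧ e = e' := by
  have h1 : (2 * n * m + e) / (2 * n) = m := by
    rw [Nat.mul_add_div (by omega), Nat.div_eq_of_lt he, add_zero]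
  have h2 : (2 * n * m' + e') / (2 * n) = m' := by
    rw [Nat.mul_add_div (by omega), Nat.div_eq_of_lt he', add_zero]
  obtain rfl : m = m' := by rw [← h1, h, h2]
  exact ⟨rfl, Nat.add_left_cancel h⟩

/-- Modulo `2n`, the exponents of `v` in `w = x ^ (n - 1) · v ^ (2n - 1)` lie between `1` and `n`, and
the exponent `n` occurs only in `u ^ (n - 1) v ^ n`. -/
theorem repr_invMonomial [CharZero 𝕜] (m m' : ((ℕ × ℕ) × Fin 2) × ℕ) :
    (basis k ω s).repr (invMonomial n k hn hω hs m) (invPosition n m')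
      = if m = m' then invCoeff n k hn hω hs m else 0 := by
  obtain ⟨⟨⟨i, j⟩, ε⟩, m⟩ := m
  obtain ⟨⟨⟨i', j'⟩, ε'⟩, m'⟩ := m'
  have hε' : (ε' : ℕ) * n < 2 * n := by
    have := ε'.2
    exact Nat.mul_lt_mul_of_pos_right this (by omega)
  fin_cases ε
  · have h : invMonomial n k hn hω hs (((i, j), 0), m) = basis k ω s ((i, j), 2 * n * m) := by
      simp [invMonomial, basis_apply, monomial, skewMonomial]
    change (basis k ω s).repr (invMonomial n k hn hω hs (((i, j), 0), m)) _
      = if (((i, j), (0 : Fin 2)), m) = _ then invCoeff n k hn hω hs (((i, j), 0), m) else 0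
    rw [h, Module.Basis.repr_self, Finsupp.single_apply, invCoeff, if_pos rfl]
    refine if_congr ?_ rfl rfl
    simp only [invPosition, Prod.mk.injEq]
    constructor
    · rintro ⟨⟨h1, h2⟩, h3⟩
      obtain ⟨h4, h5⟩ := two_mul_mul_add_inj (e := 0) (by omega) hε' h3
      have h6 : (ε' : ℕ) = 0 := by
        rcases Nat.mul_eq_zero.mp h5.symm with h | h
        · exact h
        · omega
      rw [h6, zero_mul, add_zero] at h1
      exact ⟨⟨⟨h1, h2⟩, (Fin.ext h6).symm⟩, h4⟩
    · rintro ⟨⟨⟨rfl, rfl⟩, rfl⟩, rfl⟩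
      simp
  · have hba := isBihomogeneous_aElt k hn hω hs
    have h := (basis k ω s).repr_apply_of_support
      (LinearMap.mulRight 𝕜 (v k ω s ^ (2 * n * m)) ∘ₗ
        LinearMap.mulLeft 𝕜 (u k ω s ^ i * z k ω s ^ j))
      ((Finsupp.lapply (invPosition n (((i', j'), ε'), m'))) ∘ₗ (basis k ω s).repr.toLinearMap)
      (y := aElt n k hn hω hs) ((n - 1, 0), n) ?_
    · simp only [LinearMap.comp_apply, LinearMap.mulRight_apply, LinearMap.mulLeft_apply,
        LinearEquiv.coe_coe, Finsupp.lapply_apply, basis_sandwich, map_smul,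
        Module.Basis.repr_self, Finsupp.single_apply] at h
      change (basis k ω s).repr (invMonomial n k hn hω hs (((i, j), 1), m)) _
        = if (((i, j), (1 : Fin 2)), m) = _ then invCoeff n k hn hω hs (((i, j), 1), m) else 0
      rw [invMonomial, Fin.val_one, pow_one, h, smul_eq_mul, mul_ite, mul_one, mul_zero, mul_ite,
        mul_zero]
      refine if_congr ?_ (by simp [invCoeff]) rfl
      simp only [invPosition, Prod.mk.injEq]
      constructor
      · rintro ⟨⟨h1, h2⟩, h3⟩
        rw [add_comm] at h3
        obtain ⟨h4, h5⟩ := two_mul_mul_add_inj (by omega) hε' h3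
        have h6 : (ε' : ℕ) = 1 := (Nat.mul_eq_right (by omega)).mp h5.symm
        rw [h6, one_mul] at h1
        exact ⟨⟨⟨by omega, by omega⟩, (Fin.ext h6).symm⟩, h4⟩
      · rintro ⟨⟨⟨rfl, rfl⟩, rfl⟩, rfl⟩
        simp [add_comm]
    · rintro ⟨⟨i₁, j₁⟩, l⟩ hj hne
      have hd := hba.eq_of_repr_ne_zero hj
      dsimp only at hd
      simp only [LinearMap.comp_apply, LinearMap.mulRight_apply, LinearMap.mulLeft_apply,
        LinearEquiv.coe_coe, Finsupp.lapply_apply, basis_sandwich, map_smul,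
        Module.Basis.repr_self, Finsupp.single_apply]
      rw [if_neg, smul_zero]
      simp only [invPosition, Prod.mk.injEq]
      rintro ⟨⟨h1, h2⟩, h3⟩
      rw [add_comm] at h3
      obtain ⟨h4, h5⟩ := two_mul_mul_add_inj (by omega) hε' h3
      have h6 : l = n := by
        have := ε'.2
        interval_cases h7 : (ε' : ℕ)
        · omega
        · omega
      refine hne ?_
      rw [show i₁ = n - 1 by omega, show j₁ = 0 by omega, h6]

theorem invCoeff_ne_zero (hprim : IsPrimitiveRoot s (2 * n)) (m : ((ℕ × ℕ) × Fin 2) × ℕ) :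
    invCoeff n k hn hω hs m ≠ 0 := by
  rw [invCoeff]
  split_ifs
  · exact one_ne_zero
  · exact mul_ne_zero (repr_aElt_u_ne_zero k hn hω hs hprim) (pow_ne_zero _ (mul_ne_zero
      (pow_ne_zero _ (inv_ne_zero (hω.ne_zero (by omega)))) (hprim.ne_zero (by omega))))

section Basis

variable [CharZero 𝕜] (hprim : IsPrimitiveRoot s (2 * n))

include hprim

omit [CharZero 𝕜] in
theorem invariant_gen : u k ω s ∈ xInvariants n k hn hω hs ∧ z k ω s ∈ xInvariants n k hn hω hs ∧
    v k ω s ^ (2 * n) ∈ xInvariants n k hn hω hs ∧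
    aElt n k hn hω hs ∈ xInvariants n k hn hω hs := by
  simp only [mem_xInvariants]
  exact ⟨xAct_u k _ hs, xAct_z k _ hs, xAct_v_pow_two_mul k hn _ hs hprim, xAct_aElt k hn hω hs⟩

theorem linearIndependent_invMonomial : LinearIndependent 𝕜 (invMonomial n k hn hω hs) :=
  (basis k ω s).linearIndependent_of_coord _ (invPosition n) (invCoeff n k hn hω hs)
    (invCoeff_ne_zero n k hn hω hs hprim) (fun m => by rw [repr_invMonomial, if_pos rfl])
    (fun m m' h => by rw [repr_invMonomial, if_neg h])

theorem xInvariants_le_span : Subalgebra.toSubmodule (xInvariants n k hn hω hs)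
    ≤ Submodule.span 𝕜 (Set.range (invMonomial n k hn hω hs)) := by
  obtain ⟨hu, hz, hv, ha⟩ := invariant_gen n k hn hω hs hprim
  refine (basis k ω s).le_span_of_coord _ _ ?_ (invPosition n) (invCoeff n k hn hω hs)
    (invCoeff_ne_zero n k hn hω hs hprim) (fun m => by rw [repr_invMonomial, if_pos rfl])
    (fun m m' h => by rw [repr_invMonomial, if_neg h]) ?_
  · intro m
    rw [invMonomial, pow_mul _ (2 * n), Subalgebra.mem_toSubmodule]
    exact mul_mem (mul_mem (mul_mem (pow_mem hu _) (pow_mem hz _)) (pow_mem ha _)) (pow_mem hv _)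
  · intro y hy h
    refine eq_zero_of_xAct_eq_zero k _ hs hn hprim ((mem_xInvariants n k hn hω hs).mp hy)
      (fun i j m => ?_) (fun i j m => ?_)
    · simpa [invPosition] using h (((i, j), 0), m)
    · simpa [invPosition] using h (((i, j), 1), m)

theorem xInvariants_eq_adjoin : xInvariants n k hn hω hs
    = Algebra.adjoin 𝕜 {u k ω s, z k ω s, v k ω s ^ (2 * n), aElt n k hn hω hs} := by
  refine le_antisymm ?_ ?_
  · refine Subalgebra.toSubmodule.le_iff_le.mp ?_
    refine (xInvariants_le_span n k hn hω hs hprim).trans (Submodule.span_le.mpr ?_)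
    rintro _ ⟨m, rfl⟩
    obtain ⟨hu, hz, hv, ha⟩ : _ ∧ _ ∧ _ ∧ _ := by
      simpa only [Set.insert_subset_iff, Set.singleton_subset_iff, SetLike.mem_coe] using
        Algebra.subset_adjoin (R := 𝕜)
          (s := {u k ω s, z k ω s, v k ω s ^ (2 * n), aElt n k hn hω hs})
    rw [SetLike.mem_coe, Subalgebra.mem_toSubmodule, invMonomial, pow_mul _ (2 * n)]
    exact mul_mem (mul_mem (mul_mem (pow_mem hu _) (pow_mem hz _)) (pow_mem ha _)) (pow_mem hv _)
  · obtain ⟨hu, hz, hv, ha⟩ := invariant_gen n k hn hω hs hprim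
    rw [Algebra.adjoin_le_iff]
    rintro y (rfl | rfl | rfl | rfl)
    exacts [hu, hz, hv, ha]

theorem exists_algEquiv_xInvariants [IsAlgClosed 𝕜] (hq : (ω ^ k * s) ^ n = -1) :
    ∃ γ η : 𝕜, γ ≠ 0 ∧ η ≠ 0 ∧
      ∃ e : FactorAlg n (ω ^ k * s) ≃ₐ[𝕜] xInvariants n k hn hω hs,
        (e (FactorAlg.gen n (ω ^ k * s) FourGen.a) : TaftDownUp k ω s)
            = γ • aElt n k hn hω hs ∧
        (e (FactorAlg.gen n (ω ^ k * s) FourGen.b) : TaftDownUp k ω s) = u k ω s ∧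
        (e (FactorAlg.gen n (ω ^ k * s) FourGen.c) : TaftDownUp k ω s) = η • z k ω s ∧
        (e (FactorAlg.gen n (ω ^ k * s) FourGen.d) : TaftDownUp k ω s) = v k ω s ^ (2 * n) := by
  have h0 : ω ≠ 0 := hω.ne_zero (by omega)
  have hs0 : s ≠ 0 := hprim.ne_zero (by omega)
  have hq0 : ω ^ k * s ≠ 0 := mul_ne_zero (pow_ne_zero _ h0) hs0
  have hqr : ω ^ k * s * (ω⁻¹ ^ (k + 1) * s) = 1 := by
    rw [inv_pow, pow_succ, mul_mul_mul_comm, ← pow_two, hs]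
    field_simp
  have t := TaftDownUp.skewTriple k ω s
  obtain ⟨κ, hκ, haa⟩ := exists_aElt_sq k hn hω hs hprim
  have hau := aElt_mul_u k hn hω hs hprim
  have hl := repr_aElt_z_ne_zero k hn hω hs hprim
  set r := (basis k ω s).repr (aElt n k hn hω hs) ((0, n - 1), 1)
  -- `γ` normalizes the square of `w = aElt`, and then `η` normalizes the commutator of `u` and `w`
  obtain ⟨γ, hγ⟩ := IsAlgClosed.exists_pow_nat_eq κ⁻¹ (show 0 < 2 by norm_num)
  have hγ0 : γ ≠ 0 := by
    rintro rfl
    rw [zero_pow two_ne_zero, eq_comm, inv_eq_zero] at hγ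
    exact hκ hγ
  obtain ⟨η, hη⟩ := IsAlgClosed.exists_pow_nat_eq (-(γ * r)) (show 0 < n by omega)
  have hη0 : η ≠ 0 := by
    rintro rfl
    rw [zero_pow (by omega), eq_comm, neg_eq_zero] at hη
    exact mul_ne_zero hγ0 hl hη
  have hv : ∀ y, y * v k ω s ^ (2 * n) = v k ω s ^ (2 * n) * y := fun y =>
    (commute_v_pow k hn hs hprim y).symm.eq
  have tA : SkewTriple n 1 (ω ^ k * s) (γ • aElt n k hn hω hs) (u k ω s) (η • z k ω s) := by
    constructor
    · rw [smul_mul_smul_comm, smul_mul_smul_comm, z_mul_aElt k hn hω hs hprim, mul_comm η]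
      exact smul_comm _ _ _
    · rw [smul_mul_assoc, mul_smul_comm, t.ca, smul_comm η, smul_smul, hqr, one_smul]
    · rw [mul_smul_comm, smul_mul_assoc, hau, smul_pow, hη]
      match_scalars <;> ring
  let Φ : FactorAlg n (ω ^ k * s) →ₐ[𝕜] TaftDownUp k ω s := FactorAlg.lift tA
    (d := v k ω s ^ (2 * n)) (hv _) (hv _) (hv _) (by
      rw [smul_pow, haa, hγ, smul_smul, inv_mul_cancel₀ hκ, one_smul])
  have hΦ : ∀ i, Φ (FactorAlg.gen n (ω ^ k * s) i) = OreAlg.fourElements (γ • aElt n k hn hω hs)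
      (u k ω s) (η • z k ω s) (v k ω s ^ (2 * n)) i := FactorAlg.lift_gen tA _ _ _ _
  obtain ⟨iu, iz, iv, ia⟩ := invariant_gen n k hn hω hs hprim
  have hmem : ∀ x, Φ x ∈ xInvariants n k hn hω hs := by
    intro x
    have hx : x ∈ Algebra.adjoin 𝕜 _ := FactorAlg.adjoin_gen (𝕜 := 𝕜) ▸ Algebra.mem_top
    induction hx using Algebra.adjoin_induction with
    | mem x hx =>
      rcases hx with rfl | rfl | rfl | rfl <;> rw [hΦ]
      exacts [Subalgebra.smul_mem _ ia γ, Subalgebra.smul_mem _ iz η, iu, iv]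
    | algebraMap r => rw [AlgHom.commutes]; exact Subalgebra.algebraMap_mem _ r
    | add x y _ _ hx hy => rw [map_add]; exact add_mem hx hy
    | mul x y _ _ hx hy => rw [map_mul]; exact mul_mem hx hy
  have hmon : ∀ m, ∃ w : 𝕜ˣ, Φ (FactorAlg.monomial n (ω ^ k * s) m)
      = w • invMonomial n k hn hω hs m := by
    rintro ⟨⟨⟨i, j⟩, ε⟩, m⟩
    refine ⟨Units.mk0 ((ω ^ k * s * η) ^ j * γ ^ (ε : ℕ)) (mul_ne_zero
      (pow_ne_zero _ (mul_ne_zero hq0 hη0)) (pow_ne_zero _ hγ0)), ?_⟩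
    rw [Units.smul_mk0]
    simp only [FactorAlg.monomial, skewMonomial, map_mul, map_pow, map_smul, hΦ,
      OreAlg.fourElements, invMonomial, smul_smul, smul_pow, smul_mul_assoc, mul_smul_comm]
    rw [pow_mul (v k ω s) (2 * n) m]
    congr 1
    ring
  choose w hw using hmon
  have hcomp : Φ.toLinearMap ∘ FactorAlg.monomial n (ω ^ k * s)
      = w • invMonomial n k hn hω hs := funext hw
  have hinj : Function.Injective Φ :=
    LinearMap.injective_of_linearIndependent_comp Φ.toLinearMap _
      (FactorAlg.span_monomial hq hq0) (by
        rw [hcomp]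
        exact (linearIndependent_invMonomial n k hn hω hs hprim).units_smul w)
  have hsurj : Function.Surjective (Φ.codRestrict _ hmem) := by
    rintro ⟨y, hy⟩
    have h1 := xInvariants_le_span n k hn hω hs hprim hy
    have h2 : Submodule.span 𝕜 (Set.range (invMonomial n k hn hω hs))
        ≤ LinearMap.range Φ.toLinearMap := by
      rw [Submodule.span_le]
      rintro _ ⟨m, rfl⟩
      exact ⟨((w m)⁻¹ : 𝕜ˣ) • FactorAlg.monomial n (ω ^ k * s) m, by
        rw [Units.smul_def, map_smul, AlgHom.toLinearMap_apply, hw, ← Units.smul_def,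
          inv_smul_smul]⟩
    obtain ⟨x, hx⟩ := h2 h1
    exact ⟨x, Subtype.ext hx⟩
  refine ⟨γ, η, hγ0, hη0, AlgEquiv.ofBijective (Φ.codRestrict _ hmem)
    ⟨fun x y h => hinj (congrArg Subtype.val h), hsurj⟩, hΦ _, hΦ _, hΦ _, hΦ _⟩

end Basis

end TaftDownUp

theorem proposition5p14 {𝕜 : Type u} [Field 𝕜] [IsAlgClosed 𝕜] [CharZero 𝕜]
    (n k : ℕ) (hn : 2 ≤ n) (hk : k < n)
    (ω s : 𝕜) (hω : IsPrimitiveRoot ω n) (hs : s ^ 2 = ω) (hord : orderOf s = 2 * n) :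
    -- generators of `A^x`
    TaftDownUp.xInvariants n k hn hω hs =
        Algebra.adjoin 𝕜 {TaftDownUp.u k ω s, TaftDownUp.z k ω s, TaftDownUp.v k ω s ^ (2 * n), TaftDownUp.aElt n k hn hω hs} ∧
    -- the presentation of `A^x`
    (∃ γ η : 𝕜, γ ≠ 0 ∧ η ≠ 0 ∧
      ∃ e : FactorAlg n (ω ^ k * s) ≃ₐ[𝕜] TaftDownUp.xInvariants n k hn hω hs,
        (e (FactorAlg.gen n (ω ^ k * s) FourGen.a) : TaftDownUp k ω s)
            = γ • TaftDownUp.aElt n k hn hω hs ∧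
        (e (FactorAlg.gen n (ω ^ k * s) FourGen.b) : TaftDownUp k ω s) = TaftDownUp.u k ω s ∧
        (e (FactorAlg.gen n (ω ^ k * s) FourGen.c) : TaftDownUp k ω s) = η • TaftDownUp.z k ω s ∧
        (e (FactorAlg.gen n (ω ^ k * s) FourGen.d) : TaftDownUp k ω s) = TaftDownUp.v k ω s ^ (2 * n)) ∧
    -- the algebra without the last relation is AS regular of dimension four
    IsASRegular (OreAlg.grading n (ω ^ k * s)) 4 ∧
    -- and it is the iterated Ore extension `𝕜[a][c; σ][b; τ, δ][d]`
    OreAlg.IsIteratedOreExtension n (ω ^ k * s) ∧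
    -- the element `f` is homogeneous, regular and normal
    OreAlg.f n (ω ^ k * s) ∈ OreAlg.grading n (ω ^ k * s) (4 * n - 2) ∧
    IsRegular (OreAlg.f n (ω ^ k * s)) ∧
    (∀ r, ∃ t, OreAlg.f n (ω ^ k * s) * r = t * OreAlg.f n (ω ^ k * s)) ∧
    (∀ r, ∃ t, r * OreAlg.f n (ω ^ k * s) = OreAlg.f n (ω ^ k * s) * t) ∧
    -- and `A^x` is the factor by the two-sided ideal generated by `f`
    ∃ γ η : 𝕜, γ ≠ 0 ∧ η ≠ 0 ∧
      ∃ φ : OreAlg n (ω ^ k * s) →ₐ[𝕜] TaftDownUp.xInvariants n k hn hω hs,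
        Function.Surjective φ ∧
        TwoSidedIdeal.ker φ = TwoSidedIdeal.span {OreAlg.f n (ω ^ k * s)} ∧
        (φ (OreAlg.gen n (ω ^ k * s) FourGen.a) : TaftDownUp k ω s) = γ • TaftDownUp.aElt n k hn hω hs ∧
        (φ (OreAlg.gen n (ω ^ k * s) FourGen.b) : TaftDownUp k ω s) = TaftDownUp.u k ω s ∧
        (φ (OreAlg.gen n (ω ^ k * s) FourGen.c) : TaftDownUp k ω s) = η • TaftDownUp.z k ω s ∧
        (φ (OreAlg.gen n (ω ^ k * s) FourGen.d) : TaftDownUp k ω s) = TaftDownUp.v k ω s ^ (2 * n) := by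
  have hprim : IsPrimitiveRoot s (2 * n) := hord ▸ IsPrimitiveRoot.orderOf s
  have h0 : ω ≠ 0 := hω.ne_zero (by omega)
  have hq0 : ω ^ k * s ≠ 0 := mul_ne_zero (pow_ne_zero _ h0) (hprim.ne_zero (by omega))
  have hq : (ω ^ k * s) ^ n = -1 := by
    -- `s ^ n` is a square root of `1`, and not `1` itself since `s` has order `2n`
    have h1 : s ^ n = -1 := by
      have h2 : (s ^ n) ^ 2 = 1 := by rw [← pow_mul, mul_comm, hprim.pow_eq_one]
      refine (sq_eq_one_iff.mp h2).resolve_left fun h => ?_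
      have := Nat.le_of_dvd (by omega) ((hprim.pow_eq_one_iff_dvd n).mp h)
      omega
    rw [mul_pow, ← pow_mul, mul_comm k, pow_mul, hω.pow_eq_one, one_pow, one_mul, h1]
  have hn1 : 1 ≤ n := by omega
  obtain ⟨γ, η, hγ, hη, e, ea, eb, ec, ed⟩ :=
    TaftDownUp.exists_algEquiv_xInvariants n k hn hω hs hprim hq
  refine ⟨TaftDownUp.xInvariants_eq_adjoin n k hn hω hs hprim,
    ⟨γ, η, hγ, hη, e, ea, eb, ec, ed⟩, OreAlg.isASRegular _ hn1 hq0,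
    OreAlg.isIteratedOreExtension n _ hq0, OreAlg.f_mem hn1, OreAlg.isRegular_f hq hn1,
    fun r => ⟨_, OreAlg.f_mul hq hn1 r⟩,
    fun r => ⟨(OreAlg.twist hq hn1).symm r, by rw [OreAlg.f_mul hq hn1, AlgEquiv.apply_symm_apply]⟩,
    γ, η, hγ, hη, e.toAlgHom.comp (FactorAlg.ofOreAlg n _),
    e.surjective.comp (FactorAlg.ofOreAlg_surjective n _), ?_, ?_, ?_, ?_, ?_⟩
  · refine le_antisymm (fun x hx => ?_) (TwoSidedIdeal.span_le.mpr ?_)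
    · rw [TwoSidedIdeal.mem_ker] at hx
      exact FactorAlg.mem_span_f_of_ofOreAlg_eq_zero n _
        ((map_eq_zero_iff e e.injective).mp hx)
    · rintro _ rfl
      rw [SetLike.mem_coe, TwoSidedIdeal.mem_ker, AlgHom.comp_apply, FactorAlg.ofOreAlg_f, map_zero]
  all_goals
    rw [AlgHom.comp_apply, FactorAlg.ofOreAlg_gen]
    assumption
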